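/- Let $k$ be an algebraically closed field of characteristic $p>2$ and $n\ge 1$. Let $$\mathfrak g=\tilde{\mathfrak p}(n)=\left\{\begin{pmatrix}A&B\\ C&-A^{T}\end{pmatrix}\in\mathfrak{gl}(n|n)\ :\ B=B^{T},\ C=-C^{T}\right\}$$ be the periplectic Lie superalgebra over $k$, with even part $\mathfrak g_{\bar0}\cong\mathfrak{gl}(n)$ (the matrices with $B=C=0$) and odd part $\mathfrak g_{\bar 1}$ (the matrices with $A=0$), bracket $[x,y]=xy-(-1)^{|x||y|}yx$ for homogeneous $x,y$, and $p$-map $x^{[p]}=x^p$ (matrix power) on $\mathfrak g_{\bar0}$. Let $E_{a,b}$ be the matrix units of size $2n\times 2n$, let $\mathfrak h\subset\mathfrak g_{\bar 0}$ be the subspace where $A$ is diagonal, $\mathfrak n^+_{\bar0}\subset\mathfrak g_{\bar 0}$ the subspace where $A$ is strictly upper triangular, $\mathfrak g_1\subset\mathfrak g_{\bar 1}$ the subspace where $C=0$, and $\mathcal B=\mathfrak h\oplus\mathfrak n_{\bar0}^+\oplus\mathfrak g_1$. For a sub-superalgebra $\mathfrak a\subseteq\mathfrak g$ whose even part is closed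 under the $p$-map and for $\chi\in\mathfrak g_{\bar 0}^*$, let $U_\chi(\mathfrak a)$ be the quotient of the universal enveloping superalgebra $U(\mathfrak a)$ by the two-sided ideal generated by all $x^p-x^{[p]}-\chi(x)^p$ with $x\in\mathfrak a_{\bar0}$. Let $\chi\in\mathfrak g_{\bar0}^*$ be the regular nilpotent $p$-character in standard form, that is, with $X_{\epsilon_i-\epsilon_j}=E_{i,j}-E_{n+j,n+i}$ for $1\le i\neq j\le n$, $$\chi(X_{-(\epsilon_i-\epsilon_{i+1})})=1\quad(1\le i<n),$$ while $\chi$ vanishes on $\mathfrak h$ and on all other root vectors $X_{\epsilon_i-\epsilon_j}$. Let $$\Lambda(\chi)=\{\lambda\in\mathfrak h^*\ :\ \lambda(H)^p-\lambda(H^{[p]})=\chi(H)^p\ \text{ for all } H\in\mathfrak h\}.$$ For $\lambda\in\Lambda(\chi)$ let $k_\lambda$ be the one-dimensional (even) $U_\chi(\mathcal B)$-module on which $H\in\mathfrak h$ acts by $\lambda(H)$ and $\mathfrak n^+_{\bar0}\oplus\mathfrak g_1$ acts by zero, and let $$Z_\chi(\lambda)=U_\chi(\mathfrak g)\otimes_{U_\chi(\mathcal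 B)}k_\lambda$$ be the baby Verma module. Then for every $\lambda\in\Lambda(\chi)$ the $U_\chi(\mathfrak g)$-supermodule $Z_\chi(\lambda)$ is irreducible, i.e. it is nonzero and has no sub-supermodules other than $0$ and itself. -/

import Mathlib

open scoped TensorProduct

namespace Periplectic

/-! ### Restricted Lie sub-superalgebras of `gl(n|n)` -/

/-- The underlying space of `gl(n|n)`: matrices of size `2n × 2n`. -/
abbrev Mat (k : Type*) (n : ℕ) : Type _ := Matrix (Fin n ⊕ Fin n) (Fin n ⊕ Fin n) k

/-- The even part of `gl(n|n)`: block diagonal matrices. -/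
def glEven (k : Type*) [Field k] (n : ℕ) : Submodule k (Mat k n) where
  carrier := {X | X.toBlocks₁₂ = 0 ∧ X.toBlocks₂₁ = 0}
  zero_mem' := ⟨rfl, rfl⟩
  add_mem' := by
    rintro X Y ⟨h1, h2⟩ ⟨h3, h4⟩
    refine ⟨?_, ?_⟩
    · change X.toBlocks₁₂ + Y.toBlocks₁₂ = 0
      rw [h1, h3, add_zero]
    · change X.toBlocks₂₁ + Y.toBlocks₂₁ = 0
      rw [h2, h4, add_zero]
  smul_mem' := by
    rintro c X ⟨h1, h2⟩
    refine ⟨?_, ?_⟩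
    · change c • X.toBlocks₁₂ = 0
      rw [h1, smul_zero]
    · change c • X.toBlocks₂₁ = 0
      rw [h2, smul_zero]

/-- The odd part of `gl(n|n)`: block off-diagonal matrices. -/
def glOdd (k : Type*) [Field k] (n : ℕ) : Submodule k (Mat k n) where
  carrier := {X | X.toBlocks₁₁ = 0 ∧ X.toBlocks₂₂ = 0}
  zero_mem' := ⟨rfl, rfl⟩
  add_mem' := by
    rintro X Y ⟨h1, h2⟩ ⟨h3, h4⟩
    refine ⟨?_, ?_⟩
    · change X.toBlocks₁₁ + Y.toBlocks₁₁ = 0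
      rw [h1, h3, add_zero]
    · change X.toBlocks₂₂ + Y.toBlocks₂₂ = 0
      rw [h2, h4, add_zero]
  smul_mem' := by
    rintro c X ⟨h1, h2⟩
    refine ⟨?_, ?_⟩
    · change c • X.toBlocks₁₁ = 0
      rw [h1, smul_zero]
    · change c • X.toBlocks₂₂ = 0
      rw [h2, smul_zero]

/-- A restricted Lie sub-superalgebra of `gl(n|n)`, given by its even and its odd part: it is closed
under the super-bracket `[x, y] = x y - (-1)^{|x||y|} y x` and its even part is closed under the
`p`-map `x ↦ x ^ p` (the `p`-th power of matrices). -/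
@[ext]
structure RestrictedSubalgebra (k : Type*) [Field k] (n p : ℕ) where
  even : Submodule k (Mat k n)
  odd : Submodule k (Mat k n)
  even_le : even ≤ glEven k n
  odd_le : odd ≤ glOdd k n
  lie_even_even : ∀ x ∈ even, ∀ y ∈ even, x * y - y * x ∈ even
  lie_even_odd : ∀ x ∈ even, ∀ y ∈ odd, x * y - y * x ∈ odd
  lie_odd_odd : ∀ x ∈ odd, ∀ y ∈ odd, x * y + y * x ∈ even
  pow_mem : ∀ x ∈ even, x ^ p ∈ even

/-! ### Enveloping superalgebras and reduced enveloping superalgebras -/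

section Enveloping

variable {k : Type*} [Field k] {n p : ℕ}

/-- The inclusion of the even part into the tensor algebra of `𝔞 = 𝔞₀ ⊕ 𝔞₁`. -/
def tEven (𝔞 : RestrictedSubalgebra k n p) (x : 𝔞.even) : TensorAlgebra k (𝔞.even × 𝔞.odd) :=
  TensorAlgebra.ι k (x, 0)

/-- The inclusion of the odd part into the tensor algebra of `𝔞 = 𝔞₀ ⊕ 𝔞₁`. -/
def tOdd (𝔞 : RestrictedSubalgebra k n p) (y : 𝔞.odd) : TensorAlgebra k (𝔞.even × 𝔞.odd) :=
  TensorAlgebra.ι k (0, y)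

/-- The relations `x y - (-1)^{|x||y|} y x = [x, y]` of the universal enveloping superalgebra. -/
inductive EnvRel (𝔞 : RestrictedSubalgebra k n p) :
    TensorAlgebra k (𝔞.even × 𝔞.odd) → TensorAlgebra k (𝔞.even × 𝔞.odd) → Prop
  | even_even (x y : 𝔞.even) : EnvRel 𝔞 (tEven 𝔞 x * tEven 𝔞 y - tEven 𝔞 y * tEven 𝔞 x)
      (tEven 𝔞 ⟨x.1 * y.1 - y.1 * x.1, 𝔞.lie_even_even _ x.2 _ y.2⟩)
  | even_odd (x : 𝔞.even) (y : 𝔞.odd) : EnvRel 𝔞 (tEven 𝔞 x * tOdd 𝔞 y - tOdd 𝔞 y * tEven 𝔞 x)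
      (tOdd 𝔞 ⟨x.1 * y.1 - y.1 * x.1, 𝔞.lie_even_odd _ x.2 _ y.2⟩)
  | odd_odd (x y : 𝔞.odd) : EnvRel 𝔞 (tOdd 𝔞 x * tOdd 𝔞 y + tOdd 𝔞 y * tOdd 𝔞 x)
      (tEven 𝔞 ⟨x.1 * y.1 + y.1 * x.1, 𝔞.lie_odd_odd _ x.2 _ y.2⟩)

/-- The universal enveloping superalgebra `U(𝔞)`. -/
def Env (𝔞 : RestrictedSubalgebra k n p) : Type _ := RingQuot (EnvRel 𝔞)

instance (𝔞 : RestrictedSubalgebra k n p) : Ring (Env 𝔞) :=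
  inferInstanceAs (Ring (RingQuot (EnvRel 𝔞)))

instance (𝔞 : RestrictedSubalgebra k n p) : Algebra k (Env 𝔞) :=
  inferInstanceAs (Algebra k (RingQuot (EnvRel 𝔞)))

/-- The quotient map from the tensor algebra onto `U(𝔞)`. -/
def envMk (𝔞 : RestrictedSubalgebra k n p) :
    TensorAlgebra k (𝔞.even × 𝔞.odd) →ₐ[k] Env 𝔞 :=
  RingQuot.mkAlgHom k (EnvRel 𝔞)

/-- The image in `U(𝔞)` of an even element. -/
def uEven (𝔞 : RestrictedSubalgebra k n p) (x : 𝔞.even) : Env 𝔞 := envMk 𝔞 (tEven 𝔞 x)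

/-- The image in `U(𝔞)` of an odd element. -/
def uOdd (𝔞 : RestrictedSubalgebra k n p) (y : 𝔞.odd) : Env 𝔞 := envMk 𝔞 (tOdd 𝔞 y)

/-- The generators `x ^ p - x^{[p]} - χ(x) ^ p` (with `x` even) of the ideal `I_χ` of `U(𝔞)`. -/
inductive RedRel (𝔞 : RestrictedSubalgebra k n p) (χ : Module.Dual k 𝔞.even) :
    Env 𝔞 → Env 𝔞 → Prop
  | intro (x : 𝔞.even) : RedRel 𝔞 χ
      (uEven 𝔞 x ^ p - uEven 𝔞 ⟨x.1 ^ p, 𝔞.pow_mem _ x.2⟩ - algebraMap k (Env 𝔞) (χ x ^ p)) 0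

/-- The reduced enveloping superalgebra `U_χ(𝔞) = U(𝔞) / I_χ`. -/
def RedEnv (𝔞 : RestrictedSubalgebra k n p) (χ : Module.Dual k 𝔞.even) : Type _ :=
  RingQuot (RedRel 𝔞 χ)

instance (𝔞 : RestrictedSubalgebra k n p) (χ : Module.Dual k 𝔞.even) : Ring (RedEnv 𝔞 χ) :=
  inferInstanceAs (Ring (RingQuot (RedRel 𝔞 χ)))

instance (𝔞 : RestrictedSubalgebra k n p) (χ : Module.Dual k 𝔞.even) :
    Algebra k (RedEnv 𝔞 χ) :=
  inferInstanceAs (Algebra k (RingQuot (RedRel 𝔞 χ)))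

/-- The quotient map `U(𝔞) → U_χ(𝔞)`. -/
def redMk (𝔞 : RestrictedSubalgebra k n p) (χ : Module.Dual k 𝔞.even) :
    Env 𝔞 →ₐ[k] RedEnv 𝔞 χ :=
  RingQuot.mkAlgHom k (RedRel 𝔞 χ)

/-- The canonical map from the even part of `𝔞` to `U_χ(𝔞)`. -/
def rEven (𝔞 : RestrictedSubalgebra k n p) (χ : Module.Dual k 𝔞.even) :
    𝔞.even →ₗ[k] RedEnv 𝔞 χ where
  toFun x := redMk 𝔞 χ (uEven 𝔞 x)
  map_add' x y := by
    have h : ((x + y, 0) : 𝔞.even × 𝔞.odd) = (x, 0) + (y, 0) := by simp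
    simp only [uEven, tEven, h, map_add]
  map_smul' c x := by
    have h : ((c • x, 0) : 𝔞.even × 𝔞.odd) = c • (x, 0) := by simp
    simp only [uEven, tEven, h, map_smul, RingHom.id_apply]

/-- The canonical map from the odd part of `𝔞` to `U_χ(𝔞)`. -/
def rOdd (𝔞 : RestrictedSubalgebra k n p) (χ : Module.Dual k 𝔞.even) :
    𝔞.odd →ₗ[k] RedEnv 𝔞 χ where
  toFun y := redMk 𝔞 χ (uOdd 𝔞 y)
  map_add' x y := by
    have h : ((0, x + y) : 𝔞.even × 𝔞.odd) = (0, x) + (0, y) := by simp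
    simp only [uOdd, tOdd, h, map_add]
  map_smul' c x := by
    have h : ((0, c • x) : 𝔞.even × 𝔞.odd) = c • (0, x) := by simp
    simp only [uOdd, tOdd, h, map_smul, RingHom.id_apply]

/-- Monomials in homogeneous elements of `𝔞` inside `U_χ(𝔞)`, with their parity. -/
inductive IsMonomial (𝔞 : RestrictedSubalgebra k n p) (χ : Module.Dual k 𝔞.even) :
    ZMod 2 → RedEnv 𝔞 χ → Prop
  | one : IsMonomial 𝔞 χ 0 1
  | even_mul (x : 𝔞.even) {i : ZMod 2} {u : RedEnv 𝔞 χ} (hu : IsMonomial 𝔞 χ i u) :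
      IsMonomial 𝔞 χ i (rEven 𝔞 χ x * u)
  | odd_mul (y : 𝔞.odd) {i : ZMod 2} {u : RedEnv 𝔞 χ} (hu : IsMonomial 𝔞 χ i u) :
      IsMonomial 𝔞 χ (i + 1) (rOdd 𝔞 χ y * u)

/-- The homogeneous parts of the superalgebra `U_χ(𝔞)`. -/
def redEnvPart (𝔞 : RestrictedSubalgebra k n p) (χ : Module.Dual k 𝔞.even) (i : ZMod 2) :
    Submodule k (RedEnv 𝔞 χ) :=
  Submodule.span k {u | IsMonomial 𝔞 χ i u}

/-- Universal property of `U_χ(𝔞)`. -/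
def redEnvLift (𝔞 : RestrictedSubalgebra k n p) (χ : Module.Dual k 𝔞.even)
    {A : Type*} [Ring A] [Algebra k A] (f : 𝔞.even →ₗ[k] A) (g : 𝔞.odd →ₗ[k] A)
    (h00 : ∀ x y : 𝔞.even, f x * f y - f y * f x =
      f ⟨x.1 * y.1 - y.1 * x.1, 𝔞.lie_even_even _ x.2 _ y.2⟩)
    (h01 : ∀ (x : 𝔞.even) (y : 𝔞.odd), f x * g y - g y * f x =
      g ⟨x.1 * y.1 - y.1 * x.1, 𝔞.lie_even_odd _ x.2 _ y.2⟩)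
    (h11 : ∀ x y : 𝔞.odd, g x * g y + g y * g x =
      f ⟨x.1 * y.1 + y.1 * x.1, 𝔞.lie_odd_odd _ x.2 _ y.2⟩)
    (hp : ∀ x : 𝔞.even, f x ^ p - f ⟨x.1 ^ p, 𝔞.pow_mem _ x.2⟩ - algebraMap k A (χ x ^ p) = 0) :
    RedEnv 𝔞 χ →ₐ[k] A :=
  have h : ∀ ⦃a b⦄, EnvRel 𝔞 a b → TensorAlgebra.lift k (f.coprod g) a =
      TensorAlgebra.lift k (f.coprod g) b := by
    intro a b hab
    cases hab with
    | even_even x y => simpa [tEven, tOdd] using h00 x y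
    | even_odd x y => simpa [tEven, tOdd] using h01 x y
    | odd_odd x y => simpa [tEven, tOdd] using h11 x y
  let F : Env 𝔞 →ₐ[k] A := RingQuot.liftAlgHom k ⟨TensorAlgebra.lift k (f.coprod g), h⟩
  RingQuot.liftAlgHom k ⟨F, by
    have hF : ∀ x, F (uEven 𝔞 x) = f x := by
      intro x
      refine (RingQuot.liftAlgHom_mkAlgHom_apply k _ h _).trans ?_
      simp [tEven]
    intro a b hab
    cases hab with
    | intro x =>
      rw [map_sub, map_sub, map_pow, AlgHom.commutes, hF, hF, map_zero]
      exact hp x⟩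

/-- For a restricted subalgebra `𝔟` of `𝔞`, the canonical map `U_χ(𝔟) → U_χ(𝔞)`, where on the left
`χ` stands for its restriction to the even part of `𝔟`. -/
def redEnvMap (𝔟 𝔞 : RestrictedSubalgebra k n p) (h0 : 𝔟.even ≤ 𝔞.even) (h1 : 𝔟.odd ≤ 𝔞.odd)
    (χ : Module.Dual k 𝔞.even) :
    RedEnv 𝔟 (χ.comp (Submodule.inclusion h0)) →ₐ[k] RedEnv 𝔞 χ :=
  redEnvLift 𝔟 _ ((rEven 𝔞 χ).comp (Submodule.inclusion h0))
    ((rOdd 𝔞 χ).comp (Submodule.inclusion h1))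
    (by
      intro x y
      have := congrArg (redMk 𝔞 χ) (RingQuot.mkAlgHom_rel k
        (EnvRel.even_even (𝔞 := 𝔞) (Submodule.inclusion h0 x) (Submodule.inclusion h0 y)))
      change redMk 𝔞 χ (envMk 𝔞 _) = redMk 𝔞 χ (envMk 𝔞 _) at this
      simp only [map_sub, map_mul] at this
      exact this)
    (by
      intro x y
      have := congrArg (redMk 𝔞 χ) (RingQuot.mkAlgHom_rel k
        (EnvRel.even_odd (𝔞 := 𝔞) (Submodule.inclusion h0 x) (Submodule.inclusion h1 y)))
      change redMk 𝔞 χ (envMk 𝔞 _) = redMk 𝔞 χ (envMk 𝔞 _) at this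
      simp only [map_sub, map_mul] at this
      exact this)
    (by
      intro x y
      have := congrArg (redMk 𝔞 χ) (RingQuot.mkAlgHom_rel k
        (EnvRel.odd_odd (𝔞 := 𝔞) (Submodule.inclusion h1 x) (Submodule.inclusion h1 y)))
      change redMk 𝔞 χ (envMk 𝔞 _) = redMk 𝔞 χ (envMk 𝔞 _) at this
      simp only [map_add, map_mul] at this
      exact this)
    (by
      intro x
      have := RingQuot.mkAlgHom_rel k
        (RedRel.intro (𝔞 := 𝔞) (χ := χ) (Submodule.inclusion h0 x))
      change redMk 𝔞 χ _ = redMk 𝔞 χ _ at this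
      rw [map_sub, map_sub, map_pow, AlgHom.commutes, map_zero] at this
      exact this)

end Enveloping

/-- The induced module `S ⊗_B M` along a homomorphism `φ : B → S` of (not necessarily commutative)
`k`-algebras, where `B` acts on `M` through `ρ`: the quotient of the `S`-module `S ⊗_k M` by the
elements `s b ⊗ m - s ⊗ b m`. -/
abbrev Induced {k B S M : Type*} [Field k] [Ring B] [Algebra k B] [Ring S] [Algebra k S]
    [AddCommGroup M] [Module k M] (φ : B →ₐ[k] S) (ρ : B →ₐ[k] Module.End k M) : Type _ :=
  (S ⊗[k] M) ⧸ (Submodule.span S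
    {t : S ⊗[k] M | ∃ (s : S) (b : B) (m : M), t = (s * φ b) ⊗ₜ[k] m - s ⊗ₜ[k] (ρ b m)})

/-- Irreducibility of a supermodule `Z = Z₀ ⊕ Z₁` over `S`: it is nonzero and each of its
sub-supermodules (submodules `N` with `N = (N ∩ Z₀) + (N ∩ Z₁)`) is zero or the whole of `Z`. -/
def IsIrreducibleSupermodule {k : Type*} (S : Type*) {Z : Type*} [Field k] [Ring S]
    [AddCommGroup Z] [Module k Z] [Module S Z] (part : ZMod 2 → Submodule k Z) : Prop :=
  Nontrivial Z ∧ ∀ N : Submodule S Z,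
    (∀ z ∈ N, ∃ z₀ ∈ N, ∃ z₁ ∈ N, z₀ ∈ part 0 ∧ z₁ ∈ part 1 ∧ z = z₀ + z₁) → N = ⊥ ∨ N = ⊤

/-! ### The periplectic Lie superalgebra and its subalgebras -/

section Periplectic

variable (k : Type*) [Field k] (n : ℕ)

/-- The even element with blocks `A`, `0`, `0`, `-Aᵀ`. -/
def evenMat : Matrix (Fin n) (Fin n) k →ₗ[k] Mat k n where
  toFun A := Matrix.fromBlocks A 0 0 (-A.transpose)
  map_add' A B := by simp [Matrix.fromBlocks_add, add_comm]
  map_smul' c A := by simp [Matrix.fromBlocks_smul]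

lemma evenMat_apply (A : Matrix (Fin n) (Fin n) k) :
    evenMat k n A = Matrix.fromBlocks A 0 0 (-A.transpose) := rfl

/-- The space of all matrices with blocks `A`, `B`, `C`, `-Aᵀ` where `B = Bᵀ` and `C = -Cᵀ`. -/
def periSpace : Submodule k (Mat k n) where
  carrier := {X | ∃ A B C : Matrix (Fin n) (Fin n) k, B = B.transpose ∧ C = -C.transpose ∧
    X = Matrix.fromBlocks A B C (-A.transpose)}
  zero_mem' := ⟨0, 0, 0, by simp, by simp, by simp⟩
  add_mem' := by
    rintro _ _ ⟨A, B, C, hB, hC, rfl⟩ ⟨A', B', C', hB', hC', rfl⟩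
    refine ⟨A + A', B + B', C + C', ?_, ?_, ?_⟩
    · rw [Matrix.transpose_add, ← hB, ← hB']
    · rw [Matrix.transpose_add, neg_add, ← hC, ← hC']
    · rw [Matrix.fromBlocks_add, Matrix.transpose_add, neg_add]
  smul_mem' := by
    rintro c _ ⟨A, B, C, hB, hC, rfl⟩
    refine ⟨c • A, c • B, c • C, ?_, ?_, ?_⟩
    · rw [Matrix.transpose_smul, ← hB]
    · rw [Matrix.transpose_smul, ← smul_neg, ← hC]
    · rw [Matrix.fromBlocks_smul, Matrix.transpose_smul, smul_neg]

variable {k n}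

lemma mem_even_iff {X : Mat k n} :
    X ∈ periSpace k n ⊓ glEven k n ↔ ∃ A, X = evenMat k n A := by
  constructor
  · rintro ⟨⟨A, B, C, hB, hC, rfl⟩, h1, h2⟩
    rw [Matrix.toBlocks_fromBlocks₁₂] at h1
    rw [Matrix.toBlocks_fromBlocks₂₁] at h2
    subst h1 h2
    exact ⟨A, rfl⟩
  · rintro ⟨A, rfl⟩
    exact ⟨⟨A, 0, 0, by simp, by simp, rfl⟩, by simp [evenMat_apply], by simp [evenMat_apply]⟩

lemma mem_odd_iff {X : Mat k n} :
    X ∈ periSpace k n ⊓ glOdd k n ↔ ∃ B C : Matrix (Fin n) (Fin n) k,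
      B = B.transpose ∧ C = -C.transpose ∧ X = Matrix.fromBlocks 0 B C 0 := by
  constructor
  · rintro ⟨⟨A, B, C, hB, hC, rfl⟩, h1, h2⟩
    rw [Matrix.toBlocks_fromBlocks₁₁] at h1
    subst h1
    exact ⟨B, C, hB, hC, by simp⟩
  · rintro ⟨B, C, hB, hC, rfl⟩
    exact ⟨⟨0, B, C, hB, hC, by simp⟩, by simp, by simp⟩

lemma evenMat_lie (A B : Matrix (Fin n) (Fin n) k) :
    evenMat k n A * evenMat k n B - evenMat k n B * evenMat k n A =
      evenMat k n (A * B - B * A) := by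
  simp only [evenMat_apply, sub_eq_add_neg, Matrix.fromBlocks_multiply, Matrix.fromBlocks_neg,
    Matrix.fromBlocks_add]
  simp [add_comm]

lemma evenMat_pow {p : ℕ} [Fact p.Prime] [CharP k p] (A : Matrix (Fin n) (Fin n) k) :
    evenMat k n A ^ p = evenMat k n (A ^ p) := by
  have h : ∀ (B C : Matrix (Fin n) (Fin n) k) (m : ℕ),
      Matrix.fromBlocks B 0 0 C ^ m = Matrix.fromBlocks (B ^ m) 0 0 (C ^ m) := by
    intro B C m
    induction m with
    | zero => simp
    | succ m ih => simp [pow_succ, ih, Matrix.fromBlocks_multiply]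
  have h1 : (-A.transpose) ^ p = -(A ^ p).transpose := by
    rw [← neg_one_smul k A.transpose, smul_pow, neg_one_pow_char k p, Matrix.transpose_pow,
      neg_one_smul]
  simp only [evenMat_apply, h, h1]

lemma even_odd_lie (A B C : Matrix (Fin n) (Fin n) k) :
    evenMat k n A * Matrix.fromBlocks 0 B C 0 - Matrix.fromBlocks 0 B C 0 * evenMat k n A =
      Matrix.fromBlocks 0 (A * B + B * A.transpose) (-(A.transpose * C + C * A)) 0 := by
  simp only [evenMat_apply, sub_eq_add_neg, Matrix.fromBlocks_multiply, Matrix.fromBlocks_neg,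
    Matrix.fromBlocks_add]
  simp [add_comm]

lemma odd_odd_lie (B C B' C' : Matrix (Fin n) (Fin n) k)
    (hB : B = B.transpose) (hC : C = -C.transpose) (hB' : B' = B'.transpose)
    (hC' : C' = -C'.transpose) :
    (Matrix.fromBlocks 0 B C 0 * Matrix.fromBlocks 0 B' C' 0 +
      Matrix.fromBlocks 0 B' C' 0 * Matrix.fromBlocks 0 B C 0 : Mat k n) =
      evenMat k n (B * C' + B' * C) := by
  have h1 : C.transpose = -C := by rw [eq_neg_iff_add_eq_zero, add_comm, ← eq_neg_iff_add_eq_zero, ← hC]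
  have h2 : C'.transpose = -C' := by
    rw [eq_neg_iff_add_eq_zero, add_comm, ← eq_neg_iff_add_eq_zero, ← hC']
  rw [evenMat_apply, Matrix.transpose_add, Matrix.transpose_mul, Matrix.transpose_mul, ← hB, ← hB',
    h1, h2]
  simp [Matrix.fromBlocks_multiply, Matrix.fromBlocks_add, add_comm]

variable (k n)
variable (p : ℕ) [Fact p.Prime] [CharP k p]

/-- The periplectic Lie superalgebra `𝔤 = p̃(n)`. -/
def peri : RestrictedSubalgebra k n p where
  even := periSpace k n ⊓ glEven k n
  odd := periSpace k n ⊓ glOdd k n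
  even_le := inf_le_right
  odd_le := inf_le_right
  lie_even_even := by
    intro x hx y hy
    rw [mem_even_iff] at hx hy ⊢
    obtain ⟨A, rfl⟩ := hx
    obtain ⟨B, rfl⟩ := hy
    exact ⟨_, evenMat_lie A B⟩
  lie_even_odd := by
    intro x hx y hy
    rw [mem_even_iff] at hx
    rw [mem_odd_iff] at hy ⊢
    obtain ⟨A, rfl⟩ := hx
    obtain ⟨B, C, hB, hC, rfl⟩ := hy
    refine ⟨_, _, ?_, ?_, even_odd_lie A B C⟩
    · simp only [Matrix.transpose_add, Matrix.transpose_mul, Matrix.transpose_transpose, ← hB]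
      exact add_comm _ _
    · have h1 : C.transpose = -C := by
        rw [eq_neg_iff_add_eq_zero, add_comm, ← eq_neg_iff_add_eq_zero, ← hC]
      simp [Matrix.transpose_add, Matrix.transpose_mul, h1, add_comm]
  lie_odd_odd := by
    intro x hx y hy
    rw [mem_odd_iff] at hx hy
    rw [mem_even_iff]
    obtain ⟨B, C, hB, hC, rfl⟩ := hx
    obtain ⟨B', C', hB', hC', rfl⟩ := hy
    exact ⟨_, odd_odd_lie B C B' C' hB hC hB' hC'⟩
  pow_mem := by
    intro x hx
    rw [mem_even_iff] at hx ⊢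
    obtain ⟨A, rfl⟩ := hx
    exact ⟨_, evenMat_pow A⟩

/-- The standard maximal torus `𝔥`: even elements with diagonal block `A`. -/
def torus : Submodule k (Mat k n) :=
  (LinearMap.range (Matrix.diagonalLinearMap (Fin n) k k)).map (evenMat k n)

/-- Strictly upper triangular matrices. -/
def strictUpper : Submodule k (Matrix (Fin n) (Fin n) k) where
  carrier := {A | ∀ i j, j ≤ i → A i j = 0}
  zero_mem' := fun _ _ _ => rfl
  add_mem' := by
    intro A B hA hB i j hij
    rw [Matrix.add_apply, hA i j hij, hB i j hij, add_zero]
  smul_mem' := by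
    intro c A hA i j hij
    rw [Matrix.smul_apply, hA i j hij, smul_zero]

/-- `𝔫₀⁺`: even elements with strictly upper triangular block `A`. -/
def nPlus : Submodule k (Mat k n) := (strictUpper k n).map (evenMat k n)

/-- `𝔤₁`: matrices in `𝔤` with the only nonzero block `B`. -/
def gOne : Submodule k (Mat k n) where
  carrier := {X | ∃ B : Matrix (Fin n) (Fin n) k, B = B.transpose ∧
    X = Matrix.fromBlocks 0 B 0 0}
  zero_mem' := ⟨0, by simp, by simp⟩
  add_mem' := by
    rintro _ _ ⟨B, hB, rfl⟩ ⟨B', hB', rfl⟩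
    refine ⟨B + B', ?_, ?_⟩
    · rw [Matrix.transpose_add, ← hB, ← hB']
    · simp [Matrix.fromBlocks_add]
  smul_mem' := by
    rintro c _ ⟨B, hB, rfl⟩
    refine ⟨c • B, ?_, ?_⟩
    · rw [Matrix.transpose_smul, ← hB]
    · simp [Matrix.fromBlocks_smul]

variable {k n}

lemma evenMat_mem (A : Matrix (Fin n) (Fin n) k) : evenMat k n A ∈ (peri k n p).even :=
  mem_even_iff.2 ⟨A, rfl⟩

lemma torus_le : torus k n ≤ (peri k n p).even := by
  rintro _ ⟨A, -, rfl⟩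
  exact evenMat_mem p A

lemma nPlus_le : nPlus k n ≤ (peri k n p).even := by
  rintro _ ⟨A, -, rfl⟩
  exact evenMat_mem p A

lemma gOne_le : gOne k n ≤ (peri k n p).odd := by
  rintro _ ⟨B, hB, rfl⟩
  exact mem_odd_iff.2 ⟨B, 0, hB, by simp, rfl⟩

/-- An even element lies in `𝔥 ⊕ 𝔫₀⁺` if and only if its block `A` is upper triangular. -/
lemma mem_borelEven_iff {X : Mat k n} :
    X ∈ torus k n ⊔ nPlus k n ↔ ∃ A : Matrix (Fin n) (Fin n) k,
      (∀ i j, j < i → A i j = 0) ∧ X = evenMat k n A := by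
  constructor
  · intro h
    obtain ⟨_, ⟨_, ⟨d, rfl⟩, rfl⟩, _, ⟨N, hN, rfl⟩, rfl⟩ := Submodule.mem_sup.1 h
    refine ⟨Matrix.diagonal d + N, ?_, ?_⟩
    · intro i j hij
      rw [Matrix.add_apply, Matrix.diagonal_apply_ne _ hij.ne', hN i j hij.le, add_zero]
    · rw [map_add]
      rfl
  · rintro ⟨A, hA, rfl⟩
    refine Submodule.mem_sup.2 ⟨_, ⟨_, ⟨A.diag, rfl⟩, rfl⟩, _,
      ⟨A - Matrix.diagonal A.diag, ?_, rfl⟩, ?_⟩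
    · intro i j hij
      rcases hij.eq_or_lt with rfl | hij
      · simp
      · rw [Matrix.sub_apply, Matrix.diagonal_apply_ne _ hij.ne', hA i j hij, sub_zero]
    · rw [← map_add]
      congr 1
      exact add_sub_cancel _ _

lemma upper_mul {A B : Matrix (Fin n) (Fin n) k} (hA : ∀ i j, j < i → A i j = 0)
    (hB : ∀ i j, j < i → B i j = 0) :
    (∀ i j, j < i → (A * B) i j = 0) ∧ (A * B).diag = A.diag * B.diag := by
  constructor
  · intro i j hij
    rw [Matrix.mul_apply]
    refine Finset.sum_eq_zero fun l _ => ?_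
    rcases lt_or_ge l i with h | h
    · rw [hA i l h, zero_mul]
    · rw [hB l j (hij.trans_le h), mul_zero]
  · ext i
    rw [Matrix.diag_apply, Matrix.mul_apply, Finset.sum_eq_single i]
    · rfl
    · intro l _ hl
      rcases lt_or_gt_of_ne hl with h | h
      · rw [hA i l h, zero_mul]
      · rw [hB l i h, mul_zero]
    · simp

lemma upper_pow {A : Matrix (Fin n) (Fin n) k} (hA : ∀ i j, j < i → A i j = 0) (m : ℕ) :
    (∀ i j, j < i → (A ^ m) i j = 0) ∧ (A ^ m).diag = A.diag ^ m := by
  induction m with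
  | zero =>
    refine ⟨fun i j hij => ?_, ?_⟩
    · rw [pow_zero, Matrix.one_apply_ne hij.ne']
    · ext i
      simp
  | succ m ih =>
    have := upper_mul ih.1 hA
    refine ⟨by rw [pow_succ]; exact this.1, ?_⟩
    rw [pow_succ, this.2, ih.2, pow_succ]

variable (k n)

/-- The Borel subalgebra `𝓑 = 𝔥 ⊕ 𝔫₀⁺ ⊕ 𝔤₁`. -/
def borel : RestrictedSubalgebra k n p where
  even := torus k n ⊔ nPlus k n
  odd := gOne k n
  even_le := (sup_le (torus_le p) (nPlus_le p)).trans (peri k n p).even_le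
  odd_le := (gOne_le p).trans (peri k n p).odd_le
  lie_even_even := by
    intro x hx y hy
    rw [mem_borelEven_iff] at hx hy ⊢
    obtain ⟨A, hA, rfl⟩ := hx
    obtain ⟨B, hB, rfl⟩ := hy
    refine ⟨_, ?_, evenMat_lie A B⟩
    intro i j hij
    rw [Matrix.sub_apply, (upper_mul hA hB).1 i j hij, (upper_mul hB hA).1 i j hij, sub_zero]
  lie_even_odd := by
    intro x hx y hy
    rw [mem_borelEven_iff] at hx
    obtain ⟨A, hA, rfl⟩ := hx
    obtain ⟨B, hB, rfl⟩ := hy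
    refine ⟨A * B + B * A.transpose, ?_, ?_⟩
    · simp only [Matrix.transpose_add, Matrix.transpose_mul, Matrix.transpose_transpose, ← hB]
      exact add_comm _ _
    · rw [even_odd_lie]
      simp
  lie_odd_odd := by
    intro x hx y hy
    obtain ⟨B, hB, rfl⟩ := hx
    obtain ⟨B', hB', rfl⟩ := hy
    have h : (Matrix.fromBlocks 0 B 0 0 * Matrix.fromBlocks 0 B' 0 0 +
      Matrix.fromBlocks 0 B' 0 0 * Matrix.fromBlocks 0 B 0 0 : Mat k n) = 0 := by
      simp [Matrix.fromBlocks_multiply]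
    rw [h]
    exact zero_mem _
  pow_mem := by
    intro x hx
    rw [mem_borelEven_iff] at hx ⊢
    obtain ⟨A, hA, rfl⟩ := hx
    exact ⟨_, (upper_pow hA p).1, evenMat_pow A⟩

variable {k n p}

lemma borel_even_le : (borel k n p).even ≤ (peri k n p).even :=
  sup_le (torus_le p) (nPlus_le p)

lemma borel_odd_le : (borel k n p).odd ≤ (peri k n p).odd := gOne_le p

/-- The element of `𝔥` with diagonal entries `d` in its upper left block. -/
def torusMk : (Fin n → k) →ₗ[k] torus k n where
  toFun d := ⟨evenMat k n (Matrix.diagonal d), ⟨_, ⟨d, rfl⟩, rfl⟩⟩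
  map_add' d e := by
    ext1
    change evenMat k n _ = evenMat k n _ + evenMat k n _
    rw [← map_add, Matrix.diagonal_add]
    rfl
  map_smul' c d := by
    ext1
    change evenMat k n _ = c • evenMat k n _
    rw [← map_smul, ← Matrix.diagonal_smul]

lemma torus_pow_mem (H : torus k n) : H.1 ^ p ∈ torus k n := by
  obtain ⟨_, ⟨_, ⟨d, rfl⟩, rfl⟩⟩ := H
  refine ⟨_, ⟨d ^ p, rfl⟩, ?_⟩
  change evenMat k n (Matrix.diagonal (d ^ p)) = evenMat k n (Matrix.diagonal d) ^ p
  rw [evenMat_pow, Matrix.diagonal_pow]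

/-- `Λ(χ)`: the set of all `λ ∈ 𝔥*` with `λ(H)^p - λ(H^{[p]}) = χ(H)^p` for all `H ∈ 𝔥`. -/
def weightSet (χ : Module.Dual k (peri k n p).even) : Set (Module.Dual k (torus k n)) :=
  {μ | ∀ H : torus k n, μ H ^ p - μ ⟨H.1 ^ p, torus_pow_mem H⟩ =
    χ (Submodule.inclusion (torus_le p) H) ^ p}

/-- The condition `χ(𝔫₀⁺) = 0`. -/
def VanishesOnNPlus (χ : Module.Dual k (peri k n p).even) : Prop :=
  ∀ x : nPlus k n, χ (Submodule.inclusion (nPlus_le p) x) = 0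

/-- The root vector `E_{i,j} - E_{n+j,n+i}` of weight `ε_i - ε_j`. -/
def rootVec (i j : Fin n) : (peri k n p).even :=
  ⟨evenMat k n (Matrix.single i j 1), evenMat_mem p _⟩

/-- The regular nilpotent `p`-character in standard form: `χ(X_{-α}) = 1` for all simple roots
`α = ε_i - ε_{i+1}`, and `χ` vanishes on `𝔥` and on all the other root vectors. -/
structure IsStandardRegularNilpotent (χ : Module.Dual k (peri k n p).even) : Prop where
  neg_simple : ∀ i j : Fin n, (j : ℕ) = i + 1 → χ (rootVec j i) = 1
  other_roots : ∀ i j : Fin n, i ≠ j → (i : ℕ) ≠ j + 1 → χ (rootVec i j) = 0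
  torus_eq_zero : ∀ H : torus k n, χ (Submodule.inclusion (torus_le p) H) = 0

lemma IsStandardRegularNilpotent.vanishesOnNPlus {χ : Module.Dual k (peri k n p).even}
    (hχ : IsStandardRegularNilpotent χ) : VanishesOnNPlus χ := by
  rintro ⟨_, ⟨A, hA, rfl⟩⟩
  have h : Submodule.inclusion (nPlus_le p) ⟨evenMat k n A, ⟨A, hA, rfl⟩⟩ =
      ∑ i, ∑ j, A i j • (rootVec i j : (peri k n p).even) := by
    ext1
    simp only [Submodule.coe_inclusion, AddSubmonoidClass.coe_finsetSum, Submodule.coe_smul,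
      rootVec, ← map_smul, ← map_sum]
    congr 1
    conv_lhs => rw [Matrix.matrix_eq_sum_single A]
    simp [Matrix.smul_single]
  rw [h, map_sum]
  refine Finset.sum_eq_zero fun i _ => ?_
  rw [map_sum]
  refine Finset.sum_eq_zero fun j _ => ?_
  rw [map_smul]
  rcases le_or_gt j i with hij | hij
  · rw [hA i j hij, zero_smul]
  · rw [hχ.other_roots i j hij.ne, smul_zero]
    have := Fin.lt_def.1 hij
    omega

/-- The projection of `𝔥 ⊕ 𝔫₀⁺` onto `𝔥` along `𝔫₀⁺`. -/
def borelToTorus : (borel k n p).even →ₗ[k] torus k n :=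
  torusMk.comp
    ({ toFun := fun X i => X.1 (Sum.inl i) (Sum.inl i)
       map_add' := fun _ _ => rfl
       map_smul' := fun _ _ => rfl } : (borel k n p).even →ₗ[k] (Fin n → k))

lemma borelToTorus_mk (A : Matrix (Fin n) (Fin n) k) (h : evenMat k n A ∈ (borel k n p).even) :
    borelToTorus ⟨evenMat k n A, h⟩ = torusMk A.diag := rfl

/-- The character of `U_χ(𝓑)` by which it acts on the one-dimensional module `k_λ`:
`H ∈ 𝔥` acts by `λ(H)`, while `𝔫₀⁺` and `𝔤₁` act by zero. -/
def borelChar (χ : Module.Dual k (peri k n p).even) (hχ : VanishesOnNPlus χ)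
    (μ : weightSet χ) :
    RedEnv (borel k n p) (χ.comp (Submodule.inclusion borel_even_le)) →ₐ[k] k :=
  redEnvLift (borel k n p) _ (μ.1.comp borelToTorus) 0
    (by
      rintro ⟨x, hx⟩ ⟨y, hy⟩
      obtain ⟨A, hA, rfl⟩ := mem_borelEven_iff.1 hx
      obtain ⟨B, hB, rfl⟩ := mem_borelEven_iff.1 hy
      have h : borelToTorus ⟨evenMat k n A * evenMat k n B - evenMat k n B * evenMat k n A,
          (borel k n p).lie_even_even _ hx _ hy⟩ = 0 := by
        have h1 : (A * B - B * A).diag = 0 := by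
          rw [Matrix.diag_sub, (upper_mul hA hB).2, (upper_mul hB hA).2, mul_comm, sub_self]
        simp only [evenMat_lie, borelToTorus_mk, h1, map_zero]
      simp only [LinearMap.comp_apply, h, map_zero]
      ring)
    (by
      intro x y
      simp)
    (by
      rintro ⟨_, B, hB, rfl⟩ ⟨_, B', hB', rfl⟩
      have h : (Matrix.fromBlocks 0 B 0 0 * Matrix.fromBlocks 0 B' 0 0 +
        Matrix.fromBlocks 0 B' 0 0 * Matrix.fromBlocks 0 B 0 0 : Mat k n) = 0 := by
        simp [Matrix.fromBlocks_multiply]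
      simp only [h]
      have h0 : (⟨0, zero_mem _⟩ : (borel k n p).even) = 0 := rfl
      rw [h0, map_zero]
      simp)
    (by
      rintro ⟨x, hx⟩
      obtain ⟨A, hA, rfl⟩ := mem_borelEven_iff.1 hx
      have h1 : borelToTorus ⟨evenMat k n A ^ p, (borel k n p).pow_mem _ hx⟩ =
          ⟨(torusMk A.diag).1 ^ p, torus_pow_mem _⟩ := by
        ext1
        simp only [evenMat_pow, borelToTorus_mk, (upper_pow hA p).2]
        change evenMat k n (Matrix.diagonal (A.diag ^ p)) =
          evenMat k n (Matrix.diagonal A.diag) ^ p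
        rw [evenMat_pow, Matrix.diagonal_pow]
      have hN : evenMat k n (A - Matrix.diagonal A.diag) ∈ nPlus k n := by
        refine ⟨_, ?_, rfl⟩
        intro i j hij
        rcases hij.eq_or_lt with rfl | hij
        · simp
        · rw [Matrix.sub_apply, Matrix.diagonal_apply_ne _ hij.ne', hA i j hij, sub_zero]
      have h2 : Submodule.inclusion borel_even_le ⟨evenMat k n A, hx⟩ =
          Submodule.inclusion (torus_le p) (torusMk A.diag) +
            Submodule.inclusion (nPlus_le p) ⟨_, hN⟩ := by
        ext1
        change evenMat k n A = evenMat k n (Matrix.diagonal A.diag) +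
          evenMat k n (A - Matrix.diagonal A.diag)
        rw [← map_add, add_sub_cancel]
      have h3 := μ.2 (torusMk A.diag)
      simp only [LinearMap.comp_apply, h1, h2, map_add, hχ ⟨_, hN⟩, add_zero, borelToTorus_mk, h3,
        Algebra.algebraMap_self, RingHom.id_apply, sub_self])

/-- The one-dimensional module `k_λ` over `U_χ(𝓑)`. -/
def borelRep (χ : Module.Dual k (peri k n p).even) (hχ : VanishesOnNPlus χ)
    (μ : weightSet χ) :
    RedEnv (borel k n p) (χ.comp (Submodule.inclusion borel_even_le)) →ₐ[k] Module.End k k :=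
  (Algebra.lsmul k k k).comp (borelChar χ hχ μ)

/-- The baby Verma module `Z_χ(λ) = U_χ(𝔤) ⊗_{U_χ(𝓑)} k_λ`. -/
abbrev BabyVerma (χ : Module.Dual k (peri k n p).even) (hχ : VanishesOnNPlus χ)
    (μ : weightSet χ) : Type _ :=
  Induced (redEnvMap (borel k n p) (peri k n p) borel_even_le borel_odd_le χ) (borelRep χ hχ μ)

/-- The homogeneous parts of `Z_χ(λ)`: the images of `U_χ(𝔤)_i ⊗ k_λ`, with `k_λ` even. -/
def babyVermaPart (χ : Module.Dual k (peri k n p).even) (hχ : VanishesOnNPlus χ)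
    (μ : weightSet χ) (i : ZMod 2) : Submodule k (BabyVerma χ hχ μ) :=
  Submodule.span k {z | ∃ u ∈ redEnvPart (peri k n p) χ i, ∃ c : k,
    z = Submodule.Quotient.mk (u ⊗ₜ[k] c)}

end Periplectic

end Periplectic

/-!
The algebra `𝔤 = p̃(n)` is the sum of the Borel subalgebra `𝓑` and of `𝔪 = 𝔫₀⁻ ⊕ 𝔤₋₁`. The
irreducibility of `Z_χ(λ)` follows from a count: the reduced monomials in a basis of `𝔪` (exponents
below `p` for even and below `2` for odd basis elements) bound the dimension of `Z_χ(λ)` from above,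
and their number bounds the dimension of every nonzero submodule from below.

*Upper bound* (`span_reduced_eq_top`). Modulo shorter words, the letters of a word in elements of
`𝔤` applied to the generator supercommute; elements of `𝓑` act on the generator by scalars, and the
`p`-th power of an even, or the square of an odd, basis element of `𝔪` is a scalar.

*Lower bound* (`exists_whittaker_vector`, `linearIndepOn_reducedMultisets`). Give the basis vectors
of `k^{n|n}` the degrees `n-1, …, 0` and `-(n-1), …, 0`. In the resulting `ℤ`-grading of `𝔤` the
subalgebra `𝔪` is the part of negative degree, `𝓑` is the part of nonnegative degree, and `χ`,
extended by zero to `𝔤`, is concentrated in degree `-1`. Since `χ` is regular nilpotent, each basis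
element `y_a` of `𝔪`, say of degree `-d`, has a partner `z_a ∈ 𝓑` of degree `d - 1` with
`χ([y_a, z_b]) = δ_{ab}` (`IsStandardRegularNilpotent.char_bracket_dual`). The operators
`y_a - χ(y_a)` are nilpotent, so every nonzero submodule contains a Whittaker vector `w ≠ 0`, on
which they vanish. Filter the words in `𝓑` applied to `w` by giving weight `2 d + 1` to elements
of degree `d`. Then, up to terms of lower weight, `y_a - χ(y_a)` acts on words in the `z_b` as the
partial derivative with respect to `z_a` (`lowering_word`, `contraction_dual`), so that the reduced
monomials in the `z_b`, applied to `w`, are linearly independent.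

*Nonvanishing* (`babyVerma_nontrivial`). Without the PBW theorem, `Z_χ(λ) ≠ 0` is seen from a
representation of `U_χ(𝔤)`: the oscillator representation of `gl(n|n)` on the tensor product of a
reduced polynomial algebra `k[τ_{i,t}] / (τ_{i,t}^p - ε_{i,t})` with an exterior algebra. The
constants `ε_{i,t} ∈ {0, 1}` are chosen so that its `p`-character is `χ`; by Jacobson's formula
(`pow_sub_map_pow_add`) this only has to be checked on matrix units. A monomial in the `τ_{i,i}` is
a vector of weight `λ` annihilated by `𝔫₀⁺ ⊕ 𝔤₁`.
-/

noncomputable section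

namespace Periplectic

/-! ### Jacobson's formula for `p`-th powers -/

/-- The binomial coefficients `(p - 1).choose m` are `±1` modulo `p`. -/
lemma choose_pred_eq_neg_one_pow {R : Type*} [Ring R] (p : ℕ) [Fact p.Prime] [CharP R p] {m : ℕ}
    (hm : m < p) : ((p - 1).choose m : R) = (-1) ^ m := by
  have hp : p.Prime := Fact.out
  induction m with
  | zero => simp
  | succ m ih =>
    have h1 : (p - 1).choose m + (p - 1).choose (m + 1) = p.choose (m + 1) := by
      conv_rhs => rw [← Nat.sub_add_cancel hp.one_le]
      rw [Nat.choose_succ_succ]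
    have h2 : ((p.choose (m + 1) : ℕ) : R) = 0 :=
      (CharP.cast_eq_zero_iff R p _).2 (hp.dvd_choose_self (Nat.succ_ne_zero m) hm)
    rw [← h1, Nat.cast_add, ih (by omega)] at h2
    rw [pow_succ, mul_neg_one]
    exact (neg_eq_of_add_eq_zero_right h2).symm

/-- In characteristic `p` all coefficients of the expansion are `1`, because
`(p - 1).choose m = (-1) ^ m`. -/
lemma sub_pow_pred_of_commute {R : Type*} [Ring R] (p : ℕ) [Fact p.Prime] [CharP R p] {x y : R}
    (h : Commute x y) : (x - y) ^ (p - 1) = ∑ m ∈ Finset.range p, x ^ m * y ^ (p - 1 - m) := by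
  have hp : p.Prime := Fact.out
  rw [sub_eq_add_neg, h.neg_right.add_pow, Nat.sub_add_cancel hp.one_le]
  refine Finset.sum_congr rfl fun m hm => ?_
  have hm := Finset.mem_range.1 hm
  have h1 : (-1 : R) ^ (p - 1 - m) * (-1) ^ m = 1 := by
    rw [← pow_add, Nat.sub_add_cancel (by omega)]
    have := neg_one_pow_char R p
    rw [← Nat.sub_add_cancel hp.one_le, pow_succ, mul_neg_one, neg_inj] at this
    exact this
  rw [choose_pred_eq_neg_one_pow p hm, neg_pow y, mul_assoc, mul_assoc,
    ((Commute.neg_one_left (y ^ (p - 1 - m))).pow_left m).symm.eq, ← mul_assoc ((-1) ^ _), h1, one_mul]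

section Jacobson
open Polynomial
variable {k : Type*} [Field k] {C : Type*} [Ring C] [Algebra k C]

lemma derivative_pow_noncomm (P : C[X]) (m : ℕ) :
    derivative (P ^ m) = ∑ j ∈ Finset.range m, P ^ j * derivative P * P ^ (m - 1 - j) := by
  induction m with
  | zero => simp
  | succ m ih =>
    rw [pow_succ, derivative_mul, ih, Finset.sum_range_succ, Finset.sum_mul]
    congr 1
    · refine Finset.sum_congr rfl fun j hj => ?_
      have := Finset.mem_range.1 hj
      rw [mul_assoc, ← pow_succ]
      congr 2
      omega
    · simp

/-- **Jacobson's formula**, in qualitative form: in characteristic `p` the expression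
`(x + y) ^ p - x ^ p - y ^ p` is a Lie polynomial in `x` and `y`. The coefficient of `t ^ i` in
`(t x + y) ^ p` is computed from the derivative `ad (t x + y) ^ (p - 1) (x)`. -/
theorem add_pow_sub_mem_of_lie_closed (p : ℕ) [Fact p.Prime] [CharP k p] (S : Submodule k C)
    (hS : ∀ x ∈ S, ∀ y ∈ S, x * y - y * x ∈ S) {x y : C} (hx : x ∈ S) (hy : y ∈ S) :
    (x + y) ^ p - x ^ p - y ^ p ∈ S := by
  rcases subsingleton_or_nontrivial C with hC | hC
  · rw [Subsingleton.elim ((x + y) ^ p - x ^ p - y ^ p) 0]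
    exact zero_mem _
  have hp : p.Prime := Fact.out
  set P : C[X] := Polynomial.C x * X + Polynomial.C y with hP
  have hdP : derivative P = Polynomial.C x := by simp [hP]
  -- As the variable is central, bracketing with `P` preserves coefficients in `S`.
  have hcoeff0 : ∀ Q : C[X], (∀ i, Q.coeff i ∈ S) → ∀ i, (P * Q - Q * P).coeff i ∈ S := by
    intro Q hQ i
    have h1 : P * Q - Q * P = (Polynomial.C x * Q - Q * Polynomial.C x) * X
        + (Polynomial.C y * Q - Q * Polynomial.C y) := by
      have hXQ : X * Q = Q * X := X_mul
      rw [hP, add_mul, mul_add, mul_assoc _ X, hXQ, sub_mul]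
      simp only [mul_assoc]
      abel
    rw [h1, coeff_add]
    refine S.add_mem ?_ ?_
    · cases i with
      | zero => simp
      | succ i =>
        rw [coeff_mul_X, coeff_sub, coeff_C_mul, coeff_mul_C]
        exact hS _ hx _ (hQ i)
    · rw [coeff_sub, coeff_C_mul, coeff_mul_C]
      exact hS _ hy _ (hQ i)
  have : CharP (Module.End k C[X]) p := charP_of_injective_algebraMap
    (algebraMap k (Module.End k C[X])).injective p
  -- `(L - R) ^ (p - 1) = ∑ L ^ j R ^ (p - 1 - j)` for left and right multiplication by `P`.
  have hD : derivative (P ^ p) =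
      ((LinearMap.mulLeft k P - LinearMap.mulRight k P) ^ (p - 1)) (Polynomial.C x) := by
    rw [sub_pow_pred_of_commute p (LinearMap.commute_mulLeft_right ..), derivative_pow_noncomm,
      LinearMap.sum_apply, hdP]
    refine Finset.sum_congr rfl fun j _ => ?_
    rw [Module.End.mul_apply, LinearMap.pow_mulLeft, LinearMap.pow_mulRight,
      LinearMap.mulLeft_apply, LinearMap.mulRight_apply, mul_assoc]
  have hDS : ∀ i, (derivative (P ^ p)).coeff i ∈ S := by
    rw [hD]
    generalize p - 1 = m
    induction m with
    | zero =>
      intro i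
      rw [pow_zero, Module.End.one_apply, coeff_C]
      split_ifs
      exacts [hx, zero_mem _]
    | succ m ih =>
      rw [pow_succ', Module.End.mul_apply]
      exact hcoeff0 _ ih
  -- The inner coefficients are recovered from the derivative, as `i + 1` is invertible.
  have hmid : ∀ i, i + 1 < p → (P ^ p).coeff (i + 1) ∈ S := by
    intro i hi
    have h1 := hDS i
    rw [coeff_derivative] at h1
    have h2 : ((i + 1 : ℕ) : k) ≠ 0 := by
      rw [Ne, CharP.cast_eq_zero_iff k p]
      exact Nat.not_dvd_of_pos_of_lt (Nat.succ_pos i) hi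
    have h3 : (P ^ p).coeff (i + 1) * ((i : C) + 1) =
        ((i + 1 : ℕ) : k) • (P ^ p).coeff (i + 1) := by
      rw [Nat.cast_smul_eq_nsmul, nsmul_eq_mul, Nat.cast_comm]
      push_cast
      rfl
    rw [h3] at h1
    exact (S.smul_mem_iff h2).1 h1
  have hdeg : P.natDegree ≤ 1 := natDegree_linear_le
  have hdegp : (P ^ p).natDegree < p + 1 := by
    have := natDegree_pow_le_of_le p hdeg
    omega
  have htop : (P ^ p).coeff p = x ^ p := by
    have := coeff_pow_of_natDegree_le (m := p) hdeg
    rw [mul_one] at this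
    rw [this, hP]
    simp
  have hbot : (P ^ p).coeff 0 = y ^ p := by
    have : constantCoeff (P ^ p) = constantCoeff P ^ p := map_pow _ _ _
    simpa [hP] using this
  have hev : (x + y) ^ p = (P ^ p).eval 1 := by
    have h := map_pow (eval₂RingHom' (RingHom.id C) 1 (fun a => Commute.one_right _)) P p
    have h1 : (eval₂RingHom' (RingHom.id C) 1 (fun a => Commute.one_right _)) P = x + y := by
      rw [hP, map_add, map_mul]
      change eval₂ _ _ _ * eval₂ _ _ _ + eval₂ _ _ _ = _
      simp
    rw [h1] at h
    exact h.symm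
  rw [hev, eval_eq_sum_range' hdegp, Finset.sum_range_succ, htop]
  obtain ⟨q, hq⟩ : ∃ q, p = q + 1 := ⟨p - 1, (Nat.sub_add_cancel hp.one_le).symm⟩
  rw [one_pow, mul_one, add_sub_cancel_right]
  nth_rw 1 [hq]
  rw [Finset.sum_range_succ', hbot, pow_zero, mul_one, add_sub_cancel_right]
  refine S.sum_mem fun i hi => ?_
  rw [one_pow, mul_one]
  exact hmid i (by have := Finset.mem_range.1 hi; omega)

/-- For a linear map `φ` compatible with commutators, `φ (x) ^ p - φ (x ^ p)` is additive in `x`: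
apply Jacobson's formula to the graph of `φ`. -/
lemma pow_sub_map_pow_add (p : ℕ) [Fact p.Prime] [CharP k p] {B : Type*} [Ring B] [Algebra k B]
    (φ : B →ₗ[k] C) (hφ : ∀ x y, φ x * φ y - φ y * φ x = φ (x * y - y * x)) (x y : B) :
    φ (x + y) ^ p - φ ((x + y) ^ p) = (φ x ^ p - φ (x ^ p)) + (φ y ^ p - φ (y ^ p)) := by
  have h := add_pow_sub_mem_of_lie_closed p (LinearMap.range (LinearMap.id.prod φ))
    (by
      rintro _ ⟨x, rfl⟩ _ ⟨y, rfl⟩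
      exact ⟨x * y - y * x, Prod.ext rfl (hφ x y).symm⟩)
    (x := (x, φ x)) (y := (y, φ y)) ⟨x, rfl⟩ ⟨y, rfl⟩
  obtain ⟨z, hz⟩ := h
  have h1 : z = (x + y) ^ p - x ^ p - y ^ p := congrArg Prod.fst hz
  have h2 : φ z = (φ x + φ y) ^ p - φ x ^ p - φ y ^ p := congrArg Prod.snd hz
  rw [h1, map_sub, map_sub] at h2
  rw [map_add φ x y, ← sub_eq_zero]
  rw [← sub_eq_zero] at h2
  rw [← neg_eq_zero, ← h2]
  abel

end Jacobson

/-! ### Reduced polynomial algebras -/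

section TruncatedPolynomials
open MvPolynomial

variable {k : Type*} [Field k] {σ : Type*} (p : ℕ) (ε : σ → k)

/-- The ideal of `k[τ_s]` generated by all `τ_s ^ p - ε_s`. -/
def powIdeal : Ideal (MvPolynomial σ k) :=
  Ideal.span (Set.range fun s => (X s : MvPolynomial σ k) ^ p - C (ε s))

/-- The reduced polynomial algebra `k[τ_s] / (τ_s ^ p - ε_s)`. -/
def RedPoly : Type _ := MvPolynomial σ k ⧸ powIdeal p ε

instance : CommRing (RedPoly p ε) := inferInstanceAs (CommRing (MvPolynomial σ k ⧸ powIdeal p ε))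

instance : Algebra k (RedPoly p ε) := inferInstanceAs (Algebra k (MvPolynomial σ k ⧸ powIdeal p ε))

/-- The quotient map onto the reduced polynomial algebra. -/
def redPolyMk : MvPolynomial σ k →ₐ[k] RedPoly p ε := Ideal.Quotient.mkₐ k (powIdeal p ε)

lemma redPolyMk_surjective : Function.Surjective (redPolyMk p ε) := Ideal.Quotient.mk_surjective

/-- Multiplication by the variable `τ_s`. -/
def mulVar (s : σ) : Module.End k (RedPoly p ε) :=
  LinearMap.mulLeft k (redPolyMk p ε (X s))

lemma mulVar_pow (s : σ) : mulVar p ε s ^ p = algebraMap k _ (ε s) := by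
  rw [mulVar, LinearMap.pow_mulLeft, ← map_pow]
  have h : redPolyMk p ε (X s ^ p) = algebraMap k _ (ε s) :=
    Ideal.Quotient.eq.2 (Ideal.subset_span ⟨s, rfl⟩)
  rw [h]
  refine LinearMap.ext fun q => ?_
  rw [LinearMap.mulLeft_apply, Module.algebraMap_end_apply, Algebra.smul_def]

lemma mulVar_comm (s s' : σ) : mulVar p ε s * mulVar p ε s' = mulVar p ε s' * mulVar p ε s := by
  refine LinearMap.ext fun q => ?_
  simp only [mulVar, Module.End.mul_apply, LinearMap.mulLeft_apply]
  ring

/-- A linear operator commuting with all variables is determined by its value at `1`. -/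
lemma eq_of_commute_mulVar {S T : Module.End k (RedPoly p ε)}
    (hS : ∀ s, S * mulVar p ε s = mulVar p ε s * S)
    (hT : ∀ s, T * mulVar p ε s = mulVar p ε s * T) (h1 : S 1 = T 1) : S = T := by
  refine LinearMap.ext fun q => ?_
  obtain ⟨q, rfl⟩ := redPolyMk_surjective p ε q
  induction q using MvPolynomial.induction_on with
  | C a =>
    have : redPolyMk p ε (C a) = a • (1 : RedPoly p ε) := by
      rw [Algebra.smul_def, mul_one]
      exact (redPolyMk p ε).commutes a
    rw [this, map_smul, map_smul, h1]
  | add f g hf hg => rw [map_add, map_add, map_add, hf, hg]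
  | mul_X f s hf =>
    have h2 : redPolyMk p ε (f * X s) =
        mulVar p ε s (redPolyMk p ε f) := by
      rw [mul_comm, map_mul]
      rfl
    rw [h2, ← Module.End.mul_apply, ← Module.End.mul_apply, hS, hT, Module.End.mul_apply,
      Module.End.mul_apply, hf]

/-- If all `ε_s` lie in the prime field, `τ_s ↦ ε_s` is a character of the reduced polynomial
algebra. -/
def redPolyEval (hε : ∀ s, ε s ^ p = ε s) : RedPoly p ε →ₐ[k] k :=
  Ideal.Quotient.liftₐ (powIdeal p ε) (MvPolynomial.aeval ε) (by
    intro f hf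
    refine (Ideal.span_le (I := RingHom.ker (MvPolynomial.aeval ε))).2 ?_ hf
    rintro _ ⟨s, rfl⟩
    simp [RingHom.mem_ker, hε])

lemma redPolyEval_mk (hε : ∀ s, ε s ^ p = ε s) (f : MvPolynomial σ k) :
    redPolyEval p ε hε (redPolyMk p ε f) = MvPolynomial.aeval ε f := rfl

lemma pderiv_mem_powIdeal [CharP k p] (s : σ) {f : MvPolynomial σ k} (hf : f ∈ powIdeal p ε) :
    pderiv s f ∈ powIdeal p ε := by
  refine Submodule.span_induction (p := fun f _ => pderiv s f ∈ powIdeal p ε)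
    ?_ ?_ ?_ ?_ hf
  · rintro _ ⟨t, rfl⟩
    rw [map_sub, pderiv_C, pderiv_pow, CharP.cast_eq_zero]
    simp
  · simp
  · intro f g _ _ hf hg
    rw [map_add]
    exact add_mem hf hg
  · intro a f hf' hf
    rw [smul_eq_mul, pderiv_mul]
    exact add_mem (Ideal.mul_mem_left _ _ hf') (Ideal.mul_mem_left _ _ hf)

variable [CharP k p]

/-- The partial derivative `∂ / ∂τ_s` of the reduced polynomial algebra. -/
def redDeriv (s : σ) : Module.End k (RedPoly p ε) :=
  ((Submodule.liftQ ((powIdeal p ε).restrictScalars k)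
    ((redPolyMk p ε).toLinearMap ∘ₗ (pderiv s).toLinearMap)
    (fun _ hf => Ideal.Quotient.eq_zero_iff_mem.2 (pderiv_mem_powIdeal p ε s hf)))) ∘ₗ
  (Submodule.Quotient.restrictScalarsEquiv k (powIdeal p ε)).symm.toLinearMap

lemma redDeriv_mk (s : σ) (f : MvPolynomial σ k) :
    redDeriv p ε s (redPolyMk p ε f) = redPolyMk p ε (pderiv s f) := rfl

lemma redDeriv_one (s : σ) : redDeriv p ε s 1 = 0 := by
  rw [← map_one (redPolyMk p ε), redDeriv_mk]
  simp

lemma redDeriv_mulVar [DecidableEq σ] (s s' : σ) : redDeriv p ε s * mulVar p ε s' =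
    mulVar p ε s' * redDeriv p ε s + if s = s' then 1 else 0 := by
  refine LinearMap.ext fun q => ?_
  obtain ⟨q, rfl⟩ := redPolyMk_surjective p ε q
  simp only [mulVar, Module.End.mul_apply, LinearMap.mulLeft_apply, LinearMap.add_apply]
  rw [← map_mul, redDeriv_mk, redDeriv_mk, pderiv_mul, map_add, map_mul, map_mul, add_comm]
  congr 1
  rw [pderiv_X]
  split_ifs with h
  · subst h; simp
  · simp [Pi.single_eq_of_ne (Ne.symm h)]

lemma redDeriv_comm (s s' : σ) :
    redDeriv p ε s * redDeriv p ε s' = redDeriv p ε s' * redDeriv p ε s := by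
  classical
  rw [← sub_eq_zero]
  refine eq_of_commute_mulVar p ε (fun t => ?_) (fun t => by simp) ?_
  · -- The commutator of two derivations commutes with the variables and annihilates `1`.
    rw [sub_mul, mul_assoc, redDeriv_mulVar, mul_assoc (redDeriv p ε s'), redDeriv_mulVar, mul_add,
      mul_add, ← mul_assoc, ← mul_assoc, redDeriv_mulVar, redDeriv_mulVar, mul_sub]
    split_ifs <;> (simp [add_mul, mul_assoc]; try abel)
  · simp [redDeriv_one]

variable [Fact p.Prime]

instance charP_end {V : Type*} [AddCommGroup V] [Module k V] [Nontrivial V] :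
    CharP (Module.End k V) p :=
  charP_of_injective_algebraMap (algebraMap k (Module.End k V)).injective p

/-- `∂ ^ p` commutes with the variables, because `[∂ ^ m, τ] = m ∂ ^ (m - 1)`, and annihilates `1`. -/
lemma redDeriv_pow (s : σ) : redDeriv p ε s ^ p = 0 := by
  classical
  have hp : p.Prime := Fact.out
  refine eq_of_commute_mulVar p ε (fun t => ?_) (fun t => by simp) ?_
  · have h : ∀ m : ℕ, redDeriv p ε s ^ m * mulVar p ε t = mulVar p ε t * redDeriv p ε s ^ m +
        (m : k) • if s = t then redDeriv p ε s ^ (m - 1) else 0 := by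
      intro m
      induction m with
      | zero => simp
      | succ m ih =>
        rw [pow_succ, mul_assoc, redDeriv_mulVar, mul_add, ← mul_assoc, ih, add_mul, mul_assoc]
        split_ifs
        · cases m with
          | zero => simp
          | succ m =>
            rw [add_assoc]
            congr 1
            rw [Nat.add_sub_cancel, Nat.add_sub_cancel, smul_mul_assoc, ← pow_succ, mul_one]
            push_cast
            simp only [add_smul, one_smul]
        · simp
    rw [h, CharP.cast_eq_zero, zero_smul, add_zero]
  · rw [← pow_sub_one_mul hp.ne_zero, Module.End.mul_apply, redDeriv_one, map_zero,
      LinearMap.zero_apply]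

/-- The Euler operator `θ = τ ∂ / ∂τ` is semisimple with eigenvalues in the prime field: `θ ^ p - θ`
commutes with the variables, because `θ τ = τ (θ + 1)`, and annihilates `1`. -/
lemma mulVar_redDeriv_pow [Nontrivial (RedPoly p ε)] (s : σ) :
    (mulVar p ε s * redDeriv p ε s) ^ p = mulVar p ε s * redDeriv p ε s := by
  classical
  have hp : p.Prime := Fact.out
  set θ := mulVar p ε s * redDeriv p ε s with hθ
  have h1 : ∀ t, θ * mulVar p ε t = mulVar p ε t * (θ + if s = t then 1 else 0) := by
    intro t
    rw [hθ, mul_assoc, redDeriv_mulVar, mul_add, ← mul_assoc, mulVar_comm, mul_assoc, mul_add]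
    split_ifs with h
    · subst h; rfl
    · simp
  have h2 : ∀ (t : σ) (m : ℕ), θ ^ m * mulVar p ε t =
      mulVar p ε t * (θ + if s = t then 1 else 0) ^ m := by
    intro t m
    induction m with
    | zero => simp
    | succ m ih => rw [pow_succ, mul_assoc, h1, ← mul_assoc, ih, mul_assoc, ← pow_succ]
  rw [← sub_eq_zero]
  refine eq_of_commute_mulVar p ε (fun t => ?_) (fun t => by simp) ?_
  · have h3 : Commute θ (if s = t then 1 else 0) := by
      split_ifs
      exacts [Commute.one_right _, Commute.zero_right _]
    have h4 : (if s = t then (1 : Module.End k (RedPoly p ε)) else 0) ^ p =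
        if s = t then 1 else 0 := by
      split_ifs
      exacts [one_pow p, zero_pow hp.ne_zero]
    rw [sub_mul, h2, h1, add_pow_char_of_commute _ h3, h4, ← mul_sub, add_sub_add_right_eq_sub]
  · have h3 : θ 1 = 0 := by rw [hθ, Module.End.mul_apply, redDeriv_one, map_zero]
    rw [LinearMap.sub_apply, ← pow_sub_one_mul hp.ne_zero, Module.End.mul_apply, h3, map_zero,
      sub_zero, LinearMap.zero_apply]

end TruncatedPolynomials

/-! ### Oscillator representations of `gl(m|n)` -/

section Oscillator

variable {k : Type*} [Field k] {I T : Type*} [DecidableEq I]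
  {C : Type*} [Ring C] [Algebra k C]

/-- The sign `(-1) ^ (a b)` of two parities. -/
def koszul (k : Type*) [Field k] (a b : Bool) : k := if a && b then -1 else 1

/-- A family of super oscillators in the algebra `C`: creation operators `Z i t` and annihilation
operators `D i t`, of parity `odd i`, satisfying the super canonical commutation relations. -/
structure Oscillators [DecidableEq T] (odd : I → Bool) (Z D : I → T → C) : Prop where
  zz : ∀ i j t u, Z i t * Z j u = koszul k (odd i) (odd j) • (Z j u * Z i t)
  dd : ∀ i j t u, D i t * D j u = koszul k (odd i) (odd j) • (D j u * D i t)
  dz : ∀ i j t u, D i t * Z j u =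
    koszul k (odd i) (odd j) • (Z j u * D i t) + if i = j ∧ t = u then 1 else 0

/-- The oscillator representation of matrices: the matrix unit `E_{i,j}` acts by
`∑ t, Z i t * D j t`. -/
def oscRep [Fintype I] [Fintype T] (k : Type*) [Field k] [Algebra k C] (Z D : I → T → C) :
    Matrix I I k →ₗ[k] C where
  toFun X := ∑ i, ∑ j, X i j • ∑ t, Z i t * D j t
  map_add' X Y := by simp only [Matrix.add_apply, add_smul, Finset.sum_add_distrib]
  map_smul' c X := by
    simp only [Matrix.smul_apply, smul_assoc, Finset.smul_sum, RingHom.id_apply]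

lemma oscRep_single [Fintype I] [Fintype T] (Z D : I → T → C) (i j : I) (a : k) :
    oscRep k Z D (Matrix.single i j a) = a • ∑ t, Z i t * D j t := by
  change ∑ i', ∑ j', Matrix.single i j a i' j' • ∑ t, Z i' t * D j' t = _
  rw [Finset.sum_eq_single i, Finset.sum_eq_single j, Matrix.single_apply_same]
  · intro j' _ h
    rw [Matrix.single_apply_of_col_ne _ _ (Ne.symm h), zero_smul]
  · simp
  · intro i' _ h
    exact Finset.sum_eq_zero fun j' _ => by
      rw [Matrix.single_apply_of_row_ne (Ne.symm h), zero_smul]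
  · simp

variable {odd : I → Bool} {Z D : I → T → C}

/-- The super-bracket of two quadratic expressions in the oscillators: the quartic terms cancel. -/
lemma Oscillators.bracket_unit [DecidableEq T] (h : Oscillators (k := k) odd Z D) (i j l m : I)
    (t u : T) :
    Z i t * D j t * (Z l u * D m u) - koszul k (odd i ^^ odd j) (odd l ^^ odd m) •
      (Z l u * D m u * (Z i t * D j t)) =
    (if j = l ∧ t = u then Z i t * D m u else 0) - koszul k (odd i ^^ odd j) (odd l ^^ odd m) •
      if m = i ∧ u = t then Z l u * D j t else 0 := by
  have h1 : Z i t * D j t * (Z l u * D m u) = koszul k (odd j) (odd l) •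
      (Z i t * Z l u * D j t * D m u) + if j = l ∧ t = u then Z i t * D m u else 0 := by
    rw [mul_assoc, ← mul_assoc (D j t), h.dz, add_mul, mul_add, smul_mul_assoc, mul_smul_comm]
    congr 1
    · simp only [mul_assoc]
    · split_ifs <;> simp
  have h2 : Z l u * D m u * (Z i t * D j t) = (koszul k (odd m) (odd i) *
      (koszul k (odd l) (odd i) * koszul k (odd m) (odd j))) •
      (Z i t * Z l u * D j t * D m u) + if m = i ∧ u = t then Z l u * D j t else 0 := by
    rw [mul_assoc, ← mul_assoc (D m u), h.dz, add_mul, mul_add, smul_mul_assoc, mul_smul_comm]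
    congr 1
    · rw [mul_assoc, ← mul_assoc, h.zz l i, h.dd m j, smul_mul_assoc, mul_smul_comm, smul_smul,
        smul_smul]
      simp only [mul_assoc]
    · split_ifs <;> simp
  have h3 : koszul k (odd i ^^ odd j) (odd l ^^ odd m) * (koszul k (odd m) (odd i) *
      (koszul k (odd l) (odd i) * koszul k (odd m) (odd j))) = koszul k (odd j) (odd l) := by
    generalize odd i = a, odd j = b, odd l = c, odd m = d
    cases a <;> cases b <;> cases c <;> cases d <;> simp [koszul]
  rw [h1, h2, smul_add, smul_smul, h3]
  abel

/-- A matrix is homogeneous of parity `a` if its nonzero entries are in positions whose row and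
column parities differ by `a`. -/
def IsParity (odd : I → Bool) (a : Bool) (X : Matrix I I k) : Prop :=
  ∀ i j, X i j ≠ 0 → (odd i ^^ odd j) = a

/-- The oscillator representation respects super-brackets of homogeneous matrices. -/
lemma Oscillators.oscRep_bracket [Fintype I] [Fintype T] [DecidableEq T]
    (h : Oscillators (k := k) odd Z D) {a b : Bool}
    {X Y : Matrix I I k}
    (hX : IsParity odd a X) (hY : IsParity odd b Y) :
    oscRep k Z D X * oscRep k Z D Y - koszul k a b • (oscRep k Z D Y * oscRep k Z D X) =
      oscRep k Z D (X * Y - koszul k a b • (Y * X)) := by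
  -- Both sides are bilinear, so it suffices to compare them on matrix units.
  let F : Matrix I I k →ₗ[k] Matrix I I k →ₗ[k] C :=
    (LinearMap.mul k C).compl₁₂ (oscRep k Z D) (oscRep k Z D) -
      koszul k a b • ((LinearMap.mul k C).compl₁₂ (oscRep k Z D) (oscRep k Z D)).flip -
      ((LinearMap.mul k (Matrix I I k)).compr₂ (oscRep k Z D) -
        koszul k a b • ((LinearMap.mul k (Matrix I I k)).compr₂ (oscRep k Z D)).flip)
  have hF : ∀ X Y, F X Y = oscRep k Z D X * oscRep k Z D Y -
      koszul k a b • (oscRep k Z D Y * oscRep k Z D X) -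
      oscRep k Z D (X * Y - koszul k a b • (Y * X)) := fun X Y => by
    rw [map_sub, map_smul]
    rfl
  rw [← sub_eq_zero, ← hF, Matrix.matrix_eq_sum_single X, Matrix.matrix_eq_sum_single Y]
  simp only [map_sum, LinearMap.sum_apply]
  refine Finset.sum_eq_zero fun l _ => Finset.sum_eq_zero fun m _ => Finset.sum_eq_zero fun i _ =>
    Finset.sum_eq_zero fun j _ => ?_
  by_cases hx : X i j = 0
  · simp [hx]
  by_cases hy : Y l m = 0
  · simp [hy]
  obtain rfl := hX i j hx
  obtain rfl := hY l m hy
  have e1 : Matrix.single i j (X i j) = X i j • Matrix.single i j 1 := by simp [Matrix.smul_single]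
  have e2 : Matrix.single l m (Y l m) = Y l m • Matrix.single l m 1 := by simp [Matrix.smul_single]
  rw [e1, e2, map_smul, map_smul, LinearMap.smul_apply, hF, oscRep_single, oscRep_single, one_smul,
    one_smul, Finset.sum_mul_sum, Finset.sum_mul_sum]
  have e3 : ∀ i j l m : I, oscRep k Z D (Matrix.single i j 1 * Matrix.single l m 1) =
      ∑ t, ∑ u, if j = l ∧ t = u then Z i t * D m u else 0 := by
    intro i j l m
    by_cases hjl : j = l
    · subst hjl
      rw [Matrix.single_mul_single_same, oscRep_single]
      simp
    · rw [Matrix.single_mul_single_of_ne (h := hjl)]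
      simp [hjl]
  rw [map_sub, map_smul, e3, e3]
  simp only [Finset.smul_sum]
  rw [Finset.sum_comm (f := fun t u => koszul k (odd i ^^ odd j) (odd l ^^ odd m) •
      (Z l t * D m t * (Z i u * D j u))),
    Finset.sum_comm (f := fun t u => koszul k (odd i ^^ odd j) (odd l ^^ odd m) •
      if m = i ∧ t = u then Z l t * D j u else 0)]
  have e4 : ∑ t, ∑ u, (Z i t * D j t * (Z l u * D m u) -
      koszul k (odd i ^^ odd j) (odd l ^^ odd m) • (Z l u * D m u * (Z i t * D j t)) -
      ((if j = l ∧ t = u then Z i t * D m u else 0) -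
        koszul k (odd i ^^ odd j) (odd l ^^ odd m) • if m = i ∧ u = t then Z l u * D j t else 0))
      = 0 := Finset.sum_eq_zero fun t _ => Finset.sum_eq_zero fun u _ => by
        rw [h.bracket_unit, sub_self]
  simp only [Finset.sum_sub_distrib] at e4
  rw [e4, smul_zero, smul_zero]

end Oscillator

/-! ### The Fock space -/

section ReducedOscillators

variable {k : Type*} [Field k] {n : ℕ}

/-- The `p`-th power of `τ_{i,t}` in the reduced polynomial algebra used to realize the regular
nilpotent `p`-character: `1` for `t ∈ {i, i + 1}` and `0` otherwise. -/
def oscParam (k : Type*) [Field k] (n : ℕ) (s : Fin n × Fin n) : k :=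
  if s.1 = s.2 ∨ (s.1 : ℕ) + 1 = s.2 then 1 else 0

lemma oscParam_pow {p : ℕ} (hp : p ≠ 0) (s : Fin n × Fin n) :
    oscParam k n s ^ p = oscParam k n s := by
  unfold oscParam
  split_ifs <;> simp [hp]

variable (k n) (p : ℕ)

/-- The space of bosons. -/
abbrev Bosons : Type _ := RedPoly p (oscParam k n)

/-- The space of fermions. -/
abbrev Fermions (k : Type*) [Field k] (n : ℕ) : Type _ := ExteriorAlgebra k (Fin n × Fin n → k)

/-- Fermionic creation operators: multiplication by basis vectors of the exterior algebra. -/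
def fermiCreate (i t : Fin n) : Module.End k (Fermions k n) :=
  LinearMap.mulLeft k (ExteriorAlgebra.ι k (Pi.single (i, t) 1))

/-- Fermionic annihilation operators: contraction with coordinate functions. -/
def fermiAnnih (i t : Fin n) : Module.End k (Fermions k n) :=
  CliffordAlgebra.contractLeft (LinearMap.proj (i, t))

lemma fermiCreate_mul (i j t u : Fin n) : fermiCreate k n i t * fermiCreate k n j u =
    (-1 : k) • (fermiCreate k n j u * fermiCreate k n i t) := by
  refine LinearMap.ext fun q => ?_
  simp only [fermiCreate, Module.End.mul_apply, LinearMap.mulLeft_apply, LinearMap.smul_apply,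
    ← mul_assoc, neg_one_smul]
  rw [eq_neg_of_add_eq_zero_left (ExteriorAlgebra.ι_add_mul_swap (R := k) _ _), neg_mul]

lemma fermiAnnih_mul (i j t u : Fin n) : fermiAnnih k n i t * fermiAnnih k n j u =
    (-1 : k) • (fermiAnnih k n j u * fermiAnnih k n i t) :=
  LinearMap.ext fun q =>
    (CliffordAlgebra.contractLeft_comm _ _ q).trans (neg_one_smul k _).symm

lemma fermiAnnih_mul_create (i j t u : Fin n) : fermiAnnih k n i t * fermiCreate k n j u =
    (-1 : k) • (fermiCreate k n j u * fermiAnnih k n i t) + if i = j ∧ t = u then 1 else 0 := by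
  refine LinearMap.ext fun q => ?_
  have h := CliffordAlgebra.contractLeft_ι_mul (Q := (0 : QuadraticForm k (Fin n × Fin n → k)))
    (d := LinearMap.proj (i, t)) (Pi.single (j, u) 1) q
  refine h.trans ?_
  rw [sub_eq_add_neg, add_comm, ← neg_one_smul k]
  congr 1
  rw [LinearMap.proj_apply, Pi.single_apply]
  simp only [Prod.mk.injEq]
  split_ifs <;> simp

lemma fermiAnnih_one (i t : Fin n) : fermiAnnih k n i t 1 = 0 :=
  CliffordAlgebra.contractLeft_one (Q := 0) _

/-- The space of the oscillator representation. -/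
abbrev FockSpace : Type _ := Bosons k n p ⊗[k] Fermions k n

/-- Operators on bosons, acting on the Fock space. -/
abbrev onBosons : Module.End k (Bosons k n p) →ₐ[k] Module.End k (FockSpace k n p) :=
  Module.End.rTensorAlgHom k _ _

/-- Operators on fermions, acting on the Fock space. -/
abbrev onFermions : Module.End k (Fermions k n) →ₐ[k] Module.End k (FockSpace k n p) :=
  Module.End.lTensorAlgHom k _ _

lemma onBosons_commute (a : Module.End k (Bosons k n p)) (b : Module.End k (Fermions k n)) :
    Commute (onBosons k n p a) (onFermions k n p b) := by
  refine TensorProduct.ext' fun x y => ?_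
  rfl

variable [CharP k p]

/-- Bosonic creation operators. For `i < t` the roles of `τ` and `∂ / ∂τ` are interchanged, which is
needed for both creation and annihilation operators to have nonzero `p`-th powers. -/
def bosonCreate (i t : Fin n) : Module.End k (Bosons k n p) :=
  if i < t then (-1 : k) • redDeriv p _ (i, t) else mulVar p _ (i, t)

/-- Bosonic annihilation operators; for `i < t` the roles of `τ` and `∂ / ∂τ` are interchanged. -/
def bosonAnnih (i t : Fin n) : Module.End k (Bosons k n p) :=
  if i < t then mulVar p _ (i, t) else redDeriv p _ (i, t)

lemma bosonCreate_mul (i j t u : Fin n) : bosonCreate k n p i t * bosonCreate k n p j u =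
    bosonCreate k n p j u * bosonCreate k n p i t := by
  unfold bosonCreate
  have hne : i < t → ¬ j < u → ((i, t) : Fin n × Fin n) ≠ (j, u) := by
    rintro h1 h2 h3
    obtain ⟨rfl, rfl⟩ := Prod.mk.inj h3
    exact h2 h1
  have hne' : ¬ i < t → j < u → ((j, u) : Fin n × Fin n) ≠ (i, t) := by
    rintro h1 h2 h3
    obtain ⟨rfl, rfl⟩ := Prod.mk.inj h3
    exact h1 h2
  split_ifs with h1 h2 h2
  · rw [smul_mul_assoc, mul_smul_comm, redDeriv_comm, smul_mul_assoc, mul_smul_comm]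
  · rw [smul_mul_assoc, mul_smul_comm, redDeriv_mulVar, if_neg (hne h1 h2), add_zero]
  · rw [mul_smul_comm, smul_mul_assoc, redDeriv_mulVar, if_neg (hne' h1 h2), add_zero]
  · rw [mulVar_comm]

lemma bosonAnnih_mul (i j t u : Fin n) : bosonAnnih k n p i t * bosonAnnih k n p j u =
    bosonAnnih k n p j u * bosonAnnih k n p i t := by
  unfold bosonAnnih
  have hne : i < t → ¬ j < u → ((j, u) : Fin n × Fin n) ≠ (i, t) := by
    rintro h1 h2 h3
    obtain ⟨rfl, rfl⟩ := Prod.mk.inj h3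
    exact h2 h1
  have hne' : ¬ i < t → j < u → ((i, t) : Fin n × Fin n) ≠ (j, u) := by
    rintro h1 h2 h3
    obtain ⟨rfl, rfl⟩ := Prod.mk.inj h3
    exact h1 h2
  split_ifs with h1 h2 h2
  · rw [mulVar_comm]
  · rw [redDeriv_mulVar, if_neg (hne h1 h2), add_zero]
  · rw [redDeriv_mulVar, if_neg (hne' h1 h2), add_zero]
  · rw [redDeriv_comm]

lemma bosonAnnih_mul_create (i j t u : Fin n) : bosonAnnih k n p i t * bosonCreate k n p j u =
    bosonCreate k n p j u * bosonAnnih k n p i t + if i = j ∧ t = u then 1 else 0 := by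
  unfold bosonAnnih bosonCreate
  have hiff : (j, u) = (i, t) ↔ i = j ∧ t = u := by
    rw [Prod.mk.injEq, eq_comm, eq_comm (a := u)]
  have hne : ¬ ((i < t) ↔ (j < u)) → ¬ (i = j ∧ t = u) := by
    rintro h1 ⟨rfl, rfl⟩
    exact h1 Iff.rfl
  split_ifs with h1 h2 h3 h3 h3 h3 h3
  · rw [mul_smul_comm, smul_mul_assoc, redDeriv_mulVar, if_pos (hiff.2 h3), smul_add, add_assoc,
      neg_one_smul k (1 : Module.End k (Bosons k n p)), neg_add_cancel, add_zero]
  · rw [mul_smul_comm, smul_mul_assoc, redDeriv_mulVar, if_neg (mt hiff.1 h3), add_zero, add_zero]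
  · exact absurd h3 (hne (by tauto))
  · rw [mulVar_comm, add_zero]
  · exact absurd h3 (hne (by tauto))
  · rw [mul_smul_comm, smul_mul_assoc, redDeriv_comm, add_zero]
  · rw [redDeriv_mulVar, if_pos (hiff.2 h3).symm]
  · rw [redDeriv_mulVar, if_neg (mt Eq.symm (mt hiff.1 h3))]

/-- The creation operators of the oscillator representation of `gl(n|n)`. -/
def fockCreate : Fin n ⊕ Fin n → Fin n → Module.End k (FockSpace k n p) :=
  Sum.elim (fun i t => onBosons k n p (bosonCreate k n p i t))
    (fun i t => onFermions k n p (fermiCreate k n i t))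

/-- The annihilation operators of the oscillator representation of `gl(n|n)`. -/
def fockAnnih : Fin n ⊕ Fin n → Fin n → Module.End k (FockSpace k n p) :=
  Sum.elim (fun i t => onBosons k n p (bosonAnnih k n p i t))
    (fun i t => onFermions k n p (fermiAnnih k n i t))

lemma fock_oscillators :
    Oscillators (k := k) Sum.isRight (fockCreate k n p) (fockAnnih k n p) where
  zz := by
    rintro (i | i) (j | j) t u
    · simp only [fockCreate, Sum.elim_inl, ← map_mul, koszul, bosonCreate_mul k n p i]
      simp
    · simpa [fockCreate, koszul] using (onBosons_commute k n p _ _).eq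
    · simpa [fockCreate, koszul] using (onBosons_commute k n p _ _).eq.symm
    · simp only [fockCreate, Sum.elim_inr, ← map_mul, koszul, fermiCreate_mul k n i, map_smul,
        Sum.isRight_inr, Bool.and_self, if_true]
  dd := by
    rintro (i | i) (j | j) t u
    · simp only [fockAnnih, Sum.elim_inl, ← map_mul, koszul, bosonAnnih_mul k n p i]
      simp
    · simpa [fockAnnih, koszul] using (onBosons_commute k n p _ _).eq
    · simpa [fockAnnih, koszul] using (onBosons_commute k n p _ _).eq.symm
    · simp only [fockAnnih, Sum.elim_inr, ← map_mul, koszul, fermiAnnih_mul k n i, map_smul,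
        Sum.isRight_inr, Bool.and_self, if_true]
  dz := by
    rintro (i | i) (j | j) t u
    · simp only [fockCreate, fockAnnih, Sum.elim_inl, ← map_mul, koszul,
        bosonAnnih_mul_create k n p i, map_add]
      split_ifs <;> simp_all
    · simpa [fockAnnih, fockCreate, koszul] using (onBosons_commute k n p _ _).eq
    · simpa [fockAnnih, fockCreate, koszul] using (onBosons_commute k n p _ _).eq.symm
    · simp only [fockCreate, fockAnnih, Sum.elim_inr, ← map_mul, koszul,
        fermiAnnih_mul_create k n i, map_add, map_smul, Sum.isRight_inr, Bool.and_self, if_true,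
        Sum.inr.injEq]
      split_ifs
      · rw [map_one]
      · rw [map_zero]

/-- The oscillator representation of `gl(n|n)` on the Fock space. -/
def fockRep : Mat k n →ₗ[k] Module.End k (FockSpace k n p) :=
  oscRep k (fockCreate k n p) (fockAnnih k n p)

end ReducedOscillators

/-! ### The `p`-character of the Fock space -/

lemma Oscillators.commute_unit {k : Type*} [Field k] {I T : Type*} [DecidableEq I] [DecidableEq T]
    {C : Type*} [Ring C] [Algebra k C] {odd : I → Bool} {Z D : I → T → C}
    (h : Oscillators (k := k) odd Z D) {i j l m : I} {t u : T} (ho : odd i = odd j)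
    (h1 : ¬ (j = l ∧ t = u)) (h2 : ¬ (m = i ∧ u = t)) :
    Commute (Z i t * D j t) (Z l u * D m u) := by
  have h3 := h.bracket_unit i j l m t u
  rw [if_neg h1, if_neg h2, ho, smul_zero, sub_zero, sub_eq_zero] at h3
  simpa [koszul, Commute, SemiconjBy] using h3

lemma sum_pow_char_of_commute {R : Type*} [Ring R] (p : ℕ) [Fact p.Prime] [CharP R p] {T : Type*}
    (s : Finset T) (f : T → R) (h : ∀ t u, t ≠ u → Commute (f t) (f u)) :
    (∑ t ∈ s, f t) ^ p = ∑ t ∈ s, f t ^ p := by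
  classical
  induction s using Finset.induction_on with
  | empty => simp [(Fact.out : p.Prime).ne_zero]
  | insert a s ha ih =>
    rw [Finset.sum_insert ha, Finset.sum_insert ha, add_pow_char_of_commute, ih]
    exact Commute.sum_right _ _ _ fun u hu => h a u (by rintro rfl; exact ha hu)

section FockCharacter

variable {k : Type*} [Field k] (n p : ℕ) [Fact p.Prime]

/-- The square of a product of fermionic creation and annihilation operators is again this product
or zero. -/
lemma fermiUnit_pow (i j t : Fin n) : (fermiCreate k n i t * fermiAnnih k n j t) ^ p =
    if i = j then fermiCreate k n i t * fermiAnnih k n j t else 0 := by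
  have hp : p.Prime := Fact.out
  have h0 : fermiCreate k n i t * fermiCreate k n i t = 0 := by
    refine LinearMap.ext fun q => ?_
    simp only [fermiCreate, Module.End.mul_apply, LinearMap.mulLeft_apply, ← mul_assoc]
    rw [ExteriorAlgebra.ι_sq_zero, zero_mul, LinearMap.zero_apply]
  have h1 : fermiCreate k n i t * fermiAnnih k n j t * (fermiCreate k n i t * fermiAnnih k n j t) =
      if i = j then fermiCreate k n i t * fermiAnnih k n j t else 0 := by
    rw [mul_assoc, ← mul_assoc (fermiAnnih k n j t), fermiAnnih_mul_create, add_mul, mul_add,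
      smul_mul_assoc, mul_smul_comm, ← mul_assoc, ← mul_assoc, h0, zero_mul, zero_mul, smul_zero,
      zero_add]
    by_cases h : i = j
    · subst h; simp
    · simp [h, Ne.symm h]
  split_ifs with h
  · rw [if_pos h] at h1
    obtain ⟨q, hq⟩ : ∃ q, p = q + 1 := ⟨p - 1, (Nat.sub_add_cancel hp.one_le).symm⟩
    rw [hq]
    exact IsIdempotentElem.pow_succ_eq q h1
  · rw [if_neg h] at h1
    exact pow_eq_zero_of_le hp.two_le (by rw [pow_two, h1])

variable [CharP k p]

instance : Nontrivial (Bosons k n p) :=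
  (redPolyEval p (oscParam k n)
    (oscParam_pow (Fact.out : p.Prime).ne_zero)).toRingHom.domain_nontrivial

instance : Nontrivial (FockSpace k n p) :=
  have : Nontrivial (Fermions k n) := inferInstance
  inferInstance

lemma bosonCreate_pow (i t : Fin n) : bosonCreate k n p i t ^ p =
    algebraMap k _ (if i < t then 0 else oscParam k n (i, t)) := by
  unfold bosonCreate
  split_ifs
  · rw [smul_pow, redDeriv_pow, smul_zero, map_zero]
  · rw [mulVar_pow]

lemma bosonAnnih_pow (i t : Fin n) : bosonAnnih k n p i t ^ p =
    algebraMap k _ (if i < t then oscParam k n (i, t) else 0) := by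
  unfold bosonAnnih
  split_ifs
  · rw [mulVar_pow]
  · rw [redDeriv_pow, map_zero]

/-- The number operators are `τ ∂` or `-∂ τ = -(τ ∂ + 1)`, hence equal to their `p`-th powers. -/
lemma bosonNumber_pow (i t : Fin n) : (bosonCreate k n p i t * bosonAnnih k n p i t) ^ p =
    bosonCreate k n p i t * bosonAnnih k n p i t := by
  unfold bosonCreate bosonAnnih
  split_ifs
  · rw [smul_mul_assoc, redDeriv_mulVar, if_pos rfl, smul_pow,
      add_pow_char_of_commute _ (Commute.one_right _), mulVar_redDeriv_pow, one_pow,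
      neg_one_pow_char]
  · rw [mulVar_redDeriv_pow]

lemma evenMat_single (i j : Fin n) (a : k) : evenMat k n (Matrix.single i j a) =
    Matrix.single (Sum.inl i) (Sum.inl j) a - Matrix.single (Sum.inr j) (Sum.inr i) a := by
  ext (r | r) (s | s) <;> simp [evenMat_apply, Matrix.single_apply]

/-- The sum of the products of the `p`-th powers of creation and annihilation operators is the
regular nilpotent `p`-character: a nonzero term has `j < t ≤ i`, `t ∈ {i, i + 1}` and
`t ∈ {j, j + 1}`, so that `i = t = j + 1`. -/
lemma sum_oscParam (i j : Fin n) : (∑ t, (if i < t then 0 else oscParam k n (i, t)) *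
    (if j < t then oscParam k n (j, t) else 0)) = if (i : ℕ) = j + 1 then 1 else 0 := by
  rw [Finset.sum_eq_single i]
  · rw [if_neg (lt_irrefl i)]
    simp only [oscParam, true_or, if_true, one_mul, Fin.lt_def]
    split_ifs with h1 h2 h3 h4 h5 <;>
      first | rfl | (exfalso; (try simp only [Fin.ext_iff] at *); omega)
  · intro t _ ht
    have ht : (t : ℕ) ≠ i := fun h => ht (Fin.ext h)
    simp only [oscParam, Fin.lt_def]
    split_ifs with h1 h2 h3 h4 h5 <;>
      first | (simp; done) | (exfalso; (try simp only [Fin.ext_iff] at *); omega)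
  · simp

/-- The `p`-th power of the operator of a matrix unit of `gl(n)`. The operator is a sum of commuting
bosonic and fermionic terms, so that the `p`-th power can be taken termwise. -/
lemma fockRep_single_pow (i j : Fin n) : fockRep k n p (evenMat k n (Matrix.single i j 1)) ^ p =
    (if i = j then fockRep k n p (evenMat k n (Matrix.single i j 1)) else 0) +
      algebraMap k _ (if (i : ℕ) = j + 1 then 1 else 0) := by
  have hosc := fock_oscillators k n p
  have hrep : fockRep k n p (evenMat k n (Matrix.single i j 1)) =
      ∑ t, fockCreate k n p (Sum.inl i) t * fockAnnih k n p (Sum.inl j) t -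
      ∑ t, fockCreate k n p (Sum.inr j) t * fockAnnih k n p (Sum.inr i) t := by
    rw [evenMat_single, map_sub, fockRep, oscRep_single, oscRep_single, one_smul, one_smul]
  have hc : ∀ t u, Commute (fockCreate k n p (Sum.inl i) t * fockAnnih k n p (Sum.inl j) t)
      (fockCreate k n p (Sum.inr j) u * fockAnnih k n p (Sum.inr i) u) := fun t u =>
    hosc.commute_unit rfl (by simp) (by simp)
  rw [hrep, sub_pow_char_of_commute, sum_pow_char_of_commute p, sum_pow_char_of_commute p]
  · have hB : ∀ t, (fockCreate k n p (Sum.inl i) t * fockAnnih k n p (Sum.inl j) t) ^ p =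
        (if i = j then fockCreate k n p (Sum.inl i) t * fockAnnih k n p (Sum.inl j) t else 0) +
        algebraMap k _ ((if i < t then 0 else oscParam k n (i, t)) *
          (if j < t then oscParam k n (j, t) else 0)) := by
      intro t
      change (onBosons k n p _ * onBosons k n p _) ^ p = _
      rw [← map_mul, ← map_pow]
      by_cases h : i = j
      · subst h
        rw [bosonNumber_pow, if_pos rfl, map_mul]
        split_ifs <;> simp [fockCreate, fockAnnih]
      · have h1 : Commute (bosonCreate k n p i t) (bosonAnnih k n p j t) := by
          have := bosonAnnih_mul_create k n p j i t t
          rw [if_neg (by tauto), add_zero] at this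
          exact this.symm
        rw [h1.mul_pow, bosonCreate_pow, bosonAnnih_pow, if_neg h, zero_add, ← map_mul,
          AlgHom.commutes]
    have hF : ∀ t, (fockCreate k n p (Sum.inr j) t * fockAnnih k n p (Sum.inr i) t) ^ p =
        if i = j then fockCreate k n p (Sum.inr j) t * fockAnnih k n p (Sum.inr i) t else 0 := by
      intro t
      change (onFermions k n p _ * onFermions k n p _) ^ p = _
      rw [← map_mul, ← map_pow, fermiUnit_pow]
      by_cases h : i = j
      · subst h
        rw [if_pos rfl, if_pos rfl, map_mul]
        rfl
      · rw [if_neg (Ne.symm h), if_neg h, map_zero]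
    simp only [hB, hF, Finset.sum_add_distrib, ← map_sum, sum_oscParam]
    by_cases h : i = j
    · simp only [if_pos h]
      abel
    · simp [h]
  · exact fun t u htu => hosc.commute_unit rfl (by tauto) (by tauto)
  · exact fun t u htu => hosc.commute_unit rfl (by tauto) (by tauto)
  · exact Commute.sum_left _ _ _ fun t _ => Commute.sum_right _ _ _ fun u _ => hc t u

lemma isParity_evenMat (A : Matrix (Fin n) (Fin n) k) :
    IsParity (Sum.isRight : Fin n ⊕ Fin n → Bool) false (evenMat k n A) := by
  rintro (i | i) (j | j) h <;> simp [evenMat_apply] at h ⊢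

lemma isParity_odd (B C : Matrix (Fin n) (Fin n) k) :
    IsParity (Sum.isRight : Fin n ⊕ Fin n → Bool) true (Matrix.fromBlocks 0 B C 0) := by
  rintro (i | i) (j | j) h <;> simp at h ⊢

variable {n p}

lemma IsStandardRegularNilpotent.apply_rootVec {χ : Module.Dual k (peri k n p).even}
    (hχ : IsStandardRegularNilpotent χ) (i j : Fin n) :
    χ (rootVec i j) = if (i : ℕ) = j + 1 then 1 else 0 := by
  split_ifs with h
  · exact hχ.neg_simple _ _ h
  · by_cases hij : i = j
    · subst hij
      rw [← hχ.torus_eq_zero (torusMk (Pi.single i 1))]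
      congr 1
      ext1
      change evenMat k n _ = evenMat k n _
      rw [Matrix.diagonal_single]
    · exact hχ.other_roots i j hij h

/-- The Fock space has `p`-character `χ`. As `φ(A) ^ p - φ(A ^ p)` is additive in `A`, this has to be
checked only for multiples of matrix units. -/
lemma fockRep_even_pow {χ : Module.Dual k (peri k n p).even} (hχ : IsStandardRegularNilpotent χ)
    (x : (peri k n p).even) : fockRep k n p x.1 ^ p - fockRep k n p (x.1 ^ p) -
      algebraMap k _ (χ x ^ p) = 0 := by
  have hp : p.Prime := Fact.out
  obtain ⟨A, hA⟩ := mem_even_iff.1 x.2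
  obtain rfl : x = ⟨evenMat k n A, evenMat_mem p A⟩ := Subtype.ext hA
  clear hA
  let φ : Matrix (Fin n) (Fin n) k →ₗ[k] Module.End k (FockSpace k n p) :=
    fockRep k n p ∘ₗ evenMat k n
  have hφ : ∀ x y, φ x * φ y - φ y * φ x = φ (x * y - y * x) := by
    intro x y
    have := (fock_oscillators k n p).oscRep_bracket (isParity_evenMat n x) (isParity_evenMat n y)
    simp only [koszul, Bool.and_self, Bool.false_eq_true, if_false, one_smul, evenMat_lie] at this
    exact this
  change fockRep k n p (evenMat k n A) ^ p - fockRep k n p (evenMat k n A ^ p) - _ = 0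
  rw [evenMat_pow, sub_eq_zero]
  change φ A ^ p - φ (A ^ p) = _
  induction A using Matrix.induction_on' with
  | h_zero =>
    have : (⟨evenMat k n 0, evenMat_mem p 0⟩ : (peri k n p).even) = 0 := Subtype.ext (map_zero _)
    rw [this, map_zero χ, zero_pow hp.ne_zero, map_zero φ, zero_pow hp.ne_zero, zero_pow hp.ne_zero,
      map_zero (algebraMap _ _)]
    exact sub_self _
  | h_add A B hA hB =>
    have : (⟨evenMat k n (A + B), evenMat_mem p _⟩ : (peri k n p).even) =
      ⟨evenMat k n A, evenMat_mem p _⟩ + ⟨evenMat k n B, evenMat_mem p _⟩ :=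
      Subtype.ext (map_add _ _ _)
    rw [pow_sub_map_pow_add p φ hφ, hA, hB, this, map_add, add_pow_char, map_add]
  | h_std_basis i j a =>
    have h1 : Matrix.single i j a = a • Matrix.single i j 1 := by simp [Matrix.smul_single]
    have h2 : (⟨evenMat k n (a • Matrix.single i j 1), evenMat_mem p _⟩ : (peri k n p).even) =
      a • rootVec i j := Subtype.ext (map_smul _ _ _)
    have h3 : Matrix.single i j (1 : k) ^ p = if i = j then Matrix.single i j 1 else 0 := by
      split_ifs with h
      · subst h
        obtain ⟨q, hq⟩ : ∃ q, p = q + 1 := ⟨p - 1, (Nat.sub_add_cancel hp.one_le).symm⟩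
        rw [hq]
        exact IsIdempotentElem.pow_succ_eq q (by
          rw [IsIdempotentElem, Matrix.single_mul_single_same, mul_one])
      · exact pow_eq_zero_of_le hp.two_le (by
          rw [pow_two, Matrix.single_mul_single_of_ne (h := Ne.symm h)])
    have h4 : φ (Matrix.single i j 1) ^ p - φ (Matrix.single i j 1 ^ p) =
        algebraMap k _ (if (i : ℕ) = j + 1 then 1 else 0) := by
      rw [h3]
      have := fockRep_single_pow (k := k) n p i j
      change φ _ ^ p = _ at this
      rw [this]
      split_ifs
      all_goals first | (rw [map_zero φ, sub_zero, zero_add]) | exact add_sub_cancel_left _ _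
    have h5 := hχ.apply_rootVec i j
    rw [h1, h2, map_smul, map_smul, smul_pow, smul_pow, map_smul]
    refine (smul_sub _ _ _).symm.trans ?_
    rw [h4, h5, smul_eq_mul, mul_pow, map_mul, ← Algebra.smul_def]
    split_ifs <;> simp [hp.ne_zero]

/-- The Fock space as a module over `U_χ(𝔤)`. -/
def fockModule {χ : Module.Dual k (peri k n p).even} (hχ : IsStandardRegularNilpotent χ) :
    RedEnv (peri k n p) χ →ₐ[k] Module.End k (FockSpace k n p) :=
  redEnvLift (peri k n p) χ ((fockRep k n p).comp (Submodule.subtype _))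
    ((fockRep k n p).comp (Submodule.subtype _))
    (by
      rintro ⟨_, hx⟩ ⟨_, hy⟩
      obtain ⟨A, rfl⟩ := mem_even_iff.1 hx
      obtain ⟨B, rfl⟩ := mem_even_iff.1 hy
      have := (fock_oscillators k n p).oscRep_bracket (isParity_evenMat n A) (isParity_evenMat n B)
      simpa [koszul, fockRep] using this)
    (by
      rintro ⟨_, hx⟩ ⟨_, hy⟩
      obtain ⟨A, rfl⟩ := mem_even_iff.1 hx
      obtain ⟨B, C, -, -, rfl⟩ := mem_odd_iff.1 hy
      have := (fock_oscillators k n p).oscRep_bracket (isParity_evenMat n A) (isParity_odd n B C)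
      simpa [koszul, fockRep] using this)
    (by
      rintro ⟨_, hx⟩ ⟨_, hy⟩
      obtain ⟨B, C, -, -, rfl⟩ := mem_odd_iff.1 hx
      obtain ⟨B', C', -, -, rfl⟩ := mem_odd_iff.1 hy
      have := (fock_oscillators k n p).oscRep_bracket (isParity_odd n B C) (isParity_odd n B' C')
      simp only [koszul, Bool.and_self, if_true, neg_smul, one_smul, sub_neg_eq_add] at this
      exact this)
    (fun x => fockRep_even_pow hχ x)

end FockCharacter

/-! ### The baby Verma module is nonzero -/

section RedEnvGeneration

variable {k : Type*} [Field k] {n p : ℕ} {𝔞 : RestrictedSubalgebra k n p}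
  {χ : Module.Dual k 𝔞.even}

/-- The algebra `U_χ(𝔞)` is generated by `𝔞`. -/
lemma redEnv_induction {P : RedEnv 𝔞 χ → Prop} (h_scalar : ∀ c : k, P (algebraMap k _ c))
    (h_even : ∀ x, P (rEven 𝔞 χ x)) (h_odd : ∀ y, P (rOdd 𝔞 χ y))
    (h_add : ∀ u v, P u → P v → P (u + v)) (h_mul : ∀ u v, P u → P v → P (u * v))
    (u : RedEnv 𝔞 χ) : P u := by
  obtain ⟨u, rfl⟩ := RingQuot.mkAlgHom_surjective k (RedRel 𝔞 χ) u
  obtain ⟨u, rfl⟩ := RingQuot.mkAlgHom_surjective k (EnvRel 𝔞) u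
  change P (redMk 𝔞 χ (envMk 𝔞 u))
  induction u using TensorAlgebra.induction with
  | algebraMap c =>
    rw [AlgHom.commutes, AlgHom.commutes]
    exact h_scalar c
  | ι x =>
    have h : x = (x.1, 0) + (0, x.2) := by simp
    rw [h, map_add, map_add, map_add]
    exact h_add _ _ (h_even x.1) (h_odd x.2)
  | mul a b ha hb =>
    rw [map_mul, map_mul]
    exact h_mul _ _ ha hb
  | add a b ha hb =>
    rw [map_add, map_add]
    exact h_add _ _ ha hb

variable {A : Type*} [Ring A] [Algebra k A] (f : 𝔞.even →ₗ[k] A) (g : 𝔞.odd →ₗ[k] A)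
    (h00 : ∀ x y : 𝔞.even, f x * f y - f y * f x =
      f ⟨x.1 * y.1 - y.1 * x.1, 𝔞.lie_even_even _ x.2 _ y.2⟩)
    (h01 : ∀ (x : 𝔞.even) (y : 𝔞.odd), f x * g y - g y * f x =
      g ⟨x.1 * y.1 - y.1 * x.1, 𝔞.lie_even_odd _ x.2 _ y.2⟩)
    (h11 : ∀ x y : 𝔞.odd, g x * g y + g y * g x =
      f ⟨x.1 * y.1 + y.1 * x.1, 𝔞.lie_odd_odd _ x.2 _ y.2⟩)
    (hp : ∀ x : 𝔞.even, f x ^ p - f ⟨x.1 ^ p, 𝔞.pow_mem _ x.2⟩ - algebraMap k A (χ x ^ p) = 0)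

lemma redEnvLift_rEven (x : 𝔞.even) :
    redEnvLift 𝔞 χ f g h00 h01 h11 hp (rEven 𝔞 χ x) = f x := by
  refine (RingQuot.liftAlgHom_mkAlgHom_apply k _ _ _).trans ?_
  refine (RingQuot.liftAlgHom_mkAlgHom_apply k _ _ _).trans ?_
  simp [tEven]

lemma redEnvLift_rOdd (y : 𝔞.odd) :
    redEnvLift 𝔞 χ f g h00 h01 h11 hp (rOdd 𝔞 χ y) = g y := by
  refine (RingQuot.liftAlgHom_mkAlgHom_apply k _ _ _).trans ?_
  refine (RingQuot.liftAlgHom_mkAlgHom_apply k _ _ _).trans ?_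
  simp [tOdd]

end RedEnvGeneration

section HighestWeightVector

variable {k : Type*} [Field k] {n : ℕ} (p : ℕ) (r : Fin n → ℕ)

/-- The exponent of the monomial `∏ i, τ_{i,i} ^ r i`. -/
def diagExponent : Fin n × Fin n →₀ ℕ :=
  Finsupp.equivFunOnFinite.symm fun s => if s.1 = s.2 then r s.1 else 0

/-- The monomial `∏ i, τ_{i,i} ^ r i`. -/
def diagMonomial : Bosons k n p :=
  redPolyMk p _ (MvPolynomial.monomial (diagExponent r) 1)

/-- The weight vector `∏ i, τ_{i,i} ^ r i ⊗ 1` of the Fock space. -/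
def fockVector : FockSpace k n p := diagMonomial p r ⊗ₜ 1

lemma fockVector_ne_zero [Fact p.Prime] : (fockVector p r : FockSpace k n p) ≠ 0 := by
  intro h
  -- The evaluation `τ_{i,t} ↦ ε_{i,t}`, tensored with the augmentation, maps the vector to `1`.
  have h1 := congrArg (LinearMap.mul' k k ∘ₗ TensorProduct.map
    (redPolyEval p (oscParam k n) (oscParam_pow (Fact.out : p.Prime).ne_zero)).toLinearMap
    (ExteriorAlgebra.algebraMapInv (R := k)).toLinearMap) h
  rw [map_zero, fockVector, LinearMap.comp_apply, TensorProduct.map_tmul, LinearMap.mul'_apply,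
    AlgHom.toLinearMap_apply, AlgHom.toLinearMap_apply, map_one, mul_one, diagMonomial,
    redPolyEval_mk, MvPolynomial.aeval_monomial, map_one, one_mul, Finsupp.prod] at h1
  refine one_ne_zero ((Finset.prod_eq_one fun s hs => ?_).symm.trans h1)
  have hs' : s.1 = s.2 := by
    by_contra hne
    simp [diagExponent, hne] at hs
  rw [oscParam, if_pos (Or.inl hs'), one_pow]

variable [CharP k p]

lemma mulVar_redDeriv_diagMonomial (s : Fin n × Fin n) :
    mulVar p (oscParam k n) s (redDeriv p _ s (diagMonomial p r)) =
      (if s.1 = s.2 then (r s.1 : k) else 0) • diagMonomial p r := by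
  rw [diagMonomial, redDeriv_mk, mulVar, LinearMap.mulLeft_apply, ← map_mul,
    MvPolynomial.X_mul_pderiv_monomial]
  simp only [diagExponent, Finsupp.equivFunOnFinite_symm_apply_apply]
  split_ifs
  · rw [map_nsmul, Nat.cast_smul_eq_nsmul]
  · rw [zero_smul, map_zero, zero_smul]

lemma redDeriv_diagMonomial {s : Fin n × Fin n} (hs : s.1 ≠ s.2) :
    redDeriv p (oscParam k n) s (diagMonomial p r) = 0 := by
  rw [diagMonomial, redDeriv_mk, MvPolynomial.pderiv_monomial]
  simp [diagExponent, hs]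

lemma boson_fockVector {i j : Fin n} (hij : i ≤ j) (t : Fin n) :
    bosonCreate k n p i t (bosonAnnih k n p j t (diagMonomial p r)) =
      (if i = j then (if i = t then (r i : k) else if i < t then -1 else 0) else 0) •
        diagMonomial p r := by
  rcases hij.eq_or_lt with rfl | hij
  · rw [if_pos rfl, bosonCreate, bosonAnnih]
    by_cases h : i < t
    · rw [if_pos h, if_pos h, if_neg h.ne, if_pos h, LinearMap.smul_apply, ← Module.End.mul_apply,
        redDeriv_mulVar, if_pos rfl, LinearMap.add_apply, Module.End.mul_apply,
        redDeriv_diagMonomial p r h.ne, map_zero, zero_add, Module.End.one_apply]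
    · rw [if_neg h, if_neg h, if_neg h, mulVar_redDeriv_diagMonomial]
  · rw [if_neg hij.ne, zero_smul, ← Module.End.mul_apply]
    have h0 := bosonAnnih_mul_create k n p j i t t
    rw [if_neg (by rintro ⟨rfl, -⟩; exact lt_irrefl _ hij), add_zero] at h0
    by_cases h : i < t
    · rw [← h0, Module.End.mul_apply, bosonCreate, if_pos h, LinearMap.smul_apply,
        redDeriv_diagMonomial p r h.ne, smul_zero, map_zero]
    · have h1 : t < j := (not_lt.1 h).trans_lt hij
      rw [Module.End.mul_apply, bosonAnnih, if_neg h1.le.not_gt, redDeriv_diagMonomial p r h1.ne',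
        map_zero]

lemma fockAnnih_inr_fockVector (i t : Fin n) :
    fockAnnih k n p (Sum.inr i) t (fockVector p r) = 0 := by
  change diagMonomial p r ⊗ₜ[k] (fermiAnnih k n i t 1) = 0
  rw [fermiAnnih_one, TensorProduct.tmul_zero]

lemma fockRep_single_fockVector {i j : Fin n} (hij : i ≤ j) (a : k) :
    fockRep k n p (evenMat k n (Matrix.single i j a)) (fockVector p r) =
      (if i = j then a * ((r i : k) - ((n - 1 - i : ℕ) : k)) else 0) • fockVector p r := by
  rw [evenMat_single, map_sub, fockRep, oscRep_single, oscRep_single, LinearMap.sub_apply,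
    LinearMap.smul_apply, LinearMap.smul_apply, LinearMap.sum_apply, LinearMap.sum_apply]
  have h1 : ∀ t, (fockCreate k n p (Sum.inr j) t * fockAnnih k n p (Sum.inr i) t)
      (fockVector p r) = 0 := fun t => by
    rw [Module.End.mul_apply, fockAnnih_inr_fockVector, map_zero]
  have h2 : ∀ t, (fockCreate k n p (Sum.inl i) t * fockAnnih k n p (Sum.inl j) t)
      (fockVector p r) =
      (if i = j then (if i = t then (r i : k) else if i < t then -1 else 0) else 0) •
        fockVector p r := fun t => by
    change bosonCreate k n p i t (bosonAnnih k n p j t (diagMonomial p r)) ⊗ₜ[k] 1 = _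
    rw [boson_fockVector p r hij, fockVector, TensorProduct.smul_tmul']
  simp only [h1, h2, Finset.sum_const_zero, smul_zero, sub_zero, ← Finset.sum_smul, smul_smul]
  congr 1
  split_ifs with h
  · congr 1
    have h3 : ∀ t, (if i = t then (r i : k) else if i < t then -1 else 0) =
        (if i = t then (r i : k) else 0) - if i < t then 1 else 0 := by
      intro t
      by_cases h4 : i = t
      · subst h4; simp
      · rw [if_neg h4, if_neg h4]
        split_ifs <;> simp
    simp only [h3, Finset.sum_sub_distrib, Finset.sum_ite_eq, Finset.mem_univ, if_true]
    rw [← Finset.sum_filter, Finset.sum_const, nsmul_eq_mul, mul_one]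
    congr 2
    rw [Finset.filter_lt_eq_Ioi, Fin.card_Ioi]
  · simp

/-- The vector `∏ i, τ_{i,i} ^ r i ⊗ 1` is a weight vector for upper triangular matrices. Each of the
`n - 1 - i` indices `t > i` contributes `-1` to the weight, because there the number operator is
`-∂ τ`. -/
lemma fockRep_upper_fockVector {A : Matrix (Fin n) (Fin n) k} (hA : ∀ i j, j < i → A i j = 0) :
    fockRep k n p (evenMat k n A) (fockVector p r) =
      (∑ i, A i i * ((r i : k) - ((n - 1 - i : ℕ) : k))) • fockVector p r := by
  conv_lhs => rw [Matrix.matrix_eq_sum_single A]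
  simp only [map_sum, LinearMap.sum_apply]
  rw [Finset.sum_smul]
  refine Finset.sum_congr rfl fun i _ => ?_
  rw [Finset.sum_eq_single i]
  · rw [fockRep_single_fockVector p r le_rfl, if_pos rfl]
  · intro j _ hj
    rcases lt_or_gt_of_ne hj with h | h
    · rw [hA i j h, Matrix.single_zero, map_zero, map_zero, LinearMap.zero_apply]
    · rw [fockRep_single_fockVector p r h.le, if_neg hj.symm, zero_smul]
  · simp

lemma fockRep_gOne_fockVector (B : Matrix (Fin n) (Fin n) k) :
    fockRep k n p (Matrix.fromBlocks 0 B 0 0) (fockVector p r) = 0 := by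
  conv_lhs => rw [Matrix.matrix_eq_sum_single (Matrix.fromBlocks 0 B 0 0)]
  simp only [map_sum, LinearMap.sum_apply]
  refine Finset.sum_eq_zero fun i _ => Finset.sum_eq_zero fun j _ => ?_
  rw [fockRep, oscRep_single, LinearMap.smul_apply, LinearMap.sum_apply]
  rcases j with j | j
  · rcases i with i | i <;> simp
  · rw [Finset.sum_eq_zero, smul_zero]
    intro t _
    rw [Module.End.mul_apply, fockAnnih_inr_fockVector, map_zero]

variable {p}
variable [Fact p.Prime]

/-- Weights in `Λ(χ)` take values in the prime field on matrix units. -/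
lemma exists_nat_weight {χ : Module.Dual k (peri k n p).even} (hχ : IsStandardRegularNilpotent χ)
    (μ : weightSet χ) : ∃ m : Fin n → ℕ, ∀ d, μ.1 (torusMk d) = ∑ i, d i * (m i : k) := by
  have hp : p.Prime := Fact.out
  have h : ∀ i : Fin n, ∃ m : ℕ, μ.1 (torusMk (Pi.single i 1)) = m := by
    intro i
    have h1 := μ.2 (torusMk (Pi.single i 1))
    rw [hχ.torus_eq_zero, zero_pow hp.ne_zero, sub_eq_zero] at h1
    have h2 : (⟨(torusMk (Pi.single i (1 : k))).1 ^ p, torus_pow_mem _⟩ : torus k n) =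
        torusMk (Pi.single i 1) := by
      ext1
      change evenMat k n (Matrix.diagonal _) ^ p = evenMat k n (Matrix.diagonal _)
      rw [evenMat_pow, Matrix.diagonal_pow]
      congr 2
      ext j
      by_cases hj : j = i
      · subst hj; simp
      · simp [Pi.single_eq_of_ne hj, hp.ne_zero]
    rw [h2] at h1
    have h3 : μ.1 (torusMk (Pi.single i 1)) ∈ (ZMod.castHom (dvd_refl p) k).fieldRange :=
      (bot_le : ⊥ ≤ (ZMod.castHom (dvd_refl p) k).fieldRange)
        ((Subfield.mem_bot_iff_pow_eq_self (F := k) (p := p)).2 h1)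
    obtain ⟨z, hz⟩ := h3
    have : NeZero p := ⟨hp.ne_zero⟩
    refine ⟨z.val, ?_⟩
    rw [← hz, ← map_natCast (ZMod.castHom (dvd_refl p) k), ZMod.natCast_zmod_val]
  choose m hm using h
  refine ⟨m, fun d => ?_⟩
  have h1 : d = ∑ i, d i • Pi.single i (1 : k) := by
    ext j
    simp [Finset.sum_apply, Pi.single_apply]
  conv_lhs => rw [h1]
  simp only [map_sum, map_smul, hm, smul_eq_mul]

variable {χ : Module.Dual k (peri k n p).even} (hχ : IsStandardRegularNilpotent χ)

lemma fockModule_rEven (x : (peri k n p).even) :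
    fockModule hχ (rEven _ χ x) = fockRep k n p x.1 :=
  redEnvLift_rEven (𝔞 := peri k n p) _ _ _ _ _ _ x

lemma fockModule_rOdd (y : (peri k n p).odd) :
    fockModule hχ (rOdd _ χ y) = fockRep k n p y.1 :=
  redEnvLift_rOdd (𝔞 := peri k n p) _ _ _ _ _ _ y

/-- In the Fock space, `U_χ(𝓑)` acts on a suitable monomial by the character `λ`. The exponents are
shifted by `n - 1 - i` to cancel the shift in `fockRep_upper_fockVector`. -/
lemma fockModule_borel_fockVector (μ : weightSet χ) {m : Fin n → ℕ}
    (hm : ∀ d, μ.1 (torusMk d) = ∑ i, d i * (m i : k))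
    (b : RedEnv (borel k n p) (χ.comp (Submodule.inclusion borel_even_le))) :
    fockModule hχ (redEnvMap (borel k n p) (peri k n p) borel_even_le borel_odd_le χ b)
      (fockVector p fun i => m i + (n - 1 - i)) =
    borelChar χ hχ.vanishesOnNPlus μ b • fockVector p fun i => m i + (n - 1 - i) := by
  induction b using redEnv_induction with
  | h_scalar c => simp
  | h_even x =>
    obtain ⟨x, hx⟩ := x
    obtain ⟨A, hA, rfl⟩ := mem_borelEven_iff.1 hx
    rw [redEnvMap, redEnvLift_rEven, borelChar, redEnvLift_rEven, LinearMap.comp_apply,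
      LinearMap.comp_apply, borelToTorus_mk, hm, fockModule_rEven]
    refine (fockRep_upper_fockVector p _ hA).trans ?_
    congr 1
    refine Finset.sum_congr rfl fun i _ => ?_
    rw [Nat.cast_add, add_sub_cancel_right, Matrix.diag_apply]
  | h_odd y =>
    obtain ⟨_, B, -, rfl⟩ := y
    rw [redEnvMap, redEnvLift_rOdd, borelChar, redEnvLift_rOdd, LinearMap.comp_apply,
      fockModule_rOdd, LinearMap.zero_apply, zero_smul]
    exact fockRep_gOne_fockVector p _ B
  | h_add u v hu hv => rw [map_add, map_add, map_add, LinearMap.add_apply, hu, hv, add_smul]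
  | h_mul u v hu hv =>
    rw [map_mul, map_mul, map_mul, Module.End.mul_apply, hv, map_smul, hu, smul_smul, mul_comm]

/-- The baby Verma module is nonzero, because it maps onto a nonzero submodule of the Fock
space. -/
lemma babyVerma_nontrivial (μ : weightSet χ) : Nontrivial (BabyVerma χ hχ.vanishesOnNPlus μ) := by
  obtain ⟨m, hm⟩ := exists_nat_weight hχ μ
  set v : FockSpace k n p := fockVector p fun i => m i + (n - 1 - i) with hv
  let Φ : RedEnv (peri k n p) χ ⊗[k] k →ₗ[k] FockSpace k n p :=
    LinearMap.applyₗ v ∘ₗ (fockModule hχ).toLinearMap ∘ₗ (TensorProduct.rid k _).toLinearMap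
  have hΦ : ∀ u c, Φ (u ⊗ₜ c) = c • fockModule hχ u v := fun u c => by simp [Φ]
  have hΦs : ∀ (s : RedEnv (peri k n p) χ) t, Φ (s • t) = fockModule hχ s (Φ t) := by
    intro s t
    induction t using TensorProduct.induction_on with
    | zero => simp
    | tmul u c => rw [TensorProduct.smul_tmul', hΦ, hΦ, smul_eq_mul, map_mul, map_smul]; rfl
    | add a b ha hb => rw [smul_add, map_add, map_add, map_add, ha, hb]
  refine ⟨Submodule.Quotient.mk (1 ⊗ₜ 1), 0, fun h => ?_⟩
  rw [Submodule.Quotient.mk_eq_zero] at h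
  have h1 : Φ (1 ⊗ₜ 1) = 0 := by
    refine Submodule.span_induction (p := fun t _ => Φ t = 0) ?_ (map_zero _) ?_ ?_ h
    · rintro _ ⟨s, b, c, rfl⟩
      rw [map_sub, hΦ, hΦ, map_mul, Module.End.mul_apply, fockModule_borel_fockVector hχ μ hm,
        map_smul, smul_smul, sub_eq_zero]
      congr 1
      change c * _ = _ * c
      exact mul_comm _ _
    · intro a b _ _ ha hb
      rw [map_add, ha, hb, add_zero]
    · intro s a _ ha
      rw [hΦs, ha, map_zero]
  rw [hΦ, one_smul, map_one, Module.End.one_apply] at h1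
  exact fockVector_ne_zero p _ h1

end HighestWeightVector

/-! ### Words in homogeneous elements -/

section Letters

variable {k : Type*} [Field k] {n p : ℕ}

/-- Homogeneous elements of `𝔞`, tagged by their parity: the letters of words in `U_χ(𝔞)`. -/
abbrev Letter (𝔞 : RestrictedSubalgebra k n p) : Type _ := 𝔞.even ⊕ 𝔞.odd

variable {𝔞 : RestrictedSubalgebra k n p}

/-- The matrix of a letter. -/
def Letter.mat : Letter 𝔞 → Mat k n := Sum.elim (fun x => x.1) (fun y => y.1)

/-- The super-bracket of two letters. -/
def Letter.bracket : Letter 𝔞 → Letter 𝔞 → Letter 𝔞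
  | Sum.inl x, Sum.inl y => Sum.inl ⟨x.1 * y.1 - y.1 * x.1, 𝔞.lie_even_even _ x.2 _ y.2⟩
  | Sum.inl x, Sum.inr y => Sum.inr ⟨x.1 * y.1 - y.1 * x.1, 𝔞.lie_even_odd _ x.2 _ y.2⟩
  | Sum.inr x, Sum.inl y => Sum.inr (-⟨y.1 * x.1 - x.1 * y.1, 𝔞.lie_even_odd _ y.2 _ x.2⟩)
  | Sum.inr x, Sum.inr y => Sum.inl ⟨x.1 * y.1 + y.1 * x.1, 𝔞.lie_odd_odd _ x.2 _ y.2⟩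

/-- The sign `(-1) ^ (|x| |y|)`. -/
def Letter.sign (x y : Letter 𝔞) : k := koszul k x.isRight y.isRight

lemma Letter.sign_ne_zero (x y : Letter 𝔞) : x.sign y ≠ 0 := by
  rcases x with x | x <;> rcases y with y | y <;> simp [Letter.sign, koszul]

lemma Letter.sign_inl (x : 𝔞.even) (y : Letter 𝔞) : Letter.sign (Sum.inl x) y = 1 := by
  simp [Letter.sign, koszul]

lemma Letter.mat_bracket (x y : Letter 𝔞) :
    (x.bracket y).mat = x.mat * y.mat - x.sign y • (y.mat * x.mat) := by
  rcases x with x | x <;> rcases y with y | y <;>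
    simp [Letter.mat, Letter.bracket, Letter.sign, koszul]

variable (χ : Module.Dual k 𝔞.even)

/-- The image of a letter in `U_χ(𝔞)`. -/
def Letter.toEnv : Letter 𝔞 → RedEnv 𝔞 χ := Sum.elim (rEven 𝔞 χ) (rOdd 𝔞 χ)

/-- The extension of `χ` by zero to odd letters. -/
def Letter.char : Letter 𝔞 → k := Sum.elim χ 0

lemma redMk_envMk_rel {a b : TensorAlgebra k (𝔞.even × 𝔞.odd)} (h : EnvRel 𝔞 a b) :
    redMk 𝔞 χ (envMk 𝔞 a) = redMk 𝔞 χ (envMk 𝔞 b) :=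
  congrArg _ (RingQuot.mkAlgHom_rel k h)

/-- Letters supercommute up to their bracket. -/
lemma Letter.toEnv_mul (x y : Letter 𝔞) : x.toEnv χ * y.toEnv χ =
    x.sign y • (y.toEnv χ * x.toEnv χ) + (x.bracket y).toEnv χ := by
  rcases x with x | x <;> rcases y with y | y
  · have := redMk_envMk_rel χ (EnvRel.even_even x y)
    rw [map_sub, map_sub, map_mul, map_mul, map_mul, map_mul] at this
    rw [Letter.sign_inl, one_smul]
    exact sub_eq_iff_eq_add'.1 this
  · have := redMk_envMk_rel χ (EnvRel.even_odd x y)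
    rw [map_sub, map_sub, map_mul, map_mul, map_mul, map_mul] at this
    rw [Letter.sign_inl, one_smul]
    exact sub_eq_iff_eq_add'.1 this
  · have := redMk_envMk_rel χ (EnvRel.even_odd y x)
    rw [map_sub, map_sub, map_mul, map_mul, map_mul, map_mul] at this
    have h1 : Letter.toEnv χ (Letter.bracket (Sum.inr x) (Sum.inl y) : Letter 𝔞) =
        -rOdd 𝔞 χ ⟨y.1 * x.1 - x.1 * y.1, 𝔞.lie_even_odd _ y.2 _ x.2⟩ := map_neg _ _
    have h2 : Letter.sign (Sum.inr x : Letter 𝔞) (Sum.inl y) = 1 := by simp [Letter.sign, koszul]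
    rw [h1, h2, one_smul, ← sub_eq_add_neg]
    rw [eq_sub_iff_add_eq, ← eq_sub_iff_add_eq']
    exact this.symm
  · have := redMk_envMk_rel χ (EnvRel.odd_odd x y)
    rw [map_add, map_add, map_mul, map_mul, map_mul, map_mul] at this
    have h2 : Letter.sign (Sum.inr x : Letter 𝔞) (Sum.inr y) = -1 := by simp [Letter.sign, koszul]
    rw [h2, neg_one_smul, eq_neg_add_iff_add_eq, add_comm]
    exact this

lemma Letter.sign_mul_char (x y : Letter 𝔞) : x.sign y * x.char χ = x.char χ := by
  rcases x with x | x
  · rw [Letter.sign_inl, one_mul]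
  · simp [Letter.char]

end Letters

section FilteredWords

variable {k : Type*} [Field k] {n p : ℕ} {𝔞 : RestrictedSubalgebra k n p}
  {χ : Module.Dual k 𝔞.even}
variable {M : Type*} [AddCommGroup M] [Module (RedEnv 𝔞 χ) M]
variable {κ : Type*}

/-- The word `g a₁ ⋯ g aᵣ w` in a `U_χ(𝔞)`-module. -/
def word (χ : Module.Dual k 𝔞.even) [Module (RedEnv 𝔞 χ) M] (g : κ → Letter 𝔞) (w : M)
    (l : List κ) : M :=
  l.foldr (fun a m => (g a).toEnv χ • m) w

lemma word_nil (g : κ → Letter 𝔞) (w : M) : word χ g w [] = w := rfl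

lemma word_cons (g : κ → Letter 𝔞) (w : M) (a : κ) (l : List κ) :
    word χ g w (a :: l) = (g a).toEnv χ • word χ g w l := rfl

variable [Module k M]

/-- An increasing filtration of a module, compatible with letters `g a` of weight `wt a`: letters
raise the filtration by their weight, and brackets of letters raise it by less. -/
structure WordFiltration (χ : Module.Dual k 𝔞.even) [Module (RedEnv 𝔞 χ) M] (g : κ → Letter 𝔞)
    (wt : κ → ℕ) (w : M) (F : ℤ → Submodule k M) : Prop where
  mono : Monotone F
  base_mem : w ∈ F 0
  smul_mem : ∀ a ρ, ∀ m ∈ F ρ, (g a).toEnv χ • m ∈ F (ρ + wt a)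
  bracket_mem : ∀ a b ρ, ∀ m ∈ F ρ, ((g a).bracket (g b)).toEnv χ • m ∈ F (ρ + wt a + wt b - 1)

variable {g : κ → Letter 𝔞} {wt : κ → ℕ} {w : M} {F : ℤ → Submodule k M}

lemma WordFiltration.word_mem (h : WordFiltration χ g wt w F) (l : List κ) :
    word χ g w l ∈ F (l.map wt).sum := by
  induction l with
  | nil => exact h.base_mem
  | cons a l ih =>
    have := h.smul_mem a _ _ ih
    rw [List.map_cons, List.sum_cons, Nat.cast_add, add_comm]
    exact this

variable [IsScalarTower k (RedEnv 𝔞 χ) M]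

lemma smul_smul_toEnv (x y : Letter 𝔞) (m : M) : x.toEnv χ • y.toEnv χ • m =
    x.sign y • (y.toEnv χ • x.toEnv χ • m) + (x.bracket y).toEnv χ • m := by
  rw [smul_smul, x.toEnv_mul, add_smul, smul_assoc, smul_smul]

/-- Up to lower terms, permuting the letters of a word changes it by a sign. -/
lemma WordFiltration.perm (h : WordFiltration χ g wt w F) {l l' : List κ} (hl : l.Perm l') :
    ∃ s : k, s ≠ 0 ∧ word χ g w l - s • word χ g w l' ∈ F ((l.map wt).sum - 1) := by
  induction hl with
  | nil => exact ⟨1, one_ne_zero, by simp⟩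
  | @cons a l l' _ ih =>
    obtain ⟨s, hs, hm⟩ := ih
    refine ⟨s, hs, ?_⟩
    have := h.smul_mem a _ _ hm
    rw [word_cons, word_cons, ← smul_comm, ← smul_sub]
    refine h.mono ?_ this
    rw [List.map_cons, List.sum_cons, Nat.cast_add]
    omega
  | swap a b l =>
    refine ⟨(g b).sign (g a), Letter.sign_ne_zero _ _, ?_⟩
    rw [word_cons, word_cons, word_cons, word_cons, smul_smul_toEnv, add_sub_cancel_left]
    refine h.mono ?_ (h.bracket_mem b a _ _ (h.word_mem l))
    simp only [List.map_cons, List.sum_cons, Nat.cast_add]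
    omega
  | @trans l l' l'' h1 _ ih1 ih2 =>
    obtain ⟨s, hs, hm⟩ := ih1
    obtain ⟨s', hs', hm'⟩ := ih2
    refine ⟨s * s', mul_ne_zero hs hs', ?_⟩
    have e : word χ g w l - (s * s') • word χ g w l'' = (word χ g w l - s • word χ g w l') +
        s • (word χ g w l' - s' • word χ g w l'') := by
      rw [smul_sub, smul_smul, sub_add_sub_cancel]
    rw [e, (h1.map wt).sum_eq]
    rw [(h1.map wt).sum_eq] at hm
    exact add_mem hm (Submodule.smul_mem _ _ hm')

/-- Up to lower terms, an even letter of a word can be moved to the front. -/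
lemma WordFiltration.even_to_front [DecidableEq κ] (h : WordFiltration χ g wt w F) {a : κ}
    (ha : ∀ y, (g a).sign y = 1) {l : List κ} (hl : a ∈ l) :
    word χ g w (a :: l.erase a) - word χ g w l ∈ F ((l.map wt).sum - 1) := by
  induction l with
  | nil => simp at hl
  | cons b l ih =>
    by_cases hab : b = a
    · subst hab
      simp
    · have hal : a ∈ l := by simpa [Ne.symm hab] using hl
      have h1 := h.smul_mem b _ _ (ih hal)
      rw [List.erase_cons_tail (by simpa using hab), word_cons, word_cons, word_cons,
        smul_smul_toEnv, ha, one_smul]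
      rw [smul_sub, word_cons] at h1
      have h2 := h.bracket_mem a b _ _ (h.word_mem (l.erase a))
      have h3 : (l.map wt).sum = wt a + ((l.erase a).map wt).sum := by
        rw [((List.perm_cons_erase hal).map wt).sum_eq, List.map_cons, List.sum_cons]
      rw [add_sub_right_comm]
      refine add_mem (h.mono ?_ h1) (h.mono ?_ h2) <;>
      · rw [List.map_cons, List.sum_cons]
        omega

end FilteredWords

/-! ### Dual families and the grading -/

section Grading

variable {k : Type*} [Field k] {n : ℕ}

/-- The degrees of the basis vectors of `k^{n|n}` defining the `ℤ`-grading of `gl(n|n)`. -/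
def basisDeg : Fin n ⊕ Fin n → ℤ := Sum.elim (fun i => (n : ℤ) - 1 - i) (fun i => i + 1 - (n : ℤ))

/-- A matrix is homogeneous of degree `m` if its nonzero entries lie in positions of degree `m`. -/
def IsHomDeg (m : ℤ) (X : Mat k n) : Prop := ∀ a b, X a b ≠ 0 → basisDeg a - basisDeg b = m

lemma IsHomDeg.mul {m l : ℤ} {X Y : Mat k n} (hX : IsHomDeg m X) (hY : IsHomDeg l Y) :
    IsHomDeg (m + l) (X * Y) := by
  intro a b hab
  rw [Matrix.mul_apply] at hab
  obtain ⟨c, -, hc⟩ := Finset.exists_ne_zero_of_sum_ne_zero hab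
  have h1 := hX a c (left_ne_zero_of_mul hc)
  have h2 := hY c b (right_ne_zero_of_mul hc)
  omega

lemma IsHomDeg.sub_smul {m : ℤ} {X Y : Mat k n} (hX : IsHomDeg m X) (hY : IsHomDeg m Y) (c : k) :
    IsHomDeg m (X - c • Y) := by
  intro a b hab
  by_cases h : X a b = 0
  · refine hY a b fun h' => hab ?_
    rw [Matrix.sub_apply, Matrix.smul_apply, h, h', smul_zero, sub_zero]
  · exact hX a b h

lemma Letter.isHomDeg_bracket {p : ℕ} {𝔞 : RestrictedSubalgebra k n p} {x y : Letter 𝔞} {m l : ℤ}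
    (hx : IsHomDeg m x.mat) (hy : IsHomDeg l y.mat) : IsHomDeg (m + l) (x.bracket y).mat := by
  rw [Letter.mat_bracket]
  exact (hx.mul hy).sub_smul (add_comm m l ▸ hy.mul hx) _

end Grading

section DualFamilies

variable {k : Type*} [Field k] {n : ℕ} (p : ℕ) [Fact p.Prime] [CharP k p]

/-- Pairs `i < j` of indices. -/
abbrev IndexPair (n : ℕ) : Type := {q : Fin n × Fin n // q.1 < q.2}

/-- Indices for a basis of `𝔫₀⁻ ⊕ 𝔤₋₁`: a root vector and a skew matrix unit for each `i < j`. -/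
def NegIndex (n : ℕ) : Type := IndexPair n ⊕ IndexPair n

instance : DecidableEq (NegIndex n) := inferInstanceAs (DecidableEq (IndexPair n ⊕ IndexPair n))

instance : Fintype (NegIndex n) := inferInstanceAs (Fintype (IndexPair n ⊕ IndexPair n))

/-- The element of `𝔤₋₁` with block `C = E_{i,j} - E_{j,i}`. -/
def skewUnit (q : IndexPair n) : (peri k n p).odd :=
  ⟨Matrix.fromBlocks 0 0 (Matrix.single q.1.1 q.1.2 1 - Matrix.single q.1.2 q.1.1 1) 0,
    mem_odd_iff.2 ⟨0, _, by simp, by simp, rfl⟩⟩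

/-- The basis of `𝔫₀⁻ ⊕ 𝔤₋₁`. -/
def negLetter : NegIndex n → Letter (peri k n p) :=
  Sum.map (fun q => rootVec q.1.2 q.1.1) (skewUnit p)

/-- Minus the degree of a basis element of `𝔫₀⁻ ⊕ 𝔤₋₁`. -/
def negDepth : NegIndex n → ℕ :=
  Sum.elim (fun q => q.1.2 - q.1.1) (fun q => 2 * (n - 1) - q.1.1 - q.1.2)

/-- The matrix band dual to the root vector `E_{j,i}`: ones on the diagonal `b - a = j - i - 1` in rows
`a ≤ i`. For a matrix `z` with block `Z`, `χ([E_{j,i}, z]) = Z_{i,j-1} - Z_{i+1,j}`. -/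
def dualEvenBlock (q : IndexPair n) : Matrix (Fin n) (Fin n) k :=
  Matrix.of fun a b => if (b : ℕ) + q.1.1 + 1 = a + q.1.2 ∧ a ≤ q.1.1 then 1 else 0

/-- The symmetric matrix band dual to `E_{i,j} - E_{j,i}`: entries `-1` on the antidiagonal
`a + b = i + j + 1` in rows `i < a ≤ j`. For `z ∈ 𝔤₁` with block `Z`, the value of `χ` on the bracket
is `Z_{j+1,i} - Z_{i+1,j}`. -/
def dualOddBlock (q : IndexPair n) : Matrix (Fin n) (Fin n) k :=
  Matrix.of fun a b =>
    if (a : ℕ) + b = q.1.1 + q.1.2 + 1 ∧ q.1.1 < a ∧ a ≤ q.1.2 then -1 else 0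

lemma dualOddBlock_symm (q : IndexPair n) :
    dualOddBlock (k := k) q = (dualOddBlock q).transpose := by
  ext a b
  simp only [dualOddBlock, Matrix.of_apply, Matrix.transpose_apply, Fin.lt_def, Fin.le_def]
  congr 1
  rw [eq_iff_iff]
  omega

/-- Elements of the Borel subalgebra dual to the basis of `𝔫₀⁻ ⊕ 𝔤₋₁` under the form
`(y, z) ↦ χ([y, z])`. -/
def dualLetter : NegIndex n → Letter (peri k n p) :=
  Sum.map (fun q => ⟨evenMat k n (dualEvenBlock q), evenMat_mem p _⟩)
    (fun q => ⟨Matrix.fromBlocks 0 (dualOddBlock q) 0 0,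
      mem_odd_iff.2 ⟨_, 0, dualOddBlock_symm q, by simp, rfl⟩⟩)

lemma negDepth_pos (a : NegIndex n) : 1 ≤ negDepth a := by
  rcases a with ⟨⟨i, j⟩, h⟩ | ⟨⟨i, j⟩, h⟩
  · change (i : ℕ) < j at h
    change 1 ≤ (j : ℕ) - i
    omega
  · change (i : ℕ) < j at h
    change 1 ≤ 2 * (n - 1) - (i : ℕ) - j
    have := j.2
    omega

lemma isHomDeg_evenMat {m : ℤ} {A : Matrix (Fin n) (Fin n) k}
    (hA : ∀ i j, A i j ≠ 0 → (j : ℤ) - i = m) : IsHomDeg m (evenMat k n A) := by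
  rintro (i | i) (j | j) h
  · have := hA i j h
    simp only [basisDeg, Sum.elim_inl]
    omega
  · exact absurd rfl h
  · exact absurd rfl h
  · have := hA j i (fun h0 => h (by simp [evenMat_apply, h0]))
    simp only [basisDeg, Sum.elim_inr]
    omega

lemma isHomDeg_negLetter (a : NegIndex n) :
    IsHomDeg (-(negDepth a : ℤ)) (negLetter (k := k) p a).mat := by
  rcases a with ⟨⟨i, j⟩, h⟩ | ⟨⟨i, j⟩, h⟩
  · refine isHomDeg_evenMat fun a b hab => ?_
    have : j = a ∧ i = b := by
      by_contra hne
      exact hab (by simp [hne])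
    have h := Fin.lt_def.1 h
    simp only [negDepth, Sum.elim_inl] at *
    omega
  · rintro (a | a) (b | b) hab
    · exact absurd rfl hab
    · exact absurd rfl hab
    · have : (i = a ∧ j = b) ∨ (j = a ∧ i = b) := by
        by_contra hne
        push Not at hne
        refine hab ?_
        change Matrix.single i j (1 : k) a b - Matrix.single j i 1 a b = 0
        rw [Matrix.single_apply, Matrix.single_apply, if_neg (by tauto), if_neg (by tauto), sub_zero]
      have h := Fin.lt_def.1 h
      have := j.2
      simp only [negDepth, Sum.elim_inr, Sum.elim_inl, basisDeg] at *
      rcases ‹_ ∨ _› with ⟨rfl, rfl⟩ | ⟨rfl, rfl⟩ <;> omega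
    · exact absurd rfl hab

lemma isHomDeg_dualLetter (a : NegIndex n) :
    IsHomDeg ((negDepth a - 1 : ℕ) : ℤ) (dualLetter (k := k) p a).mat := by
  rcases a with ⟨⟨i, j⟩, h⟩ | ⟨⟨i, j⟩, h⟩
  · refine isHomDeg_evenMat fun a b hab => ?_
    have : (b : ℕ) + i + 1 = a + j ∧ a ≤ i := by
      by_contra hne
      exact hab (by simp [dualEvenBlock, hne])
    have h := Fin.lt_def.1 h
    simp only [negDepth, Sum.elim_inl] at *
    omega
  · rintro (a | a) (b | b) hab
    · exact absurd rfl hab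
    · have : (a : ℕ) + b = i + j + 1 ∧ i < a ∧ a ≤ j := by
        by_contra hne
        exact hab (if_neg hne)
      have h := Fin.lt_def.1 h
      have := j.2
      simp only [negDepth, Sum.elim_inr, Sum.elim_inl, basisDeg] at *
      omega
    · exact absurd rfl hab
    · exact absurd rfl hab

variable {p} {χ : Module.Dual k (peri k n p).even}

/-- `χ` is the sum of the subdiagonal entries of the block `A`. -/
lemma IsStandardRegularNilpotent.apply_evenMat (hχ : IsStandardRegularNilpotent χ)
    (A : Matrix (Fin n) (Fin n) k)
    (hA : evenMat k n A ∈ (peri k n p).even) :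
    χ ⟨evenMat k n A, hA⟩ = ∑ i : Fin n, ∑ j : Fin n, if (i : ℕ) = j + 1 then A i j else 0 := by
  have h : (⟨evenMat k n A, hA⟩ : (peri k n p).even) = ∑ i, ∑ j, A i j • rootVec i j := by
    ext1
    simp only [AddSubmonoidClass.coe_finsetSum, Submodule.coe_smul, rootVec, ← map_smul, ← map_sum]
    congr 1
    conv_lhs => rw [Matrix.matrix_eq_sum_single A]
    simp [Matrix.smul_single]
  rw [h]
  simp only [map_sum, map_smul, hχ.apply_rootVec, smul_eq_mul, mul_ite, mul_one, mul_zero]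

/-- The character `χ` lives in degree `-1`. -/
lemma IsStandardRegularNilpotent.char_eq_zero (hχ : IsStandardRegularNilpotent χ)
    {x : Letter (peri k n p)} {m : ℤ}
    (hx : IsHomDeg m x.mat) (hm : m ≠ -1) : x.char χ = 0 := by
  rcases x with ⟨x, hx'⟩ | x
  · obtain ⟨A, rfl⟩ := mem_even_iff.1 hx'
    refine (hχ.apply_evenMat A hx').trans
      (Finset.sum_eq_zero fun i _ => Finset.sum_eq_zero fun j _ => ?_)
    split_ifs with h
    · by_contra hA
      have := hx (Sum.inl i) (Sum.inl j) hA
      simp only [basisDeg, Sum.elim_inl] at this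
      omega
    · rfl
  · rfl

/-- The families `negLetter` and `dualLetter` are dual under `(y, z) ↦ χ([y, z])`. -/
lemma IsStandardRegularNilpotent.char_bracket_dual (hχ : IsStandardRegularNilpotent χ)
    (a b : NegIndex n) :
    ((negLetter p a).bracket (dualLetter p b)).char χ = if a = b then 1 else 0 := by
  have hsum : ∀ (j : Fin n) (f : Fin n → k), (∑ a : Fin n, if (a : ℕ) = j + 1 then f a else 0) =
      if h : (j : ℕ) + 1 < n then f ⟨j + 1, h⟩ else 0 := by
    intro j f
    split_ifs with h
    · rw [Finset.sum_eq_single ⟨j + 1, h⟩]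
      · simp
      · intro b _ hb
        rw [if_neg fun h' => hb (Fin.ext h')]
      · simp
    · exact Finset.sum_eq_zero fun a _ => if_neg (by have := a.2; omega)
  rcases a with ⟨⟨i, j⟩, h⟩ | ⟨⟨i, j⟩, h⟩ <;> rcases b with ⟨⟨i', j'⟩, h'⟩ | ⟨⟨i', j'⟩, h'⟩
  · have h := Fin.lt_def.1 h
    have h' := Fin.lt_def.1 h'
    dsimp only at h h'
    have hj := j.2
    have e : ∀ hm, χ ⟨evenMat k n (Matrix.single j i 1) *
        evenMat k n (dualEvenBlock ⟨(i', j'), h'⟩) - evenMat k n (dualEvenBlock ⟨(i', j'), h'⟩) *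
        evenMat k n (Matrix.single j i 1), hm⟩ =
        if (Sum.inl ⟨(i, j), h⟩ : NegIndex n) = Sum.inl ⟨(i', j'), h'⟩ then 1 else 0 := by
      rw [evenMat_lie]
      intro hm
      obtain ⟨b, hb⟩ : ∃ b : Fin n, (b : ℕ) + 1 = j := ⟨⟨j - 1, by omega⟩, by dsimp only; omega⟩
      rw [hχ.apply_evenMat]
      have e1 : ∀ a c : Fin n, (if (a : ℕ) = c + 1 then (Matrix.single j i 1 *
          dualEvenBlock ⟨(i', j'), h'⟩ - dualEvenBlock ⟨(i', j'), h'⟩ * Matrix.single j i 1 :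
            Matrix (Fin n) (Fin n) k) a c else 0) =
          (if j = a then if b = c then dualEvenBlock ⟨(i', j'), h'⟩ i b else 0 else 0) -
          (if i = c then if (a : ℕ) = i + 1 then dualEvenBlock ⟨(i', j'), h'⟩ a j else 0 else 0) := by
        intro a c
        rw [Matrix.sub_apply]
        by_cases ha : j = a
        · subst ha
          rw [Matrix.single_mul_apply_same, one_mul]
          by_cases hc : i = c
          · subst hc
            rw [Matrix.mul_single_apply_same, mul_one]
            by_cases hbc : b = i
            · subst hbc
              simp [hb]
            · have : ¬ (j : ℕ) = i + 1 := fun h0 => hbc (Fin.ext (by omega))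
              simp [hbc, this]
          · rw [Matrix.mul_single_apply_of_ne _ _ _ _ _ (Ne.symm hc)]
            by_cases hbc : b = c
            · subst hbc
              simp [hb, hc]
            · have : ¬ (j : ℕ) = c + 1 := fun h0 => hbc (Fin.ext (by omega))
              simp [hbc, hc, this]
        · rw [Matrix.single_mul_apply_of_ne _ _ _ _ _ (Ne.symm ha)]
          by_cases hc : i = c
          · subst hc
            rw [Matrix.mul_single_apply_same, mul_one]
            simp only [ha, if_false, if_true, zero_sub]
            split_ifs <;> simp
          · rw [Matrix.mul_single_apply_of_ne _ _ _ _ _ (Ne.symm hc)]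
            simp [ha, hc]
      simp only [e1, Finset.sum_sub_distrib, Finset.sum_ite_eq, Finset.mem_univ, if_true]
      rw [Finset.sum_eq_single j (fun a _ ha => by simp [ha.symm]) (by simp)]
      simp only [if_true, Finset.sum_ite_eq, Finset.mem_univ, hsum]
      rw [dif_pos (by omega)]
      simp only [dualEvenBlock, Matrix.of_apply, Fin.le_def, Sum.inl.injEq, Subtype.mk.injEq,
        Prod.mk.injEq, Fin.ext_iff]
      split_ifs <;> first | (simp; done) | (exfalso; omega)
    exact e _
  · simp [negLetter, dualLetter, Letter.bracket, Letter.char]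
  · simp [negLetter, dualLetter, Letter.bracket, Letter.char]
  · have h := Fin.lt_def.1 h
    have h' := Fin.lt_def.1 h'
    dsimp only at h h'
    have hj := j.2
    have e : ∀ hm, χ ⟨Matrix.fromBlocks 0 0 (Matrix.single i j 1 - Matrix.single j i 1) 0 *
        Matrix.fromBlocks 0 (dualOddBlock ⟨(i', j'), h'⟩) 0 0 +
        Matrix.fromBlocks 0 (dualOddBlock ⟨(i', j'), h'⟩) 0 0 *
        Matrix.fromBlocks 0 0 (Matrix.single i j 1 - Matrix.single j i 1) 0, hm⟩ =
        if (Sum.inr ⟨(i, j), h⟩ : NegIndex n) = Sum.inr ⟨(i', j'), h'⟩ then 1 else 0 := by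
      rw [odd_odd_lie _ _ _ _ (by simp) (by simp) (dualOddBlock_symm _) (by simp), zero_mul, zero_add]
      intro hm
      rw [hχ.apply_evenMat]
      have e1 : ∀ a c : Fin n, (if (a : ℕ) = c + 1 then (dualOddBlock ⟨(i', j'), h'⟩ *
            (Matrix.single i j 1 - Matrix.single j i 1) : Matrix (Fin n) (Fin n) k) a c else 0) =
          (if j = c then if (a : ℕ) = j + 1 then dualOddBlock ⟨(i', j'), h'⟩ a i else 0 else 0) -
          (if i = c then if (a : ℕ) = i + 1 then dualOddBlock ⟨(i', j'), h'⟩ a j else 0 else 0) := by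
        intro a c
        rw [mul_sub, Matrix.sub_apply]
        by_cases hc : j = c
        · subst hc
          have hij : j ≠ i := fun h0 => by subst h0; omega
          rw [Matrix.mul_single_apply_same, Matrix.mul_single_apply_of_ne _ _ _ _ _ hij]
          simp [Ne.symm hij]
        · rw [Matrix.mul_single_apply_of_ne _ _ _ _ _ (Ne.symm hc)]
          by_cases hc' : i = c
          · subst hc'
            rw [Matrix.mul_single_apply_same]
            simp only [hc, if_false, if_true, mul_one, zero_sub]
            split_ifs <;> simp
          · rw [Matrix.mul_single_apply_of_ne _ _ _ _ _ (Ne.symm hc')]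
            simp [hc, hc']
      simp only [e1, Finset.sum_sub_distrib, Finset.sum_ite_eq, Finset.mem_univ, if_true, hsum]
      rw [dif_pos (show (i : ℕ) + 1 < n by omega)]
      simp only [dualOddBlock, Matrix.of_apply, Fin.le_def, Fin.lt_def, Sum.inr.injEq,
        Subtype.mk.injEq, Prod.mk.injEq, Fin.ext_iff]
      split_ifs <;> first | (simp; done) | (exfalso; omega)
    exact e _

end DualFamilies

/-! ### Decomposition of `𝔤` -/

section Decomposition

variable {k : Type*} [Field k] {n : ℕ}

lemma sum_single_lower_apply (A : Matrix (Fin n) (Fin n) k) (a b : Fin n) :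
    (∑ q : IndexPair n, A q.1.2 q.1.1 • Matrix.single q.1.2 q.1.1 (1 : k)) a b =
      if b < a then A a b else 0 := by
  rw [Matrix.sum_apply]
  split_ifs with h
  · rw [Finset.sum_eq_single ⟨(b, a), h⟩]
    · simp
    · rintro ⟨⟨i, j⟩, hij⟩ _ hne
      have : ¬ (j = a ∧ i = b) := by
        rintro ⟨rfl, rfl⟩
        exact hne rfl
      simp [this]
    · simp
  · refine Finset.sum_eq_zero ?_
    rintro ⟨⟨i, j⟩, hij⟩ _
    have : ¬ (j = a ∧ i = b) := by
      rintro ⟨rfl, rfl⟩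
      exact h hij
    simp [this]

lemma sum_single_upper_apply (A : Matrix (Fin n) (Fin n) k) (a b : Fin n) :
    (∑ q : IndexPair n, A q.1.1 q.1.2 • Matrix.single q.1.1 q.1.2 (1 : k)) a b =
      if a < b then A a b else 0 := by
  have := sum_single_lower_apply A.transpose b a
  rw [Matrix.sum_apply] at this ⊢
  rw [← Matrix.transpose_apply A, ← this]
  refine Finset.sum_congr rfl fun q _ => ?_
  simp [Matrix.single_apply, and_comm]

lemma sum_skewUnit_eq (h2 : (2 : k) ≠ 0) {C : Matrix (Fin n) (Fin n) k} (hC : C = -C.transpose) :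
    ∑ q : IndexPair n, C q.1.1 q.1.2 •
      (Matrix.single q.1.1 q.1.2 (1 : k) - Matrix.single q.1.2 q.1.1 1) = C := by
  have hC' : ∀ a b, C a b = -C b a := fun a b => congrFun (congrFun hC a) b
  have h3 := sum_single_lower_apply C.transpose
  ext a b
  simp only [smul_sub, Finset.sum_sub_distrib, Matrix.sub_apply]
  simp only [Matrix.transpose_apply] at h3
  rw [sum_single_upper_apply, h3]
  rcases lt_trichotomy a b with h | rfl | h
  · rw [if_pos h, if_neg h.le.not_gt, sub_zero]
  · have : (2 : k) * C a a = 0 := by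
      have := hC' a a
      rw [two_mul]
      nth_rw 1 [this]
      exact neg_add_cancel _
    rw [if_neg (lt_irrefl a), sub_zero, (mul_eq_zero.1 this).resolve_left h2]
  · rw [if_neg h.le.not_gt, if_pos h, zero_sub, hC' a b]

lemma two_ne_zero_of_charP {p : ℕ} [CharP k p] (hp : 2 < p) : (2 : k) ≠ 0 := by
  have h : ((2 : ℕ) : k) ≠ 0 := by
    rw [Ne, CharP.cast_eq_zero_iff k p]
    exact Nat.not_dvd_of_pos_of_lt two_pos hp
  exact_mod_cast h

variable (p : ℕ) [Fact p.Prime] [CharP k p]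

/-- A letter lying in the Borel subalgebra. -/
def IsBorelLetter : Letter (peri k n p) → Prop :=
  Sum.elim (fun x => x.1 ∈ (borel k n p).even) (fun y => y.1 ∈ (borel k n p).odd)

/-- The exponents bounding reduced monomials: `p` for even and `2` for odd basis elements. -/
def negExp : NegIndex n → ℕ := Sum.elim (fun _ => p) (fun _ => 2)

variable {p}

variable {χ : Module.Dual k (peri k n p).even}
variable {M : Type*} [AddCommGroup M] [Module k M] [Module (RedEnv (peri k n p) χ) M]
  [IsScalarTower k (RedEnv (peri k n p) χ) M]

lemma sum_rootVec_eq (A : Matrix (Fin n) (Fin n) k) :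
    ((∑ q : IndexPair n, A q.1.2 q.1.1 • rootVec q.1.2 q.1.1 : (peri k n p).even) : Mat k n) =
      evenMat k n (∑ q : IndexPair n, A q.1.2 q.1.1 • Matrix.single q.1.2 q.1.1 (1 : k)) := by
  simp only [AddSubmonoidClass.coe_finsetSum, Submodule.coe_smul, rootVec, map_smul, map_sum]

lemma sum_skewUnit_coe (hp : 2 < p) {C : Matrix (Fin n) (Fin n) k} (hC : C = -C.transpose) :
    ((∑ q : IndexPair n, C q.1.1 q.1.2 • skewUnit p q : (peri k n p).odd) : Mat k n) =
      Matrix.fromBlocks 0 0 C 0 := by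
  conv_rhs => rw [← sum_skewUnit_eq (two_ne_zero_of_charP hp) hC]
  simp only [AddSubmonoidClass.coe_finsetSum, Submodule.coe_smul, skewUnit,
    Matrix.fromBlocks_smul, smul_zero]
  ext (a | a) (b | b) <;> simp [Matrix.sum_apply]

/-- `𝔤` is spanned by the basis of `𝔫₀⁻ ⊕ 𝔤₋₁` and the Borel subalgebra. -/
lemma toEnv_smul_mem (hp : 2 < p) (F : Submodule k M) {m : M}
    (h1 : ∀ a, (negLetter p a).toEnv χ • m ∈ F)
    (h2 : ∀ b, IsBorelLetter p b → b.toEnv χ • m ∈ F) (x : Letter (peri k n p)) :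
    x.toEnv χ • m ∈ F := by
  rcases x with ⟨x, hx⟩ | ⟨y, hy⟩
  · obtain ⟨A, rfl⟩ := mem_even_iff.1 hx
    set s : (peri k n p).even := ∑ q : IndexPair n, A q.1.2 q.1.1 • rootVec q.1.2 q.1.1 with hs
    have hb : IsBorelLetter p (Sum.inl (⟨evenMat k n A, hx⟩ - s)) := by
      change evenMat k n A - (s : Mat k n) ∈ _
      rw [hs, sum_rootVec_eq, ← map_sub]
      refine mem_borelEven_iff.2 ⟨_, fun i j hij => ?_, rfl⟩
      rw [Matrix.sub_apply, sum_single_lower_apply, if_pos hij, sub_self]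
    have e : Letter.toEnv χ (Sum.inl ⟨evenMat k n A, hx⟩ : Letter (peri k n p)) • m =
        Letter.toEnv χ (Sum.inl (⟨evenMat k n A, hx⟩ - s)) • m +
        ∑ q : IndexPair n, A q.1.2 q.1.1 • ((negLetter p (Sum.inl q)).toEnv χ • m) := by
      change rEven _ χ _ • m = rEven _ χ _ • m + ∑ q : IndexPair n, _ • (rEven _ χ _ • m)
      simp only [← smul_assoc, ← map_smul, ← Finset.sum_smul, ← map_sum, ← add_smul, ← map_add]
      rw [← hs, sub_add_cancel]
    rw [e]
    exact add_mem (h2 _ hb) (sum_mem fun q _ => F.smul_mem _ (h1 _))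
  · obtain ⟨B, C, hB, hC, rfl⟩ := mem_odd_iff.1 hy
    set s : (peri k n p).odd := ∑ q : IndexPair n, C q.1.1 q.1.2 • skewUnit p q with hs
    have hb : IsBorelLetter p (Sum.inr (⟨Matrix.fromBlocks 0 B C 0, hy⟩ - s)) := by
      change Matrix.fromBlocks 0 B C 0 - (s : Mat k n) ∈ _
      rw [hs, sum_skewUnit_coe hp hC]
      refine ⟨B, hB, ?_⟩
      ext (a | a) (b | b) <;> simp
    have e : Letter.toEnv χ (Sum.inr ⟨Matrix.fromBlocks 0 B C 0, hy⟩ : Letter (peri k n p)) • m =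
        Letter.toEnv χ (Sum.inr (⟨Matrix.fromBlocks 0 B C 0, hy⟩ - s)) • m +
        ∑ q : IndexPair n, C q.1.1 q.1.2 • ((negLetter p (Sum.inr q)).toEnv χ • m) := by
      change rOdd _ χ _ • m = rOdd _ χ _ • m + ∑ q : IndexPair n, _ • (rOdd _ χ _ • m)
      simp only [← smul_assoc, ← map_smul, ← Finset.sum_smul, ← map_sum, ← add_smul, ← map_add]
      rw [← hs, sub_add_cancel]
    rw [e]
    exact add_mem (h2 _ hb) (sum_mem fun q _ => F.smul_mem _ (h1 _))

/-- Homogeneous letters of degree `-j < 0` are combinations of the basis elements of `𝔫₀⁻ ⊕ 𝔤₋₁` of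
that degree; if these act on a vector by `χ`, so does the letter. -/
lemma toEnv_smul_eq_char_smul (hp : 2 < p) {j : ℕ} (hj : 1 ≤ j) {x : Letter (peri k n p)}
    (hx : IsHomDeg (-(j : ℤ)) x.mat) {m : M} (h : ∀ a, negDepth a = j →
      (negLetter p a).toEnv χ • m = (negLetter p a).char χ • m) :
    x.toEnv χ • m = x.char χ • m := by
  rcases x with ⟨x, hx'⟩ | ⟨y, hy⟩
  · obtain ⟨A, rfl⟩ := mem_even_iff.1 hx'
    have hdeg : ∀ a b, A a b ≠ 0 → (b : ℤ) - a = -j := by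
      intro a b hab
      have := hx (Sum.inl a) (Sum.inl b) hab
      simp only [basisDeg, Sum.elim_inl] at this
      omega
    have e : (⟨evenMat k n A, hx'⟩ : (peri k n p).even) =
        ∑ q : IndexPair n, A q.1.2 q.1.1 • rootVec q.1.2 q.1.1 := by
      refine Subtype.ext (Eq.trans ?_ (sum_rootVec_eq A).symm)
      refine congrArg (evenMat k n) ?_
      ext a b
      rw [sum_single_lower_apply]
      split_ifs with hab
      · rfl
      · by_contra h0
        have := hdeg a b h0
        rw [Fin.lt_def] at hab
        omega
    change rEven _ χ _ • m = χ _ • m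
    rw [e, map_sum, map_sum, Finset.sum_smul, Finset.sum_smul]
    refine Finset.sum_congr rfl fun q _ => ?_
    rw [map_smul, map_smul, smul_assoc, smul_assoc]
    by_cases h0 : A q.1.2 q.1.1 = 0
    · rw [h0, zero_smul, zero_smul]
    · congr 1
      refine h (Sum.inl q) ?_
      have := hdeg _ _ h0
      simp only [negDepth, Sum.elim_inl]
      omega
  · obtain ⟨B, C, hB, hC, rfl⟩ := mem_odd_iff.1 hy
    have hdeg : ∀ a b, C a b ≠ 0 → (a : ℤ) + b + 2 - 2 * n = -j := by
      intro a b hab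
      have := hx (Sum.inr a) (Sum.inl b) hab
      simp only [basisDeg, Sum.elim_inl, Sum.elim_inr] at this
      omega
    have hB0 : B = 0 := by
      ext a b
      by_contra hab
      have := hx (Sum.inl a) (Sum.inr b) hab
      simp only [basisDeg, Sum.elim_inl, Sum.elim_inr] at this
      omega
    subst hB0
    have e : (⟨Matrix.fromBlocks 0 0 C 0, hy⟩ : (peri k n p).odd) =
        ∑ q : IndexPair n, C q.1.1 q.1.2 • skewUnit p q :=
      Subtype.ext (sum_skewUnit_coe hp hC).symm
    change rOdd _ χ _ • m = (0 : k) • m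
    rw [e, map_sum, Finset.sum_smul, zero_smul]
    refine Finset.sum_eq_zero fun q _ => ?_
    rw [map_smul, smul_assoc]
    by_cases h0 : C q.1.1 q.1.2 = 0
    · rw [h0, zero_smul]
    · have h1 : rOdd _ χ (skewUnit p q) • m = (0 : k) • m := by
        refine h (Sum.inr q) ?_
        have := hdeg _ _ h0
        have := q.1.1.2
        have := q.1.2.2
        simp only [negDepth, Sum.elim_inr]
        omega
      rw [h1, zero_smul, smul_zero]

/-- Basis elements of `𝔫₀⁻ ⊕ 𝔤₋₁` have scalar powers in `U_χ(𝔤)`: root vectors have vanishing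
`p`-th matrix power, and the elements of `𝔤₋₁` have vanishing superbrackets with themselves. -/
lemma negLetter_toEnv_pow (hp : 2 < p) (a : NegIndex n) :
    (negLetter p a).toEnv χ ^ negExp p a =
      algebraMap k _ ((negLetter p a).char χ ^ negExp p a) := by
  have hp' : p.Prime := Fact.out
  rcases a with ⟨⟨i, j⟩, hij⟩ | q
  · have h := RingQuot.mkAlgHom_rel k (RedRel.intro (𝔞 := peri k n p) (χ := χ) (rootVec j i))
    change redMk _ χ _ = redMk _ χ _ at h
    rw [map_sub, map_sub, map_pow, AlgHom.commutes, map_zero] at h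
    have h0 : (⟨(rootVec (k := k) (p := p) j i).1 ^ p, (peri k n p).pow_mem _ (rootVec j i).2⟩ :
        (peri k n p).even) = 0 := by
      ext1
      change evenMat k n (Matrix.single j i 1) ^ p = 0
      rw [evenMat_pow, pow_eq_zero_of_le hp'.two_le, map_zero]
      rw [pow_two, Matrix.single_mul_single_of_ne (h := (ne_of_lt hij))]
    have h1 : redMk _ χ (uEven (peri k n p) 0) = 0 := map_zero (rEven _ χ)
    rw [h0, h1, sub_zero, sub_eq_zero] at h
    exact h
  · have h := (negLetter p (Sum.inr q)).toEnv_mul χ (negLetter p (Sum.inr q))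
    have h1 : (Letter.bracket (negLetter p (Sum.inr q)) (negLetter p (Sum.inr q))).toEnv χ = 0 := by
      change rEven _ χ _ = 0
      rw [← map_zero (rEven _ χ)]
      congr 1
      ext1
      change Matrix.fromBlocks 0 0 _ 0 * Matrix.fromBlocks 0 0 _ 0 +
        Matrix.fromBlocks 0 0 _ 0 * Matrix.fromBlocks 0 0 _ 0 = 0
      simp [Matrix.fromBlocks_multiply]
    have h2 : Letter.sign (negLetter (k := k) p (Sum.inr q)) (negLetter p (Sum.inr q)) = -1 := by
      simp [negLetter, Letter.sign, koszul]
    rw [h1, h2, add_zero, neg_one_smul, eq_neg_iff_add_eq_zero, ← two_smul k] at h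
    have h3 : (negLetter (k := k) p (Sum.inr q)).char χ = 0 := rfl
    rw [h3]
    simp only [negExp, Sum.elim_inr]
    rw [pow_two, pow_two, zero_mul, map_zero]
    exact (smul_eq_zero.1 h).resolve_left (two_ne_zero_of_charP hp)

end Decomposition

/-! ### Spanning by reduced monomials and Whittaker vectors -/

section Spanning

variable {k : Type*} [Field k] {n p : ℕ}

/-- The exponents of reduced monomials in the basis of `𝔫₀⁻ ⊕ 𝔤₋₁`, as multisets of indices. -/
def reducedMultisets (n p : ℕ) : Set (Multiset (NegIndex n)) := {s | ∀ a, s.count a < negExp p a}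

lemma finite_reducedMultisets (n p : ℕ) : (reducedMultisets n p).Finite := by
  refine (Set.finite_Iic (∑ a : NegIndex n, Multiset.replicate (negExp p a) a)).subset fun s hs => ?_
  rw [Set.mem_Iic, Multiset.le_iff_count]
  intro a
  rw [Multiset.count_sum', Finset.sum_eq_single a]
  · rw [Multiset.count_replicate_self]
    exact (hs a).le
  · intro b _ hb
    rw [Multiset.count_replicate, if_neg hb]
  · simp

variable [Fact p.Prime] [CharP k p]
variable {χ : Module.Dual k (peri k n p).even}
variable {M : Type*} [AddCommGroup M] [Module (RedEnv (peri k n p) χ) M]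

lemma word_append_replicate {κ : Type*} (g : κ → Letter (peri k n p)) (v : M) (a : κ) (m : ℕ)
    (l : List κ) : word χ g v (List.replicate m a ++ l) = (g a).toEnv χ ^ m • word χ g v l := by
  induction m with
  | zero => simp
  | succ m ih => rw [List.replicate_succ, List.cons_append, word_cons, ih, pow_succ', mul_smul]

variable [Module k M] [IsScalarTower k (RedEnv (peri k n p) χ) M]

/-- Generators of `𝔤`: the basis of `𝔫₀⁻ ⊕ 𝔤₋₁` and all letters of the Borel subalgebra. -/
def spanLetter (p : ℕ) [Fact p.Prime] [CharP k p] :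
    NegIndex n ⊕ {b : Letter (peri k n p) // IsBorelLetter p b} → Letter (peri k n p) :=
  Sum.elim (negLetter p) Subtype.val

/-- The filtration by length of words. -/
def lengthFiltration (χ : Module.Dual k (peri k n p).even) [Module (RedEnv (peri k n p) χ) M] (v : M)
    (ρ : ℤ) : Submodule k M :=
  Submodule.span k {z | ∃ l : List _, (l.length : ℤ) ≤ ρ ∧ z = word χ (spanLetter p) v l}

lemma toEnv_smul_mem_lengthFiltration (hp : 2 < p) (v : M) (x : Letter (peri k n p)) (ρ : ℤ) {m : M}
    (hm : m ∈ lengthFiltration χ v ρ) : x.toEnv χ • m ∈ lengthFiltration χ v (ρ + 1) := by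
  refine Submodule.span_induction
    (p := fun m _ => x.toEnv χ • m ∈ lengthFiltration χ v (ρ + 1)) ?_ ?_ ?_ ?_ hm
  · rintro _ ⟨l, hl, rfl⟩
    refine toEnv_smul_mem hp _ (fun a => ?_) (fun b hb => ?_) x
    · refine Submodule.subset_span ⟨Sum.inl a :: l, ?_, rfl⟩
      rw [List.length_cons]
      omega
    · refine Submodule.subset_span ⟨Sum.inr ⟨b, hb⟩ :: l, ?_, rfl⟩
      rw [List.length_cons]
      omega
  · rw [smul_zero]
    exact zero_mem _
  · intro a b _ _ ha hb
    rw [smul_add]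
    exact add_mem ha hb
  · intro c a _ ha
    rw [smul_comm]
    exact Submodule.smul_mem _ _ ha

lemma lengthFiltration_wordFiltration (hp : 2 < p) (v : M) :
    WordFiltration χ (spanLetter p) (fun _ => 1) v (lengthFiltration χ v) where
  mono := fun ρ σ h => Submodule.span_mono fun z ⟨l, hl, hz⟩ => ⟨l, hl.trans h, hz⟩
  base_mem := Submodule.subset_span ⟨[], le_rfl, rfl⟩
  smul_mem a ρ m hm := toEnv_smul_mem_lengthFiltration hp v _ ρ hm
  bracket_mem a b ρ m hm := by
    have := toEnv_smul_mem_lengthFiltration hp v ((spanLetter p a).bracket (spanLetter p b)) ρ hm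
    convert this using 2
    simp

lemma word_append_singleton {κ : Type*} (g : κ → Letter (peri k n p)) (v : M) {a : κ} {c : k}
    (hc : (g a).toEnv χ • v = c • v) (l : List κ) :
    word χ g v (l ++ [a]) = c • word χ g v l := by
  induction l with
  | nil => exact hc
  | cons b l ih => rw [List.cons_append, word_cons, word_cons, ih, smul_comm]

/-- Reduced monomials in the basis of `𝔫₀⁻ ⊕ 𝔤₋₁` span the words in a vector `v` on which the Borel
subalgebra acts by scalars: modulo shorter words, letters can be permuted; Borel letters are moved
to the right end and absorbed, and powers beyond the bound are scalars. -/
lemma word_mem_span_reduced (hp : 2 < p) {v : M}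
    (hv : ∀ b : Letter (peri k n p), IsBorelLetter p b → ∃ c : k, b.toEnv χ • v = c • v)
    (l : List (NegIndex n ⊕ {b : Letter (peri k n p) // IsBorelLetter p b})) :
    word χ (spanLetter p) v l ∈ Submodule.span k
      ((fun s : Multiset (NegIndex n) => word χ (negLetter p) v s.toList) ''
        reducedMultisets n p) := by
  classical
  induction hr : l.length using Nat.strong_induction_on generalizing l with
  | _ r ih =>
  subst hr
  set T := Submodule.span k ((fun s : Multiset (NegIndex n) =>
    word χ (negLetter p) v s.toList) '' reducedMultisets n p) with hT
  have hF := lengthFiltration_wordFiltration (χ := χ) hp v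
  have hlow : ∀ l', l.Perm l' → word χ (spanLetter p) v l' ∈ T → word χ (spanLetter p) v l ∈ T := by
    intro l' hl' hmem
    obtain ⟨s, -, hs⟩ := hF.perm hl'
    have h1 : word χ (spanLetter p) v l - s • word χ (spanLetter p) v l' ∈ T := by
      refine (Submodule.span_le (p := T)).2 ?_ hs
      rintro _ ⟨l'', hl'', rfl⟩
      refine ih _ ?_ l'' rfl
      simp only [List.map_const', List.sum_replicate, smul_eq_mul, mul_one] at hl''
      omega
    have := add_mem h1 (T.smul_mem s hmem)
    rwa [sub_add_cancel] at this
  -- A Borel letter is moved to the right end, where it acts by a scalar.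
  by_cases hB : ∃ b, Sum.inr b ∈ l
  · obtain ⟨b, hb⟩ := hB
    obtain ⟨t, t', rfl⟩ := List.append_of_mem hb
    refine hlow ((t ++ t') ++ [Sum.inr b])
      (List.perm_middle.trans (List.perm_append_singleton _ _).symm) ?_
    obtain ⟨c, hc⟩ := hv b.1 b.2
    rw [word_append_singleton (spanLetter p) v (a := Sum.inr b) (c := c) hc]
    refine T.smul_mem _ (ih _ ?_ _ rfl)
    simp only [List.length_append, List.length_cons]
    omega
  · obtain ⟨t, rfl⟩ : ∃ t : List (NegIndex n), t.map Sum.inl = l := by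
      refine ⟨l.filterMap Sum.getLeft?, ?_⟩
      clear ih hlow
      induction l with
      | nil => rfl
      | cons a l ih' =>
        rcases a with a | b
        · rw [List.filterMap_cons_some (b := a) (by rfl), List.map_cons, ih']
          rintro ⟨b, hb⟩
          exact hB ⟨b, List.mem_cons_of_mem _ hb⟩
        · exact absurd ⟨b, List.mem_cons_self⟩ hB
    have hmap : ∀ t : List (NegIndex n), word χ (spanLetter p) v (t.map Sum.inl) =
        word χ (negLetter p) v t := fun t => by
      induction t with
      | nil => rfl
      | cons a t ih' => rw [List.map_cons, word_cons, word_cons, ih']; rfl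
    -- A basis element occurring too often is collected at the front, where its power is a scalar.
    by_cases hred : (t : Multiset (NegIndex n)) ∈ reducedMultisets n p
    · refine hlow ((t : Multiset (NegIndex n)).toList.map Sum.inl) (List.Perm.map _ ?_) ?_
      · rw [← Multiset.coe_eq_coe, Multiset.coe_toList]
      · rw [hmap]
        exact Submodule.subset_span ⟨_, hred, rfl⟩
    · obtain ⟨a, ha⟩ : ∃ a, negExp p a ≤ (t : Multiset (NegIndex n)).count a := by
        by_contra hcon
        push Not at hcon
        exact hred hcon
      obtain ⟨u, hu⟩ := Multiset.le_iff_exists_add.1 (Multiset.le_count_iff_replicate_le.1 ha)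
      obtain ⟨t', ht'⟩ : ∃ t', t.Perm (List.replicate (negExp p a) a ++ t') := by
        refine ⟨u.toList, Multiset.coe_eq_coe.1 ?_⟩
        rw [hu, ← Multiset.coe_add, Multiset.coe_toList, Multiset.coe_replicate]
      refine hlow ((List.replicate (negExp p a) a ++ t').map Sum.inl) (ht'.map _) ?_
      rw [hmap, word_append_replicate, negLetter_toEnv_pow hp, algebraMap_smul, ← hmap]
      refine T.smul_mem _ (ih _ ?_ _ rfl)
      rw [List.length_map, List.length_map, ht'.length_eq, List.length_append, List.length_replicate]
      have : 0 < negExp p a := by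
        rcases a with a | a
        · exact (Fact.out : p.Prime).pos
        · exact two_pos
      omega

/-- A module generated by a vector on which the Borel subalgebra acts by scalars has dimension at
most the number of reduced monomials in `𝔫₀⁻ ⊕ 𝔤₋₁`. -/
lemma span_reduced_eq_top (hp : 2 < p) {v : M}
    (hv : ∀ b : Letter (peri k n p), IsBorelLetter p b → ∃ c : k, b.toEnv χ • v = c • v)
    (hgen : ∀ z : M, ∃ u : RedEnv (peri k n p) χ, u • v = z) :
    Submodule.span k ((fun s : Multiset (NegIndex n) => word χ (negLetter p) v s.toList) ''
        reducedMultisets n p) = ⊤ := by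
  rw [eq_top_iff]
  rintro z -
  obtain ⟨u, rfl⟩ := hgen z
  have hall : ∀ (u : RedEnv (peri k n p) χ) (m : M),
      m ∈ Submodule.span k (Set.range (word χ (spanLetter p) v)) →
      u • m ∈ Submodule.span k (Set.range (word χ (spanLetter p) v)) := by
    intro u
    have hlet : ∀ (x : Letter (peri k n p)) (m : M),
        m ∈ Submodule.span k (Set.range (word χ (spanLetter p) v)) →
        x.toEnv χ • m ∈ Submodule.span k (Set.range (word χ (spanLetter p) v)) := by
      intro x m hm
      refine Submodule.span_induction (p := fun m _ => x.toEnv χ • m ∈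
        Submodule.span k (Set.range (word χ (spanLetter p) v))) ?_ ?_ ?_ ?_ hm
      · rintro _ ⟨l, rfl⟩
        exact toEnv_smul_mem hp _ (fun a => Submodule.subset_span (Set.mem_range_self (Sum.inl a :: l)))
          (fun b hb => Submodule.subset_span (Set.mem_range_self (Sum.inr ⟨b, hb⟩ :: l))) x
      · rw [smul_zero]
        exact zero_mem _
      · intro a b _ _ ha hb
        rw [smul_add]
        exact add_mem ha hb
      · intro c a _ ha
        rw [smul_comm]
        exact Submodule.smul_mem _ _ ha
    induction u using redEnv_induction with
    | h_scalar c =>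
      intro m hm
      rw [algebraMap_smul]
      exact Submodule.smul_mem _ _ hm
    | h_even x => exact hlet (Sum.inl x)
    | h_odd y => exact hlet (Sum.inr y)
    | h_add a b ha hb =>
      intro m hm
      rw [add_smul]
      exact add_mem (ha m hm) (hb m hm)
    | h_mul a b ha hb =>
      intro m hm
      rw [mul_smul]
      exact ha _ (hb m hm)
  refine (Submodule.span_le.2 ?_) (hall u v (Submodule.subset_span ⟨[], rfl⟩))
  rintro _ ⟨l, rfl⟩
  exact word_mem_span_reduced hp hv l

end Spanning

section Whittaker

variable {k : Type*} [Field k] {n p : ℕ} [Fact p.Prime] [CharP k p]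
variable {χ : Module.Dual k (peri k n p).even}
variable {M : Type*} [AddCommGroup M] [Module k M] [Module (RedEnv (peri k n p) χ) M]
  [IsScalarTower k (RedEnv (peri k n p) χ) M]

/-- Every nonzero module contains a Whittaker vector, on which `𝔫₀⁻ ⊕ 𝔤₋₁` acts by `χ`. The
operators `y - χ(y)` for basis elements `y` are nilpotent; common kernels are built up one basis
element at a time, the deepest ones first. -/
lemma exists_whittaker_vector (hp : 2 < p) (hχ : IsStandardRegularNilpotent χ) [Nontrivial M] :
    ∃ w : M, w ≠ 0 ∧ ∀ a, (negLetter p a).toEnv χ • w = (negLetter p a).char χ • w := by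
  classical
  set Y : NegIndex n → M → M := fun a m =>
    (negLetter p a).toEnv χ • m - (negLetter p a).char χ • m with hY
  have hYsmul : ∀ a m, Y a m =
      ((negLetter p a).toEnv χ - algebraMap k _ ((negLetter p a).char χ)) • m := fun a m => by
    rw [sub_smul, algebraMap_smul]
  have hYnil : ∀ a, ((negLetter p a).toEnv χ - algebraMap k (RedEnv (peri k n p) χ)
      ((negLetter p a).char χ)) ^ negExp p a = 0 := by
    intro a
    rcases subsingleton_or_nontrivial (RedEnv (peri k n p) χ) with h | h
    · exact Subsingleton.elim _ _
    rcases a with a | a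
    · have : CharP (RedEnv (peri k n p) χ) p := charP_of_injective_algebraMap
        (algebraMap k (RedEnv (peri k n p) χ)).injective p
      refine (sub_pow_char_of_commute p (Algebra.commutes _ _).symm).trans ?_
      have := negLetter_toEnv_pow (χ := χ) hp (Sum.inl a)
      simp only [negExp, Sum.elim_inl] at this
      rw [this, map_pow, sub_self]
    · have := negLetter_toEnv_pow (χ := χ) hp (Sum.inr a)
      have h0 : (negLetter p (Sum.inr a)).char χ = 0 := rfl
      rw [h0, map_zero, sub_zero, this, h0, zero_pow (by simp [negExp]), map_zero]
  have hYcomm : ∀ a b m, Y a (Y b m) = (negLetter (k := k) p a).sign (negLetter p b) • Y b (Y a m) +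
      ((negLetter p a).bracket (negLetter p b)).toEnv χ • m := by
    intro a b m
    have h1 := (negLetter p a).sign_mul_char χ (negLetter p b)
    have h2 : (negLetter p a).sign (negLetter p b) * (negLetter p b).char χ =
        (negLetter p b).char χ := by
      have := (negLetter p b).sign_mul_char χ (negLetter p a)
      rwa [Letter.sign, koszul, Bool.and_comm] at this
    simp only [hY, smul_sub]
    rw [smul_smul_toEnv, smul_comm ((negLetter p a).toEnv χ) ((negLetter p b).char χ),
      smul_comm ((negLetter p b).toEnv χ) ((negLetter p a).char χ)]
    simp only [smul_smul, h1, ← mul_assoc, h2]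
    rw [mul_comm ((negLetter p b).char χ)]
    abel
  -- `P S` says that the operators `Y a`, for `a ∈ S`, have a common kernel; let `S` be maximal.
  set P : Finset (NegIndex n) → Prop := fun S => ∃ w : M, w ≠ 0 ∧ ∀ a ∈ S, Y a w = 0 with hP
  have hP0 : P ∅ := by
    obtain ⟨w, hw⟩ := exists_ne (0 : M)
    exact ⟨w, hw, by simp⟩
  obtain ⟨S, hS, hmax⟩ := Finset.exists_max_image (Finset.univ.filter P) Finset.card
    ⟨∅, by simpa using hP0⟩
  have hPS : P S := (Finset.mem_filter.1 hS).2
  by_cases hSu : S = Finset.univ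
  · obtain ⟨w, hw, hw'⟩ := hPS
    exact ⟨w, hw, fun a => sub_eq_zero.1 (hw' a (by simp [hSu]))⟩
  exfalso
  -- Otherwise add to `S` an index `i` of largest depth. As brackets are deeper than `i`, they act by
  -- `χ`, and therefore by `0`, on the common kernel, which is thus stable under `Y i`.
  obtain ⟨i, hi, himax⟩ := Finset.exists_max_image Sᶜ negDepth
    (Finset.nonempty_iff_ne_empty.2 (by simpa using hSu))
  have hiS : i ∉ S := by simpa using hi
  have hdeep : ∀ t, negDepth i < negDepth t → t ∈ S := by
    intro t ht
    by_contra htS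
    exact absurd (himax t (by simpa using htS)) (by omega)
  have hstable : ∀ m : M, (∀ a ∈ S, Y a m = 0) → ∀ a ∈ S, Y a (Y i m) = 0 := by
    intro m hm a ha
    have hYi0 : Y i 0 = 0 := by simp [hY]
    rw [hYcomm, hm a ha, hYi0, smul_zero, zero_add]
    have hd := negDepth_pos a
    have hd' := negDepth_pos i
    have hdeg : IsHomDeg (-((negDepth a + negDepth i : ℕ) : ℤ))
        ((negLetter (k := k) p a).bracket (negLetter p i)).mat := by
      have := Letter.isHomDeg_bracket (isHomDeg_negLetter (k := k) p a) (isHomDeg_negLetter p i)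
      rwa [← neg_add, ← Nat.cast_add] at this
    rw [toEnv_smul_eq_char_smul hp (by omega) hdeg, hχ.char_eq_zero hdeg (by omega), zero_smul]
    intro t ht
    exact sub_eq_zero.1 (hm t (hdeep t (by omega)))
  obtain ⟨w, hw, hwS⟩ := hPS
  have hiter : ∀ m, ∀ a ∈ S, Y a ((Y i)^[m] w) = 0 := by
    intro m
    induction m with
    | zero => exact hwS
    | succ m ih =>
      rw [Function.iterate_succ_apply']
      exact hstable _ ih
  have hzero : (Y i)^[negExp p i] w = 0 := by
    have : ∀ m, (Y i)^[m] w = ((negLetter p i).toEnv χ -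
        algebraMap k _ ((negLetter p i).char χ)) ^ m • w := by
      intro m
      induction m with
      | zero => simp
      | succ m ih => rw [Function.iterate_succ_apply', ih, hYsmul, pow_succ', mul_smul]
    rw [this, hYnil, zero_smul]
  -- The last nonzero vector among the `(Y i)^m w` contradicts the maximality of `S`.
  have hex : ∃ m, (Y i)^[m] w = 0 := ⟨_, hzero⟩
  obtain ⟨m, hm⟩ : ∃ m, Nat.find hex = m + 1 := by
    refine ⟨Nat.find hex - 1, (Nat.sub_add_cancel ?_).symm⟩
    rw [Nat.one_le_iff_ne_zero]
    intro h0
    have := Nat.find_spec hex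
    rw [h0] at this
    exact hw this
  have hPi : P (insert i S) := by
    refine ⟨(Y i)^[m] w, Nat.find_min hex (by omega), fun a ha => ?_⟩
    rcases Finset.mem_insert.1 ha with rfl | ha
    · have := Nat.find_spec hex
      rwa [hm, Function.iterate_succ_apply'] at this
    · exact hiter m a ha
  have := hmax _ (Finset.mem_filter.2 ⟨Finset.mem_univ _, hPi⟩)
  rw [Finset.card_insert_of_notMem hiS] at this
  omega

end Whittaker

/-! ### Linear independence of dual words -/

section GradedWords

variable {k : Type*} [Field k] {n p : ℕ} [Fact p.Prime] [CharP k p]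

variable (k n p) in
/-- Homogeneous letters of `𝔤` of nonnegative degree. -/
structure GradedLetter where
  /-- The underlying element of `𝔤`. -/
  letter : Letter (peri k n p)
  /-- Its degree. -/
  deg : ℕ
  isHomDeg : IsHomDeg (deg : ℤ) letter.mat

/-- The weight `2d + 1` of a letter of degree `d`. With this choice the bracket of two letters has
weight one less than the sum of their weights. -/
def GradedLetter.wt (u : GradedLetter k n p) : ℕ := 2 * u.deg + 1

variable {M : Type*} [AddCommGroup M] [Module k M]

/-- The filtration by total weight of words in letters of nonnegative degree. -/
def weightFiltration (χ : Module.Dual k (peri k n p).even) [Module (RedEnv (peri k n p) χ) M]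
    (w : M) (ρ : ℤ) : Submodule k M :=
  Submodule.span k {z | ∃ l : List (GradedLetter k n p),
    ((l.map GradedLetter.wt).sum : ℤ) ≤ ρ ∧ z = word χ GradedLetter.letter w l}

variable {χ : Module.Dual k (peri k n p).even} [Module (RedEnv (peri k n p) χ) M]

lemma weightFiltration_eq_bot (w : M) {ρ : ℤ} (hρ : ρ < 0) : weightFiltration χ w ρ = ⊥ := by
  rw [weightFiltration, Submodule.span_eq_bot]
  rintro _ ⟨l, hl, -⟩
  omega

/-- The leading term of the commutator of `y` with a word. -/
def contraction (χ : Module.Dual k (peri k n p).even) [Module (RedEnv (peri k n p) χ) M] (w : M)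
    (y : Letter (peri k n p)) : List (GradedLetter k n p) → M
  | [] => 0
  | u :: l => (y.bracket u.letter).char χ • word χ GradedLetter.letter w l +
      y.sign u.letter • (u.letter.toEnv χ • contraction χ w y l)

variable [IsScalarTower k (RedEnv (peri k n p) χ) M]

lemma GradedLetter.toEnv_smul_mem (w : M) (u : GradedLetter k n p) {ρ : ℤ} {m : M}
    (hm : m ∈ weightFiltration χ w ρ) :
    u.letter.toEnv χ • m ∈ weightFiltration χ w (ρ + u.wt) := by
  refine Submodule.span_induction
    (p := fun m _ => u.letter.toEnv χ • m ∈ weightFiltration χ w (ρ + u.wt)) ?_ ?_ ?_ ?_ hm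
  · rintro _ ⟨l, hl, rfl⟩
    refine Submodule.subset_span ⟨u :: l, ?_, rfl⟩
    rw [List.map_cons, List.sum_cons]
    omega
  · rw [smul_zero]
    exact zero_mem _
  · intro a b _ _ ha hb
    rw [smul_add]
    exact add_mem ha hb
  · intro c a _ ha
    rw [smul_comm]
    exact Submodule.smul_mem _ _ ha

lemma weightFiltration_wordFiltration (w : M) : WordFiltration χ
    (GradedLetter.letter (k := k) (n := n) (p := p)) GradedLetter.wt w (weightFiltration χ w) where
  mono := fun ρ σ h => Submodule.span_mono fun z ⟨l, hl, hz⟩ => ⟨l, hl.trans h, hz⟩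
  base_mem := Submodule.subset_span ⟨[], le_rfl, rfl⟩
  smul_mem u ρ m hm := u.toEnv_smul_mem w hm
  bracket_mem u v ρ m hm := by
    have hdeg := Letter.isHomDeg_bracket u.isHomDeg v.isHomDeg
    rw [← Nat.cast_add] at hdeg
    have := GradedLetter.toEnv_smul_mem w ⟨_, u.deg + v.deg, hdeg⟩ hm
    convert this using 2
    simp only [GradedLetter.wt]
    push_cast
    ring

/-- If all letters of degree `-j < 0` act on `w` by `χ`, then applying `y - χ(y)` to a word, for `y`
of degree `-j`, lowers the weight by `2 j - 1`, with leading term the contraction. -/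
lemma lowering_word (hχ : IsStandardRegularNilpotent χ) {w : M}
    (hw : ∀ (j : ℕ) (y : Letter (peri k n p)), 1 ≤ j → IsHomDeg (-(j : ℤ)) y.mat →
      y.toEnv χ • w = y.char χ • w) (l : List (GradedLetter k n p)) :
    ∀ (j : ℕ) (y : Letter (peri k n p)), 1 ≤ j → IsHomDeg (-(j : ℤ)) y.mat →
      y.toEnv χ • word χ GradedLetter.letter w l - y.char χ • word χ GradedLetter.letter w l -
        contraction χ w y l ∈ weightFiltration χ w ((l.map GradedLetter.wt).sum - 2 * j) ∧
      contraction χ w y l ∈ weightFiltration χ w ((l.map GradedLetter.wt).sum - (2 * j - 1)) := by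
  have hF := weightFiltration_wordFiltration (χ := χ) w
  induction l with
  | nil =>
    intro j y hj hy
    rw [word_nil, hw j y hj hy, sub_self, contraction, sub_zero]
    exact ⟨zero_mem _, zero_mem _⟩
  | cons u l ih =>
    intro j y hj hy
    obtain ⟨h1, h2⟩ := ih j y hj hy
    set W := word χ GradedLetter.letter w l with hW
    have hWmem : W ∈ weightFiltration χ w (l.map GradedLetter.wt).sum := hF.word_mem l
    have hsum : (((u :: l).map GradedLetter.wt).sum : ℤ) =
        (l.map GradedLetter.wt).sum + (2 * u.deg + 1) := by
      rw [List.map_cons, List.sum_cons, GradedLetter.wt]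
      push_cast
      ring
    have hbr := Letter.isHomDeg_bracket hy u.isHomDeg
    rw [hsum]
    constructor
    · have e : y.toEnv χ • word χ GradedLetter.letter w (u :: l) -
          y.char χ • word χ GradedLetter.letter w (u :: l) - contraction χ w y (u :: l) =
          y.sign u.letter • (u.letter.toEnv χ • (y.toEnv χ • W - y.char χ • W - contraction χ w y l))
          + ((y.bracket u.letter).toEnv χ • W - (y.bracket u.letter).char χ • W) := by
        rw [contraction, word_cons, smul_smul_toEnv, ← hW]
        simp only [smul_sub]
        rw [smul_comm (u.letter.toEnv χ) (y.char χ), smul_smul (y.sign u.letter) (y.char χ),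
          Letter.sign_mul_char]
        abel
      rw [e]
      refine add_mem (Submodule.smul_mem _ _ (hF.mono ?_ (u.toEnv_smul_mem w h1))) ?_
      · rw [GradedLetter.wt]
        push_cast
        omega
      -- The bracket is a letter of nonnegative degree, on which `χ` vanishes, or it is of negative
      -- degree `-(j - deg u)`, and the induction hypothesis applies.
      rcases le_or_gt j u.deg with hle | hlt
      · rw [hχ.char_eq_zero hbr (by omega), zero_smul, sub_zero]
        have hd : (-(j : ℤ) + u.deg) = ((u.deg - j : ℕ) : ℤ) := by omega
        rw [hd] at hbr
        refine hF.mono ?_ (GradedLetter.toEnv_smul_mem w ⟨_, _, hbr⟩ hWmem)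
        simp only [GradedLetter.wt]
        push_cast
        omega
      · have hd : (-(j : ℤ) + u.deg) = -((j - u.deg : ℕ) : ℤ) := by omega
        rw [hd] at hbr
        obtain ⟨h3, h4⟩ := ih (j - u.deg) _ (by omega) hbr
        have := add_mem (hF.mono (b := (l.map GradedLetter.wt).sum + (2 * (u.deg : ℤ) + 1) - 2 * j)
          (by omega) h3) (hF.mono (by omega) h4)
        rwa [sub_add_cancel] at this
    · rw [contraction]
      refine add_mem ?_ (Submodule.smul_mem _ _ (hF.mono ?_ (u.toEnv_smul_mem w h2)))
      · -- The first term is nonzero only if `j = deg u + 1`, and then `2 j - 1` is the weight of `u`.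
        by_cases hd : -(j : ℤ) + u.deg = -1
        · exact Submodule.smul_mem _ _ (hF.mono (by omega) hWmem)
        · rw [hχ.char_eq_zero hbr hd, zero_smul]
          exact zero_mem _
      · rw [GradedLetter.wt]
        push_cast
        omega

end GradedWords

section DualWords

lemma negExp_le {n p : ℕ} (hp : 2 < p) (a : NegIndex n) : negExp p a ≤ p := by
  rcases a with a | a
  · exact le_rfl
  · exact hp.le

variable {k : Type*} [Field k] {n p : ℕ} [Fact p.Prime] [CharP k p]

/-- The dual elements as graded letters. -/
def dualGraded (k : Type*) [Field k] (p : ℕ) [Fact p.Prime] [CharP k p] (a : NegIndex n) :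
    GradedLetter k n p :=
  ⟨dualLetter p a, negDepth a - 1, isHomDeg_dualLetter p a⟩

/-- The weight of the dual element with index `a`. -/
def dualWt (a : NegIndex n) : ℕ := 2 * (negDepth a - 1) + 1

lemma dualWt_eq (a : NegIndex n) : (dualWt a : ℤ) = 2 * negDepth a - 1 := by
  have := negDepth_pos a
  rw [dualWt]
  omega

lemma even_or_negExp_eq_two (a : NegIndex n) :
    ((∀ y, (negLetter (k := k) p a).sign y = 1) ∧ ∀ y, (dualLetter (k := k) p a).sign y = 1) ∨
      negExp p a = 2 := by
  rcases a with a | a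
  · exact Or.inl ⟨fun y => Letter.sign_inl _ y, fun y => Letter.sign_inl _ y⟩
  · exact Or.inr rfl

variable {M : Type*} [AddCommGroup M]
variable {χ : Module.Dual k (peri k n p).even} [Module (RedEnv (peri k n p) χ) M]

lemma word_map_dualGraded (w : M) (t : List (NegIndex n)) :
    word χ GradedLetter.letter w (t.map (dualGraded k p)) = word χ (dualLetter p) w t := by
  induction t with
  | nil => rfl
  | cons a t ih => rw [List.map_cons, word_cons, word_cons, ih]; rfl

lemma map_wt_map_dualGraded (t : List (NegIndex n)) :
    (t.map (dualGraded k p)).map GradedLetter.wt = t.map dualWt := by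
  rw [List.map_map]
  rfl

variable [Module k M]

lemma contraction_dual_cons (hχ : IsStandardRegularNilpotent χ) (w : M) (a b : NegIndex n)
    (t : List (NegIndex n)) :
    contraction χ w (negLetter p a) ((b :: t).map (dualGraded k p)) =
      (if a = b then 1 else 0 : k) • word χ (dualLetter p) w t +
      (negLetter (k := k) p a).sign (dualLetter p b) •
        ((dualLetter p b).toEnv χ • contraction χ w (negLetter p a) (t.map (dualGraded k p))) := by
  rw [List.map_cons, contraction, word_map_dualGraded, ← hχ.char_bracket_dual a b]
  rfl

lemma contraction_dual_eq_zero (hχ : IsStandardRegularNilpotent χ) (w : M) {a : NegIndex n}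
    {t : List (NegIndex n)} (ha : a ∉ t) :
    contraction χ w (negLetter p a) (t.map (dualGraded k p)) = 0 := by
  induction t with
  | nil => rfl
  | cons b t ih =>
    rw [List.mem_cons, not_or] at ha
    rw [contraction_dual_cons hχ, if_neg ha.1, ih ha.2, zero_smul, smul_zero, smul_zero, add_zero]

variable [IsScalarTower k (RedEnv (peri k n p) χ) M]

lemma dual_wordFiltration (w : M) :
    WordFiltration χ (dualLetter (n := n) p) dualWt w (weightFiltration χ w) where
  mono := (weightFiltration_wordFiltration w).mono
  base_mem := (weightFiltration_wordFiltration w).base_mem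
  smul_mem a := (weightFiltration_wordFiltration w).smul_mem (dualGraded k p a)
  bracket_mem a b :=
    (weightFiltration_wordFiltration w).bracket_mem (dualGraded k p a) (dualGraded k p b)

/-- Up to lower terms and an invertible factor, contraction with a basis element acts on reduced
words in the dual elements like a partial derivative. -/
lemma contraction_dual (hχ : IsStandardRegularNilpotent χ) (w : M) {a : NegIndex n}
    {t : List (NegIndex n)} (ht : t.count a < negExp p a) :
    ∃ ε : k, ε ≠ 0 ∧ ((∀ y, (negLetter (k := k) p a).sign y = 1) → ε = 1) ∧
      contraction χ w (negLetter p a) (t.map (dualGraded k p)) -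
        (ε * t.count a) • word χ (dualLetter p) w (t.erase a) ∈
        weightFiltration χ w ((t.map dualWt).sum - dualWt a - 1) := by
  have hF := dual_wordFiltration (χ := χ) w
  induction t with
  | nil =>
    refine ⟨1, one_ne_zero, fun _ => rfl, ?_⟩
    simp only [List.map_nil, contraction, List.count_nil, Nat.cast_zero, mul_zero, zero_smul,
      sub_zero]
    exact zero_mem _
  | cons b t ih =>
    by_cases hab : a = b
    · subst hab
      refine ⟨1, one_ne_zero, fun _ => rfl, ?_⟩
      have hsum : (((a :: t).map dualWt).sum : ℤ) - dualWt a - 1 = (t.map dualWt).sum - 1 := by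
        rw [List.map_cons, List.sum_cons]
        omega
      rw [List.count_cons_self] at ht
      rw [hsum, contraction_dual_cons hχ, if_pos rfl, List.erase_cons_head, List.count_cons_self]
      -- A repeated index is even; its letter commutes to the front up to lower terms.
      by_cases hat : a ∈ t
      · have hpos := List.count_pos_iff.2 hat
        obtain ⟨hy, hz⟩ := (even_or_negExp_eq_two (k := k) a).resolve_right (by omega)
        obtain ⟨ε, -, hε, hmem⟩ := ih (by omega)
        rw [hε hy, one_mul] at hmem
        have h1 := hF.smul_mem a _ _ hmem
        have h2 := hF.even_to_front hz hat
        have e : (1 : k) • word χ (dualLetter p) w t + (negLetter (k := k) p a).sign (dualLetter p a)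
            • ((dualLetter p a).toEnv χ • contraction χ w (negLetter p a) (t.map (dualGraded k p)))
            - (1 * ((t.count a + 1 : ℕ) : k)) • word χ (dualLetter p) w t =
            (dualLetter p a).toEnv χ • (contraction χ w (negLetter p a) (t.map (dualGraded k p)) -
              (t.count a : k) • word χ (dualLetter p) w (t.erase a)) + (t.count a : k) •
            (word χ (dualLetter p) w (a :: t.erase a) - word χ (dualLetter p) w t) := by
          rw [hy, one_mul, Nat.cast_add, Nat.cast_one, add_smul, smul_sub, smul_sub, word_cons,
            smul_comm ((dualLetter p a).toEnv χ) (t.count a : k)]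
          simp only [one_smul]
          abel
        rw [e]
        exact add_mem (hF.mono (by omega) h1) (Submodule.smul_mem _ _ h2)
      · rw [contraction_dual_eq_zero hχ w hat, List.count_eq_zero_of_not_mem hat]
        simp
    · have hba : b ≠ a := Ne.symm hab
      rw [List.count_cons_of_ne hba] at ht
      obtain ⟨ε, hε0, hε, hmem⟩ := ih ht
      refine ⟨(negLetter (k := k) p a).sign (dualLetter p b) * ε,
        mul_ne_zero (Letter.sign_ne_zero _ _) hε0, fun hy => by rw [hy, hε hy, one_mul], ?_⟩
      have h1 := hF.smul_mem b _ _ hmem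
      rw [contraction_dual_cons hχ, if_neg hab, zero_smul, zero_add, List.count_cons_of_ne hba,
        List.erase_cons_tail (by simpa using hba), word_cons, mul_assoc, mul_smul,
        ← smul_comm ((dualLetter p b).toEnv χ) (ε * _ : k), ← smul_sub, ← smul_sub]
      refine Submodule.smul_mem _ _ (hF.mono ?_ h1)
      rw [List.map_cons, List.sum_cons]
      omega

/-- The total weight of a multiset of dual elements. -/
def totalWt (s : Multiset (NegIndex n)) : ℕ := (s.map dualWt).sum

lemma sum_map_toList (s : Multiset (NegIndex n)) : (s.toList.map dualWt).sum = totalWt s := by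
  rw [totalWt]
  conv_rhs => rw [← s.coe_toList, Multiset.map_coe, Multiset.sum_coe]

lemma totalWt_erase {s : Multiset (NegIndex n)} {a : NegIndex n} (ha : a ∈ s) :
    totalWt (s.erase a) + dualWt a = totalWt s := by
  conv_rhs => rw [← Multiset.cons_erase ha, totalWt, Multiset.map_cons, Multiset.sum_cons]
  rw [totalWt, add_comm]

variable {w : M}

/-- The Whittaker condition extends from the basis of `𝔫₀⁻ ⊕ 𝔤₋₁` to all letters of negative
degree. -/
lemma whittaker_isHomDeg (hp : 2 < p)
    (hw : ∀ a, (negLetter p a).toEnv χ • w = (negLetter p a).char χ • w)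
    (j : ℕ) (y : Letter (peri k n p)) (hj : 1 ≤ j) (hy : IsHomDeg (-(j : ℤ)) y.mat) :
    y.toEnv χ • w = y.char χ • w :=
  toEnv_smul_eq_char_smul hp hj hy fun a _ => hw a

/-- Up to lower terms and an invertible factor, `y_a - χ(y_a)` acts on the reduced words in the dual
elements like a partial derivative. -/
lemma lowering_reduced (hp : 2 < p) (hχ : IsStandardRegularNilpotent χ)
    (hw : ∀ a, (negLetter p a).toEnv χ • w = (negLetter p a).char χ • w) (a : NegIndex n)
    {s : Multiset (NegIndex n)} (hs : s.count a < negExp p a) :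
    ∃ ε : k, ε ≠ 0 ∧ (negLetter p a).toEnv χ • word χ (dualLetter p) w s.toList -
      (negLetter p a).char χ • word χ (dualLetter p) w s.toList -
      (ε * s.count a) • word χ (dualLetter p) w (s.erase a).toList ∈
        weightFiltration χ w (totalWt s - dualWt a - 1) := by
  have hF := dual_wordFiltration (χ := χ) w
  have hc : s.toList.count a = s.count a := by
    rw [← Multiset.coe_count, Multiset.coe_toList]
  obtain ⟨ε, hε, -, h1⟩ := contraction_dual hχ w (a := a) (t := s.toList) (by rwa [hc])
  have h2 := (lowering_word hχ (whittaker_isHomDeg hp hw) (s.toList.map (dualGraded k p)) _ _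
    (negDepth_pos a) (isHomDeg_negLetter p a)).1
  rw [map_wt_map_dualGraded, word_map_dualGraded, sum_map_toList] at h2
  rw [hc, sum_map_toList] at h1
  have hd := dualWt_eq a
  have h3 := add_mem (hF.mono (b := (totalWt s : ℤ) - dualWt a - 1) (by omega) h2) h1
  by_cases has : a ∈ s
  · have hperm : (s.toList.erase a).Perm (s.erase a).toList := by
      rw [← Multiset.coe_eq_coe, ← Multiset.coe_erase, Multiset.coe_toList, Multiset.coe_toList]
    obtain ⟨ε', hε', h4⟩ := hF.perm hperm
    rw [(hperm.map dualWt).sum_eq, sum_map_toList] at h4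
    have hwt := totalWt_erase has
    refine ⟨ε * ε', mul_ne_zero hε hε', ?_⟩
    have h5 := add_mem h3 (Submodule.smul_mem _ (ε * s.count a) (hF.mono (by omega) h4))
    convert h5 using 1
    rw [smul_sub, smul_smul, mul_right_comm]
    abel
  · refine ⟨ε, hε, ?_⟩
    rw [Multiset.count_eq_zero_of_notMem has, Nat.cast_zero, mul_zero, zero_smul] at h3 ⊢
    convert h3 using 1
    abel

lemma lowering_mem (hp : 2 < p) (hχ : IsStandardRegularNilpotent χ)
    (hw : ∀ a, (negLetter p a).toEnv χ • w = (negLetter p a).char χ • w) (a : NegIndex n)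
    {ρ : ℤ} {m : M} (hm : m ∈ weightFiltration χ w ρ) :
    (negLetter p a).toEnv χ • m - (negLetter p a).char χ • m ∈
      weightFiltration χ w (ρ - dualWt a) := by
  have hF := weightFiltration_wordFiltration (χ := χ) w
  refine Submodule.span_induction (p := fun m _ => (negLetter p a).toEnv χ • m -
    (negLetter p a).char χ • m ∈ weightFiltration χ w (ρ - dualWt a)) ?_ ?_ ?_ ?_ hm
  · rintro _ ⟨l, hl, rfl⟩
    obtain ⟨h1, h2⟩ := lowering_word hχ (whittaker_isHomDeg hp hw) l _ _
      (negDepth_pos a) (isHomDeg_negLetter p a)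
    have hd := dualWt_eq a
    have := add_mem (hF.mono (b := ρ - dualWt a) (by omega) h1) (hF.mono (by omega) h2)
    rwa [sub_add_cancel] at this
  · rw [smul_zero, smul_zero, sub_zero]
    exact zero_mem _
  · intro x y _ _ hx hy
    rw [smul_add, smul_add, add_sub_add_comm]
    exact add_mem hx hy
  · intro c x _ hx
    rw [smul_comm, smul_comm ((negLetter p a).char χ) c, ← smul_sub]
    exact Submodule.smul_mem _ _ hx

/-- Reduced words of weight `ρ` in the dual elements, applied to a Whittaker vector, are linearly
independent modulo terms of lower weight: the operators `y - χ(y)` act on them like partial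
derivatives. -/
lemma eq_zero_of_sum_mem (hp : 2 < p) (hχ : IsStandardRegularNilpotent χ) (hw0 : w ≠ 0)
    (hw : ∀ a, (negLetter p a).toEnv χ • w = (negLetter p a).char χ • w) (ρ : ℕ)
    (T : Finset (Multiset (NegIndex n))) (c : Multiset (NegIndex n) → k)
    (hT : ∀ s ∈ T, s ∈ reducedMultisets n p ∧ totalWt s = ρ)
    (hsum : ∑ s ∈ T, c s • word χ (dualLetter p) w s.toList ∈ weightFiltration χ w (ρ - 1)) :
    ∀ s ∈ T, c s = 0 := by
  induction ρ using Nat.strong_induction_on generalizing T c with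
  | _ ρ ih =>
  intro s hs
  rcases s.empty_or_exists_mem with rfl | ⟨a, ha⟩
  · have hρ : ρ = 0 := (hT _ hs).2.symm.trans (by simp [totalWt])
    subst hρ
    have hT0 : T = {0} := by
      refine Finset.eq_singleton_iff_unique_mem.2 ⟨hs, fun t ht => ?_⟩
      rcases t.empty_or_exists_mem with rfl | ⟨b, hb⟩
      · rfl
      · have h1 := totalWt_erase hb
        rw [(hT t ht).2, dualWt] at h1
        omega
    rw [hT0, Finset.sum_singleton, weightFiltration_eq_bot w (by simp), Submodule.mem_bot,
      Multiset.toList_zero, word_nil] at hsum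
    exact (smul_eq_zero.1 hsum).resolve_right hw0
  have hex : ∀ t : Multiset (NegIndex n), ∃ ε : k, ε ≠ 0 ∧ (t ∈ reducedMultisets n p →
      (negLetter p a).toEnv χ • word χ (dualLetter p) w t.toList -
      (negLetter p a).char χ • word χ (dualLetter p) w t.toList -
      (ε * t.count a) • word χ (dualLetter p) w (t.erase a).toList ∈
        weightFiltration χ w (totalWt t - dualWt a - 1)) := by
    intro t
    by_cases ht : t ∈ reducedMultisets n p
    · obtain ⟨ε, hε, h⟩ := lowering_reduced hp hχ hw a (ht a)
      exact ⟨ε, hε, fun _ => h⟩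
    · exact ⟨1, one_ne_zero, fun h => absurd h ht⟩
  -- Applying `y_a - χ(y_a)` to the sum gives a relation of lower weight between the words with one
  -- `z_a` removed, whose coefficient at `s.erase a` is a nonzero multiple of `c s`.
  choose ε hε hlow using hex
  have hwt := totalWt_erase ha
  rw [(hT s hs).2] at hwt
  have hinj : Set.InjOn (fun t : Multiset (NegIndex n) => t.erase a)
      (T.filter (a ∈ ·) : Finset (Multiset (NegIndex n))) := by
    intro t ht t' ht' h
    rw [Finset.mem_coe, Finset.mem_filter] at ht ht'
    rw [← Multiset.cons_erase ht.2, ← Multiset.cons_erase ht'.2]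
    exact congrArg _ h
  have key := ih (totalWt (s.erase a)) (by rw [dualWt] at hwt; omega)
    ((T.filter (a ∈ ·)).image (·.erase a))
    (fun t => c (a ::ₘ t) * (ε (a ::ₘ t) * (a ::ₘ t).count a)) ?_ ?_ (s.erase a)
    (Finset.mem_image_of_mem _ (Finset.mem_filter.2 ⟨hs, ha⟩))
  · simp only [Multiset.cons_erase ha] at key
    refine (mul_eq_zero.1 key).resolve_right (mul_ne_zero (hε s) ?_)
    rw [Ne, CharP.cast_eq_zero_iff k p]
    exact Nat.not_dvd_of_pos_of_lt (Multiset.count_pos.2 ha)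
      (((hT s hs).1 a).trans_le (negExp_le hp a))
  · intro t ht
    obtain ⟨t, ht', rfl⟩ := Finset.mem_image.1 ht
    obtain ⟨htT, hat⟩ := Finset.mem_filter.1 ht'
    refine ⟨fun b => (Multiset.count_le_of_le b (Multiset.erase_le a t)).trans_lt ((hT t htT).1 b),
      ?_⟩
    have := totalWt_erase hat
    rw [(hT t htT).2] at this
    omega
  · rw [Finset.sum_image hinj]
    have h1 : ∑ t ∈ T.filter (a ∈ ·), (c (a ::ₘ t.erase a) * (ε (a ::ₘ t.erase a) *
        (a ::ₘ t.erase a).count a)) • word χ (dualLetter p) w (t.erase a).toList =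
        ∑ t ∈ T, (c t * (ε t * t.count a)) • word χ (dualLetter p) w (t.erase a).toList := by
      rw [Finset.sum_filter]
      refine Finset.sum_congr rfl fun t _ => ?_
      split_ifs with hat
      · rw [Multiset.cons_erase hat]
      · rw [Multiset.count_eq_zero_of_notMem hat, Nat.cast_zero, mul_zero, mul_zero, zero_smul]
    rw [h1]
    have h2 := lowering_mem hp hχ hw a hsum
    have h3 : ∑ t ∈ T, c t • ((negLetter p a).toEnv χ • word χ (dualLetter p) w t.toList -
        (negLetter p a).char χ • word χ (dualLetter p) w t.toList -
        (ε t * t.count a) • word χ (dualLetter p) w (t.erase a).toList) ∈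
        weightFiltration χ w ((ρ : ℤ) - 1 - dualWt a) := by
      refine sum_mem fun t ht => Submodule.smul_mem _ _ ?_
      have := hlow t (hT t ht).1
      rw [(hT t ht).2, sub_right_comm] at this
      exact this
    have h4 := sub_mem h2 h3
    have hρ : (ρ : ℤ) - 1 - dualWt a = totalWt (s.erase a) - 1 := by omega
    rw [hρ] at h4
    convert h4 using 1
    rw [Finset.smul_sum, Finset.smul_sum, ← Finset.sum_sub_distrib, ← Finset.sum_sub_distrib]
    refine Finset.sum_congr rfl fun t _ => ?_
    rw [smul_comm ((negLetter p a).toEnv χ) (c t), smul_comm ((negLetter p a).char χ) (c t),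
      ← smul_sub, ← smul_sub, sub_sub_cancel, smul_smul]

/-- Reduced words in the dual elements, applied to a Whittaker vector, are linearly independent. -/
lemma linearIndepOn_reducedMultisets (hp : 2 < p) (hχ : IsStandardRegularNilpotent χ) (hw0 : w ≠ 0)
    (hw : ∀ a, (negLetter p a).toEnv χ • w = (negLetter p a).char χ • w) :
    LinearIndepOn k (fun s : Multiset (NegIndex n) => word χ (dualLetter p) w s.toList)
      (reducedMultisets n p) := by
  classical
  have hF := dual_wordFiltration (χ := χ) w
  rw [linearIndepOn_iff']
  intro T c hT hsum
  by_contra! hcon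
  obtain ⟨s₀, hs₀, hc₀⟩ := hcon
  obtain ⟨s, hs, hmax⟩ := Finset.exists_max_image (T.filter (c · ≠ 0)) totalWt
    ⟨s₀, Finset.mem_filter.2 ⟨hs₀, hc₀⟩⟩
  obtain ⟨hsT, hcs⟩ := Finset.mem_filter.1 hs
  -- The terms of maximal weight `totalWt s` add up to an element of lower filtration.
  refine hcs (eq_zero_of_sum_mem hp hχ hw0 hw (totalWt s) (T.filter (totalWt · = totalWt s)) c
    (fun t ht => ?_) ?_ s (Finset.mem_filter.2 ⟨hsT, rfl⟩))
  · obtain ⟨h1, h2⟩ := Finset.mem_filter.1 ht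
    exact ⟨hT h1, h2⟩
  · rw [← Finset.sum_filter_add_sum_filter_not T (totalWt · = totalWt s)] at hsum
    rw [eq_neg_of_add_eq_zero_left hsum]
    refine neg_mem (sum_mem fun t ht => ?_)
    obtain ⟨h1, h2⟩ := Finset.mem_filter.1 ht
    by_cases hct : c t = 0
    · rw [hct, zero_smul]
      exact zero_mem _
    · have h3 := hmax t (Finset.mem_filter.2 ⟨h1, hct⟩)
      have h4 := hF.word_mem t.toList
      rw [sum_map_toList] at h4
      exact Submodule.smul_mem _ _ (hF.mono (by omega) h4)

end DualWords

/-! ### Irreducibility -/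

section Irreducibility

variable {k : Type*} [Field k] {n p : ℕ} [Fact p.Prime] [CharP k p]
variable {χ : Module.Dual k (peri k n p).even}

/-- A module generated by a vector on which the Borel subalgebra acts by scalars is simple or zero:
its dimension is at most the number of reduced monomials, while every nonzero submodule contains as
many linearly independent vectors. -/
lemma eq_bot_or_eq_top {M : Type*} [AddCommGroup M] [Module k M] [Module (RedEnv (peri k n p) χ) M]
    [IsScalarTower k (RedEnv (peri k n p) χ) M] (hp : 2 < p) (hχ : IsStandardRegularNilpotent χ)
    {v : M} (hv : ∀ b : Letter (peri k n p), IsBorelLetter p b → ∃ c : k, b.toEnv χ • v = c • v)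
    (hgen : ∀ z : M, ∃ u : RedEnv (peri k n p) χ, u • v = z)
    (N : Submodule (RedEnv (peri k n p) χ) M) : N = ⊥ ∨ N = ⊤ := by
  rw [or_iff_not_imp_left]
  intro hN
  have := (Submodule.nontrivial_iff_ne_bot (p := N)).2 hN
  obtain ⟨⟨w, hwN⟩, hw0, hw⟩ := exists_whittaker_vector (M := N) hp hχ
  have hw0' : w ≠ 0 := fun h => hw0 (Subtype.ext h)
  have hli := linearIndepOn_reducedMultisets hp hχ hw0' fun a => congrArg Subtype.val (hw a)
  have hspan := span_reduced_eq_top hp hv hgen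
  have hfin := finite_reducedMultisets n p
  have : Fintype (reducedMultisets n p) := hfin.fintype
  have : FiniteDimensional k M := Module.finite_def.2 (Submodule.fg_def.2 ⟨_, hfin.image _, hspan⟩)
  rw [Set.image_eq_range] at hspan
  have hcard : Fintype.card (reducedMultisets n p) = Module.finrank k M := by
    refine le_antisymm (LinearIndependent.fintype_card_le_finrank hli) ?_
    rw [← finrank_top k M, ← hspan]
    exact finrank_range_le_card _
  have htop := LinearIndependent.span_eq_top_of_card_eq_finrank' hli hcard
  have hle : (⊤ : Submodule k M) ≤ N.restrictScalars k := by
    rw [← htop, Submodule.span_le]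
    rintro _ ⟨⟨s, -⟩, rfl⟩
    change word χ (dualLetter p) w s.toList ∈ N
    induction s.toList with
    | nil => exact hwN
    | cons a l ih => exact N.smul_mem _ ih
  exact eq_top_iff.2 fun z _ => hle (Submodule.mem_top (x := z))

/-- The canonical generator of the baby Verma module. -/
def babyVermaVector (hχ : VanishesOnNPlus χ) (μ : weightSet χ) : BabyVerma χ hχ μ :=
  Submodule.Quotient.mk (1 ⊗ₜ 1)

lemma redEnvMap_smul_babyVermaVector (hχ : VanishesOnNPlus χ) (μ : weightSet χ)
    (b : RedEnv (borel k n p) (χ.comp (Submodule.inclusion borel_even_le))) :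
    redEnvMap (borel k n p) (peri k n p) borel_even_le borel_odd_le χ b • babyVermaVector hχ μ =
      borelChar χ hχ μ b • babyVermaVector hχ μ := by
  rw [babyVermaVector, ← Submodule.Quotient.mk_smul, ← Submodule.Quotient.mk_smul,
    Submodule.Quotient.eq]
  refine Submodule.subset_span ⟨1, b, 1, ?_⟩
  rw [TensorProduct.smul_tmul', smul_eq_mul, mul_one, one_mul, ← TensorProduct.tmul_smul]
  rfl

lemma exists_smul_babyVermaVector (hχ : VanishesOnNPlus χ) (μ : weightSet χ)
    (z : BabyVerma χ hχ μ) : ∃ u : RedEnv (peri k n p) χ, u • babyVermaVector hχ μ = z := by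
  obtain ⟨t, rfl⟩ := Submodule.Quotient.mk_surjective _ z
  refine ⟨TensorProduct.rid k _ t, ?_⟩
  rw [babyVermaVector, ← Submodule.Quotient.mk_smul, TensorProduct.smul_tmul', smul_eq_mul, mul_one]
  congr 1
  exact (TensorProduct.rid k _).symm_apply_apply t

lemma borelLetter_smul_babyVermaVector (hχ : VanishesOnNPlus χ) (μ : weightSet χ)
    (b : Letter (peri k n p)) (hb : IsBorelLetter p b) :
    ∃ c : k, b.toEnv χ • babyVermaVector hχ μ = c • babyVermaVector hχ μ := by
  rcases b with ⟨x, hx⟩ | ⟨y, hy⟩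
  · refine ⟨_, (redEnvMap_smul_babyVermaVector hχ μ (rEven _ _ ⟨x, hb⟩)).symm.trans ?_ |>.symm⟩
    exact congrArg (· • babyVermaVector hχ μ) (redEnvLift_rEven _ _ _ _ _ _ _)
  · refine ⟨_, (redEnvMap_smul_babyVermaVector hχ μ (rOdd _ _ ⟨y, hb⟩)).symm.trans ?_ |>.symm⟩
    exact congrArg (· • babyVermaVector hχ μ) (redEnvLift_rOdd _ _ _ _ _ _ _)

end Irreducibility

end Periplectic

end

theorem mainTheorem4 {k : Type*} [Field k] [IsAlgClosed k] (p : ℕ) [Fact p.Prime] [CharP k p]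
    (hp : 2 < p) (n : ℕ) (hn : 0 < n)
    (χ : Module.Dual k (Periplectic.peri k n p).even)
    (hχ : Periplectic.IsStandardRegularNilpotent χ)
    (μ : Periplectic.weightSet χ) :
    Periplectic.IsIrreducibleSupermodule
      (Periplectic.RedEnv (Periplectic.peri k n p) χ)
      (Periplectic.babyVermaPart χ hχ.vanishesOnNPlus μ) :=
  ⟨Periplectic.babyVerma_nontrivial hχ μ, fun N _ => Periplectic.eq_bot_or_eq_top hp hχ
    (Periplectic.borelLetter_smul_babyVermaVector hχ.vanishesOnNPlus μ)
    (Periplectic.exists_smul_babyVermaVector hχ.vanishesOnNPlus μ) N⟩
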